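/- Let $I$ be a positive definite symmetric $3\times3$ matrix (the moment of inertia tensor), $m,r>0$ (the mass and radius of Chaplygin's sphere), $\rho=mr^2$, and $e_3$ the vertical unit vector. The rotational motion of Chaplygin's sphere (a ball with center of mass at its geometric center, rolling without slipping on a horizontal plane) is the system on $\mathrm{SO}(3)\times\mathbb R^3\ni(A,\omega)$ $$\frac{dA}{dt}=A\circ(\omega\times\cdot),\qquad I\frac{d\omega}{dt}-(I\omega)\times\omega=\rho\Big(\Big\langle u,\frac{d\omega}{dt}\Big\rangle u-\frac{d\omega}{dt}\Big),\qquad u:=A^{-1}e_3 .$$ It has the integrals $$j=A\big(I\omega+\rho\,u\times(\omega\times u)\big)\in\mathbb R^3,\qquad T=\tfrac12\langle I\omega,\omega\rangle+\tfrac12\rho\,\|u\times\omega\|^2 .$$ Put $X(u)=\rho^{-1}-\langle u,(I+\rho)^{-1}u\rangle$ and introduce a new time variable $\tau$ by $\frac{d\tau}{dt}=X(u(t))^{-1/2}$. Then the rotational motion, parametrized by $\tau$, is quasi-periodic on two-dimensional analytic tori on the regular level sets of $(j,T)$, with analytic dependence on $(j,T)$. Precisely, let $\varepsilon_0=(j_0,T_0)\in\mathbb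 R^3\times\mathbb R$ be a regular value of $(j,T):\mathrm{SO}(3)\times\mathbb R^3\to\mathbb R^3\times\mathbb R$, and let $p_0$ be a point of the level set of $\varepsilon_0$. Then there exist an open neighborhood $E$ of $\varepsilon_0$ in $\mathbb R^3\times\mathbb R$, an open subset $M$ of $\mathrm{SO}(3)\times\mathbb R^3$ containing $p_0$, a real analytic diffeomorphism $\Phi:(\mathbb R^2/\mathbb Z^2)\times E\to M$ and a real analytic map $\nu:E\to\mathbb R^2$ such that: 1. $(j,T)(\Phi(x,\varepsilon))=\varepsilon$ for all $(x,\varepsilon)$, and for each $\varepsilon\in E$ the torus $\Phi((\mathbb R^2/\mathbb Z^2)\times\{\varepsilon\})$ is a connected component of the level set $\{(j,T)=\varepsilon\}$ (so for $\varepsilon=\varepsilon_0$ it is the component containing $p_0$); 2. $\Phi$ carries the vector field $(\nu(\varepsilon),0)$ to the velocity field of the rotational motion with respect to $\tau$, i.e. to $X(u)^{1/2}$ times its velocity field with respect to $t$; 3. for every rotational motion $t\mapsto\gamma(t)=(A(t),\omega(t))$, $t\in\mathbb R$, with $\gamma(0)\in M$ and every function $\tau(t)$ with $\frac{d\tau}{dt}=X(u(t))^{-1/2}$,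 there are $x\in\mathbb R^2/\mathbb Z^2$ and $\varepsilon\in E$ such that $\gamma(t)=\Phi(x+\tau(t)\,\nu(\varepsilon),\varepsilon)$ for all $t\in\mathbb R$. -/

import Mathlib

open scoped Matrix Matrix.Norms.Elementwise Topology

namespace Chaplygin

/-- Vectors of three-space. -/
abbrev Vec : Type := Fin 3 → ℝ

/-- Ambient vector space of the phase space of the rotational motion: pairs `(A, ω)`. -/
abbrev Phase : Type := Matrix (Fin 3) (Fin 3) ℝ × Vec

/-- The space of the values `(j, T)` of the integrals. -/
abbrev Param : Type := Vec × ℝ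

/-- The vertical unit vector `e₃`. -/
def e3 : Vec := ![0, 0, 1]

/-- The antisymmetric matrix of the linear map `ν ↦ ω × ν`. -/
def hat (ω : Vec) : Matrix (Fin 3) (Fin 3) ℝ :=
  !![0, -ω 2, ω 1; ω 2, 0, -ω 0; -ω 1, ω 0, 0]

theorem hat_mulVec (ω ν : Vec) : hat ω *ᵥ ν = ω ⨯₃ ν := by
  ext i
  fin_cases i <;> simp [hat, cross_apply, Matrix.mulVec, dotProduct, Fin.sum_univ_three] <;> ring

/-- The phase space `SO(3) × ℝ³` of the rotational motion. -/
def phaseSpace : Set Phase :=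
  {p | p.1 ∈ Matrix.specialOrthogonalGroup (Fin 3) ℝ}

/-- `u = A⁻¹ e₃`, the vertical direction in body coordinates. The inverse of a rotation matrix is
written as its transpose. -/
def bodyVertical (A : Matrix (Fin 3) (Fin 3) ℝ) : Vec := Aᵀ *ᵥ e3

/-- The function `X(u) = ρ⁻¹ - ⟨u, J u⟩`, with `J = (I + ρ)⁻¹`. -/
noncomputable def X (I : Matrix (Fin 3) (Fin 3) ℝ) (ρ : ℝ) (u : Vec) : ℝ :=
  ρ⁻¹ - u ⬝ᵥ ((I + ρ • (1 : Matrix (Fin 3) (Fin 3) ℝ))⁻¹ *ᵥ u)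

/-- The moment of momentum about the point of contact,
`j = A (I ω + ρ u × (ω × u))`. -/
def moment (I : Matrix (Fin 3) (Fin 3) ℝ) (ρ : ℝ) (p : Phase) : Vec :=
  p.1 *ᵥ (I *ᵥ p.2 + ρ • (bodyVertical p.1 ⨯₃ (p.2 ⨯₃ bodyVertical p.1)))

/-- The kinetic energy `T = ½ ⟨I ω, ω⟩ + ½ ρ ‖u × ω‖²`. -/
noncomputable def energy (I : Matrix (Fin 3) (Fin 3) ℝ) (ρ : ℝ) (p : Phase) : ℝ :=
  1 / 2 * ((I *ᵥ p.2) ⬝ᵥ p.2) +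
    1 / 2 * ρ * ((bodyVertical p.1 ⨯₃ p.2) ⬝ᵥ (bodyVertical p.1 ⨯₃ p.2))

/-- The map `(j, T)`. -/
noncomputable def integrals (I : Matrix (Fin 3) (Fin 3) ℝ) (ρ : ℝ) (p : Phase) : Param :=
  (moment I ρ p, energy I ρ p)

/-- The level sets of `(j, T)` in the phase space. -/
def levelSet (I : Matrix (Fin 3) (Fin 3) ℝ) (ρ : ℝ) (ε : Param) : Set Phase :=
  {p | p ∈ phaseSpace ∧ integrals I ρ p = ε}

/-- The tangent map of `(j, T)` at the point `p = (A, ω)` of `SO(3) × ℝ³` is surjective (has rank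
four). The tangent vectors are the `(A ∘ (ν × ·), δ)`, with `ν, δ ∈ ℝ³`. -/
def IsRegularPoint (I : Matrix (Fin 3) (Fin 3) ℝ) (ρ : ℝ) (p : Phase) : Prop :=
  ∀ y : Param, ∃ ν δ : Vec, fderiv ℝ (integrals I ρ) p (p.1 * hat ν, δ) = y

/-- `ε` is a regular value of `(j, T)` on `SO(3) × ℝ³`. -/
def IsRegularValue (I : Matrix (Fin 3) (Fin 3) ℝ) (ρ : ℝ) (ε : Param) : Prop :=
  ∀ p ∈ levelSet I ρ ε, IsRegularPoint I ρ p

/-- `V = (A', ω')` is the velocity of the rotational motion at `p = (A, ω)`: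
`A' = A ∘ (ω × ·)` and `I ω' - (I ω) × ω = ρ (⟨u, ω'⟩ u - ω')`. -/
def IsVelocity (I : Matrix (Fin 3) (Fin 3) ℝ) (ρ : ℝ) (p V : Phase) : Prop :=
  V.1 = p.1 * hat p.2 ∧
    I *ᵥ V.2 - (I *ᵥ p.2) ⨯₃ p.2 =
      ρ • ((bodyVertical p.1 ⬝ᵥ V.2) • bodyVertical p.1 - V.2)

/-- `t ↦ γ t = (A t, ω t)` is a rotational motion, a solution of the equations of motion. -/
def IsRotationalMotion (I : Matrix (Fin 3) (Fin 3) ℝ) (ρ : ℝ) (γ : ℝ → Phase) : Prop :=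
  ∀ t, γ t ∈ phaseSpace ∧ ∃ V, IsVelocity I ρ (γ t) V ∧ HasDerivAt γ V t

/-- The projection `ℝ² → ℝ² / ℤ²`. -/
def toTorus (x : Fin 2 → ℝ) : UnitAddTorus (Fin 2) := fun i => (x i : UnitAddCircle)

/-- `Φ` is a real analytic diffeomorphism from `(ℝ² / ℤ²) × E` onto the subset `M` of the phase
space. Analyticity of `Φ` is that of its lift to `ℝ² × E`; the inverse is analytic in the sense that
near each point of `M` it has a lift to `ℝ² × E` which is the restriction to `M` of an analytic map
on a neighborhood of that point in the ambient vector space. -/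
structure IsAnalyticDiffeo (Φ : UnitAddTorus (Fin 2) → Param → Phase) (E : Set Param)
    (M : Set Phase) : Prop where
  bijOn : Set.BijOn (fun z : UnitAddTorus (Fin 2) × Param => Φ z.1 z.2) (Set.univ ×ˢ E) M
  analytic : AnalyticOnNhd ℝ (fun z : (Fin 2 → ℝ) × Param => Φ (toTorus z.1) z.2)
    (Set.univ ×ˢ E)
  analytic_symm : ∀ p ∈ M, ∃ g : Phase → (Fin 2 → ℝ) × Param, AnalyticAt ℝ g p ∧
    ∀ᶠ q in 𝓝[M] p, (g q).2 ∈ E ∧ Φ (toTorus (g q).1) (g q).2 = q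

/-- `Φ` carries the constant vector field `(ν ε, 0)` on `(ℝ² / ℤ²) × E` to the velocity field
`dp/dτ = X(u)^{1/2} dp/dt` of the rotational motion with respect to the time variable `τ`,
where `dτ/dt = X(u)^{-1/2}`. -/
def LinearizesFlow (I : Matrix (Fin 3) (Fin 3) ℝ) (ρ : ℝ)
    (Φ : UnitAddTorus (Fin 2) → Param → Phase) (E : Set Param) (ν : Param → Fin 2 → ℝ) : Prop :=
  ∀ x : UnitAddTorus (Fin 2), ∀ ε ∈ E, ∃ V : Phase, IsVelocity I ρ (Φ x ε) V ∧
    HasDerivAt (fun s : ℝ => Φ (x + toTorus (s • ν ε)) ε)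
      (√(X I ρ (bodyVertical (Φ x ε).1)) • V) 0

end Chaplygin

/-! The mechanism is that of Liouville–Arnold, with a second commuting vector field in place of a
symplectic structure. Put η = (I + ρ)ω and w = (I + ρ)⁻¹u. Besides the velocity field `field₁` of
the motion, with angular velocity ω, there is the field `field₂` with angular velocity η, whose
ω-component is chosen such that it also conserves j and T. Vector algebra (`bracket_field`) gives X
· (D`field₂`(`field₁`) - D`field₁`(`field₂`)) = P `field₂` - Q `field₁` with P = ⟨w, u × ω⟩ and Q =
⟨w, u × η⟩, while X changes along the two fields at the rates -2P and -2Q. Hence the fields √X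
`field₁` and √X `field₂` commute (`fderiv_field_comm`): this is what the new time τ achieves.

To avoid charts on SO(3), everything is extended to the open set det A > 0 of the 12-dimensional
space of pairs (A, ω). The formulas for X, j and T are made homogeneous in u, so that conservation
and commutation hold on the whole set. The six entries of A Aᵀ are added to the integrals; this
gives a map F (`invariants`) into a 10-dimensional space, and SO(3) × ℝ³ is the part with A Aᵀ = 1.
The level sets of F are compact (`isCompact_invariants_level`), so the flows are complete. At a
regular point of (j, T) the vector η × ω is nonzero (`torque_ne_zero_of_isRegularPoint`); this makes
the two fields independent and lets them span the kernel of dF (`isRegularAt_invariants`).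

The rest is general. The local flow of an analytic field is analytic, by the implicit function
theorem for the Picard equation, and the two commuting complete flows combine to an analytic action
G of ℝ² (`exists_isAction`). Orbits are open in the regular level sets, and compactness forces the
periods at a point to be a lattice of rank two (`IsAction.exists_lattice_basis`). A basis of periods
continues analytically to nearby values of F and remains a basis (`IsAction.exists_period_lattice`).
In coordinates of this basis the orbits become ℝ²/ℤ², and ν consists of the coordinates of the
direction of the first flow (`IsAction.exists_tori`). Restriction to A Aᵀ = 1 gives the theorem. -/

section

open scoped Topology ContDiff
open Set Filter Metric

/-! ### Analytic composition operators on spaces of continuous functions -/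

namespace Nemytskii

variable {K : Type*} [TopologicalSpace K] [CompactSpace K]
  {E : Type*} [NormedAddCommGroup E] [NormedSpace ℝ E]
  {F : Type*} [NormedAddCommGroup F] [NormedSpace ℝ F]

/-- A continuous multilinear map acts pointwise on continuous functions. -/
noncomputable def liftMultilinear (K : Type*) [TopologicalSpace K] [CompactSpace K] {n : ℕ}
    (p : ContinuousMultilinearMap ℝ (fun _ : Fin n => E) F) :
    ContinuousMultilinearMap ℝ (fun _ : Fin n => C(K, E)) C(K, F) :=
  MultilinearMap.mkContinuous
    { toFun := fun x => ⟨fun s => p fun i => x i s, by fun_prop⟩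
      map_update_add' := by
        intro _ x j a b
        ext s
        have h (c : C(K, E)) :
            (fun i => Function.update x j c i s) = Function.update (fun i => x i s) j (c s) := by
          ext i
          by_cases hij : i = j
          · subst hij; simp
          · simp [hij]
        simp [h]
      map_update_smul' := by
        intro _ x j a b
        ext s
        have h (c : C(K, E)) :
            (fun i => Function.update x j c i s) = Function.update (fun i => x i s) j (c s) := by
          ext i
          by_cases hij : i = j
          · subst hij; simp
          · simp [hij]
        simp [h] }
    ‖p‖ (by
      intro x
      rw [ContinuousMap.norm_le _ (by positivity)]
      intro s
      refine (p.le_opNorm _).trans ?_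
      gcongr with i
      exact (x i).norm_coe_le_norm s)

theorem norm_liftMultilinear_le {n : ℕ}
    (p : ContinuousMultilinearMap ℝ (fun _ : Fin n => E) F) : ‖liftMultilinear K p‖ ≤ ‖p‖ :=
  MultilinearMap.mkContinuous_norm_le _ (norm_nonneg _) _

/-- Composition with a function that is analytic at `x₀` is an analytic operator on continuous
functions near the constant function `x₀`. -/
theorem exists_analyticAt_comp [CompleteSpace F] {f : E → F} {x₀ : E} (hf : AnalyticAt ℝ f x₀) :
    ∃ Φ : C(K, E) → C(K, F), AnalyticAt ℝ Φ (ContinuousMap.const K x₀) ∧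
      ∀ᶠ x in 𝓝 (ContinuousMap.const K x₀), ∀ s, Φ x s = f (x s) := by
  obtain ⟨p, r, hp⟩ := hf
  -- The Taylor coefficients of `f` act pointwise. In the sup norm this does not increase their
  -- norms, so the lifted series converges at least where that of `f` does.
  let P : FormalMultilinearSeries ℝ C(K, E) C(K, F) := fun n => liftMultilinear K (p n)
  have hrad : p.radius ≤ P.radius :=
    FormalMultilinearSeries.radius_le_of_le fun n => norm_liftMultilinear_le (p n)
  have hpos : 0 < P.radius := hp.r_pos.trans_le (hp.r_le.trans hrad)
  refine ⟨fun x => P.sum (x - ContinuousMap.const K x₀), ?_, ?_⟩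
  · have h0 := (P.hasFPowerSeriesOnBall hpos).analyticAt
    have h1 : AnalyticAt ℝ (fun x : C(K, E) => x - ContinuousMap.const K x₀)
        (ContinuousMap.const K x₀) := analyticAt_id.sub analyticAt_const
    exact AnalyticAt.fun_comp (by simpa using h0) h1
  · filter_upwards [eball_mem_nhds (ContinuousMap.const K x₀) hp.r_pos] with x hx s
    have hx' : x - ContinuousMap.const K x₀ ∈ eball (0 : C(K, E)) r := by
      simpa [edist_eq_enorm_sub] using hx
    have h1 := P.hasSum (eball_subset_eball (hp.r_le.trans hrad) hx')
    have h2 := h1.mapL (ContinuousMap.evalCLM ℝ s)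
    have h3 : x s - x₀ ∈ eball (0 : E) r := by
      have : ‖x s - x₀‖ₑ ≤ ‖x - ContinuousMap.const K x₀‖ₑ := by
        have := (x - ContinuousMap.const K x₀).norm_coe_le_norm s
        rw [← ofReal_norm, ← ofReal_norm]
        exact ENNReal.ofReal_le_ofReal (by simpa using this)
      simp only [mem_eball, edist_zero_right] at hx' ⊢
      exact this.trans_lt hx'
    have h4 := hp.hasSum h3
    rw [add_sub_cancel] at h4
    exact h2.unique h4

end Nemytskii

end

/-! ### Analytic local flows from the Picard equation -/

section

open scoped Topology ContDiff
open Set Filter Metric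

namespace AnalyticFlow

variable {N : Type*} [NormedAddCommGroup N] [NormedSpace ℝ N]

/-- The operator `x ↦ (s ↦ ∫ σ in 0..s, x σ)` on continuous functions on `[-1, 1]`. -/
noncomputable def integralOp :
    C(Icc (-1 : ℝ) 1, N) →L[ℝ] C(Icc (-1 : ℝ) 1, N) :=
  LinearMap.mkContinuous
    { toFun := fun x => ⟨fun s => ∫ σ in (0 : ℝ)..s, IccExtend (by norm_num) x σ, by
        have : Continuous fun s : ℝ => ∫ σ in (0 : ℝ)..s, IccExtend (by norm_num) x σ :=
          intervalIntegral.continuous_primitive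
            (fun a b => (x.continuous.Icc_extend' (h := by norm_num)).intervalIntegrable a b) 0
        exact this.comp continuous_subtype_val⟩
      map_add' := by
        intro x y
        ext s
        exact intervalIntegral.integral_add
          ((x.continuous.Icc_extend' (h := by norm_num)).intervalIntegrable _ _)
          ((y.continuous.Icc_extend' (h := by norm_num)).intervalIntegrable _ _)
      map_smul' := by
        intro c x
        ext s
        exact intervalIntegral.integral_smul _ _ }
    1 (by
      intro x
      rw [ContinuousMap.norm_le _ (by positivity)]
      intro s
      refine (intervalIntegral.norm_integral_le_of_norm_le_const (C := ‖x‖)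
        fun σ _ => x.norm_coe_le_norm _).trans ?_
      have hs : |(s : ℝ) - 0| ≤ 1 := by
        rw [sub_zero]
        exact abs_le.2 s.2
      nlinarith [norm_nonneg x])

theorem integralOp_apply (x : C(Icc (-1 : ℝ) 1, N)) (s : Icc (-1 : ℝ) 1) :
    integralOp x s = ∫ σ in (0 : ℝ)..s, IccExtend (by norm_num : (-1 : ℝ) ≤ 1) x σ := rfl

/-- The point `s * t` of `[-1, 1]`. -/
def mulIcc (s t : Icc (-1 : ℝ) 1) : Icc (-1 : ℝ) 1 :=
  ⟨s * t, by
    refine abs_le.1 ?_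
    rw [abs_mul]
    exact mul_le_one₀ (abs_le.2 s.2) (abs_nonneg _) (abs_le.2 t.2)⟩

/-- The path `σ ↦ x (s σ)`. -/
def rescale (s : Icc (-1 : ℝ) 1) (x : C(Icc (-1 : ℝ) 1, N)) : C(Icc (-1 : ℝ) 1, N) :=
  ⟨fun σ => x (mulIcc s σ), x.continuous.comp (by unfold mulIcc; fun_prop)⟩

/-- Substitution in the integral. It is the reason why shortening a solution of the Picard equation
gives the solution for a shorter time. -/
theorem integralOp_rescale (s σ : Icc (-1 : ℝ) 1) (x : C(Icc (-1 : ℝ) 1, N)) :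
    (s : ℝ) • integralOp (rescale s x) σ = integralOp x (mulIcc s σ) := by
  rw [integralOp_apply, integralOp_apply]
  have h1 : ∫ τ in (0 : ℝ)..σ, IccExtend (by norm_num : (-1 : ℝ) ≤ 1) (rescale s x) τ
      = ∫ τ in (0 : ℝ)..σ, IccExtend (by norm_num : (-1 : ℝ) ≤ 1) x (s * τ) := by
    refine intervalIntegral.integral_congr fun τ hτ => ?_
    have hτ' : τ ∈ Icc (-1 : ℝ) 1 :=
      (ordConnected_Icc.uIcc_subset (by simp) σ.2) hτ
    have h2 : (s : ℝ) * τ ∈ Icc (-1 : ℝ) 1 := (mulIcc s ⟨τ, hτ'⟩).2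
    simp only [IccExtend_of_mem _ _ hτ', IccExtend_of_mem _ _ h2]
    rfl
  rw [h1, intervalIntegral.smul_integral_comp_mul_left]
  simp [mulIcc]

/-- The Picard operator `x ↦ x - q - t ∫ Φ(x)`, in dependence of `t` and `q`. -/
noncomputable def picardMap (Φ : C(Icc (-1 : ℝ) 1, N) → C(Icc (-1 : ℝ) 1, N))
    (z : (ℝ × N) × C(Icc (-1 : ℝ) 1, N)) : C(Icc (-1 : ℝ) 1, N) :=
  z.2 - ContinuousLinearMap.const ℝ (Icc (-1 : ℝ) 1) z.1.2
    - z.1.1 • integralOp (Φ z.2)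

theorem picardMap_apply (Φ : C(Icc (-1 : ℝ) 1, N) → C(Icc (-1 : ℝ) 1, N)) (t : ℝ) (q : N)
    (x : C(Icc (-1 : ℝ) 1, N)) (s : Icc (-1 : ℝ) 1) :
    picardMap Φ ((t, q), x) s = x s - q - t • integralOp (Φ x) s := rfl

theorem analyticAt_picardMap {Φ : C(Icc (-1 : ℝ) 1, N) → C(Icc (-1 : ℝ) 1, N)}
    {z : (ℝ × N) × C(Icc (-1 : ℝ) 1, N)} (hΦ : AnalyticAt ℝ Φ z.2) :
    AnalyticAt ℝ (picardMap Φ) z := by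
  have h1 : AnalyticAt ℝ (fun z : (ℝ × N) × C(Icc (-1 : ℝ) 1, N) => Φ z.2) z :=
    AnalyticAt.fun_comp hΦ analyticAt_snd
  have h2 : AnalyticAt ℝ (fun z : (ℝ × N) × C(Icc (-1 : ℝ) 1, N) => integralOp (Φ z.2)) z :=
    AnalyticAt.fun_comp (g := integralOp) (f := fun z : (ℝ × N) × C(Icc (-1 : ℝ) 1, N) => Φ z.2)
      (ContinuousLinearMap.analyticAt _ _) h1
  have h3 : AnalyticAt ℝ (fun z : (ℝ × N) × C(Icc (-1 : ℝ) 1, N) => z.1.1) z :=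
    (ContinuousLinearMap.fst ℝ ℝ N ∘L ContinuousLinearMap.fst ℝ _ _).analyticAt z
  have h4 : AnalyticAt ℝ (fun z : (ℝ × N) × C(Icc (-1 : ℝ) 1, N) =>
      ContinuousLinearMap.const ℝ (Icc (-1 : ℝ) 1) z.1.2) z :=
    ((ContinuousLinearMap.const ℝ (Icc (-1 : ℝ) 1)) ∘L ContinuousLinearMap.snd ℝ ℝ N ∘L
      ContinuousLinearMap.fst ℝ _ C(Icc (-1 : ℝ) 1, N)).analyticAt z
  exact (analyticAt_snd.sub h4).sub (h3.smul h2)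

/-- Two solutions of the Picard equation are related by a rescaling of the time. -/
theorem picardMap_rescale {Y : N → N} {Φ : C(Icc (-1 : ℝ) 1, N) → C(Icc (-1 : ℝ) 1, N)}
    {t : ℝ} {q : N} {x : C(Icc (-1 : ℝ) 1, N)} (s : Icc (-1 : ℝ) 1)
    (h : picardMap Φ ((t, q), x) = 0) (h1 : ∀ σ, Φ x σ = Y (x σ))
    (h2 : ∀ σ, Φ (rescale s x) σ = Y (rescale s x σ)) :
    picardMap Φ ((s * t, q), rescale s x) = 0 := by
  ext σ
  have h3 : Φ (rescale s x) = rescale s (Φ x) := by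
    ext τ
    rw [h2]
    exact (h1 (mulIcc s τ)).symm
  have h4 := congrArg (fun y : C(Icc (-1 : ℝ) 1, N) => y (mulIcc s σ)) h
  rw [picardMap_apply, h3, mul_comm, mul_smul, integralOp_rescale]
  exact h4

/-- A solution of the Picard equation is a solution of the differential equation. -/
theorem hasDerivAt_of_picardMap_eq_zero {Y : N → N} [CompleteSpace N]
    {Φ : C(Icc (-1 : ℝ) 1, N) → C(Icc (-1 : ℝ) 1, N)}
    {t : ℝ} {q : N} {x : C(Icc (-1 : ℝ) 1, N)}
    (h : picardMap Φ ((t, q), x) = 0) (h1 : ∀ σ, Φ x σ = Y (x σ)) {s : ℝ} (hs : s ∈ Ioo (-1 : ℝ) 1) :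
    HasDerivAt (IccExtend (by norm_num : (-1 : ℝ) ≤ 1) x)
      (t • Y (x ⟨s, Ioo_subset_Icc_self hs⟩)) s := by
  have hc : Continuous (IccExtend (by norm_num : (-1 : ℝ) ≤ 1) (Φ x)) :=
    (Φ x).continuous.Icc_extend'
  have h2 := (intervalIntegral.integral_hasDerivAt_right (hc.intervalIntegrable 0 s)
    hc.aestronglyMeasurable.stronglyMeasurableAtFilter hc.continuousAt).const_smul t |>.const_add q
  rw [IccExtend_of_mem _ _ (Ioo_subset_Icc_self hs), h1] at h2
  refine h2.congr_of_eventuallyEq ?_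
  filter_upwards [isOpen_Ioo.mem_nhds hs] with τ hτ
  rw [IccExtend_of_mem _ _ (Ioo_subset_Icc_self hτ)]
  have h3 := congrArg (fun y : C(Icc (-1 : ℝ) 1, N) => y ⟨τ, Ioo_subset_Icc_self hτ⟩) h
  simp only [picardMap_apply, integralOp_apply, ContinuousMap.zero_apply, sub_sub, sub_eq_zero] at h3
  exact h3

/-- The flow of an analytic vector field exists locally and is analytic in time and initial
value. -/
theorem exists_analytic_localFlow [CompleteSpace N] {Y : N → N} {p : N} (hY : AnalyticAt ℝ Y p)
    {U : Set N} (hU : U ∈ 𝓝 p) :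
    ∃ ψ : ℝ × N → N, ∃ δ > 0, ∀ q ∈ ball p δ, ψ (0, q) = q ∧ ∀ t : ℝ, |t| < δ →
      HasDerivAt (fun s => ψ (s, q)) (Y (ψ (t, q))) t ∧ ψ (t, q) ∈ U ∧ AnalyticAt ℝ ψ (t, q) := by
  -- The unknown is the path `x(s)`, `s ∈ [-1, 1]`, that follows the flow from `q` up to time `t s`.
  -- It satisfies `x = q + t ∫ Y(x)`, an analytic equation in which time is only a parameter.
  obtain ⟨Φ, hΦ, hΦY⟩ := Nemytskii.exists_analyticAt_comp (K := Icc (-1 : ℝ) 1) hY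
  set x₀ : C(Icc (-1 : ℝ) 1, N) := ContinuousMap.const _ p with hx₀
  set u : (ℝ × N) × C(Icc (-1 : ℝ) 1, N) := ((0, p), x₀) with hu
  have hA : AnalyticAt ℝ (picardMap Φ) u := analyticAt_picardMap hΦ
  have hu0 : picardMap Φ u = 0 := by
    ext s
    simp [hu, picardMap_apply, hx₀]
  -- At `t = 0` the integral drops out and the Picard map is a translation in `x`, so the implicit
  -- function theorem applies at the constant path `p`.
  have hD : fderiv ℝ (picardMap Φ) u ∘L .inr ℝ (ℝ × N) C(Icc (-1 : ℝ) 1, N)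
      = ContinuousLinearMap.id ℝ _ := by
    have h1 : HasFDerivAt (fun x => picardMap Φ ((0, p), x))
        (fderiv ℝ (picardMap Φ) u ∘L .inr ℝ (ℝ × N) C(Icc (-1 : ℝ) 1, N)) x₀ :=
      HasFDerivAt.comp x₀ hA.differentiableAt.hasFDerivAt (hasFDerivAt_prodMk_right _ _)
    have h2 : HasFDerivAt (fun x => picardMap Φ ((0, p), x))
        (ContinuousLinearMap.id ℝ C(Icc (-1 : ℝ) 1, N)) x₀ := by
      have : (fun x => picardMap Φ ((0, p), x)) = fun x => x - x₀ := by
        ext x s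
        simp [picardMap_apply, hx₀]
      rw [this]
      exact (hasFDerivAt_id _).sub_const _
    exact h1.unique h2
  have hinv : (fderiv ℝ (picardMap Φ) u ∘L .inr ℝ (ℝ × N) C(Icc (-1 : ℝ) 1, N)).IsInvertible := by
    rw [hD]
    exact ⟨ContinuousLinearEquiv.refl ℝ _, rfl⟩
  have hC : ContDiffAt ℝ ω (picardMap Φ) u := hA.contDiffAt
  set X := hC.implicitFunction (by simp) hinv with hX
  have hXA : AnalyticAt ℝ X u.1 := (hC.contDiffAt_implicitFunction (by simp) hinv).analyticAt
  have hX0 : X u.1 = x₀ := hC.implicitFunction_apply_self (by simp) hinv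
  have hXz : ∀ᶠ z in 𝓝 u.1, picardMap Φ (z, X z) = 0 := by
    rw [← hu0]
    exact hC.eventually_apply_implicitFunction (by simp) hinv
  have hXu : ∀ᶠ v in 𝓝 u, picardMap Φ v = 0 ↔ X v.1 = v.2 := by
    rw [← hu0]
    exact hC.eventually_apply_eq_iff_implicitFunction (by simp) hinv
  obtain ⟨r, hr, hball⟩ := Metric.mem_nhds_iff.1 hU
  obtain ⟨r₁, hr₁, hunif⟩ := Metric.eventually_nhds_iff_ball.1 hXu
  obtain ⟨r₂, hr₂, hcomp⟩ := Metric.eventually_nhds_iff_ball.1 hΦY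
  set R := min r (min r₁ r₂) with hR
  have hR0 : 0 < R := by positivity
  have hclose : ∀ᶠ z in 𝓝 u.1, X z ∈ ball x₀ R := by
    have := hXA.continuousAt
    rw [ContinuousAt, hX0] at this
    exact this.eventually (ball_mem_nhds _ hR0)
  obtain ⟨η, hη, hall⟩ := Metric.eventually_nhds_iff_ball.1
    (hXz.and (hclose.and hXA.eventually_analyticAt))
  -- The centre is a constant path, hence fixed by rescaling.
  have hresc : ∀ s, ∀ x ∈ ball x₀ R, rescale s x ∈ ball x₀ R := by
    intro s x hx
    rw [mem_ball, dist_eq_norm] at hx ⊢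
    refine lt_of_le_of_lt ?_ hx
    rw [ContinuousMap.norm_le _ (norm_nonneg _)]
    intro σ
    exact (x - x₀).norm_coe_le_norm (mulIcc s σ)
  set δ := min (η / 2) (r₁ / 2) with hδ
  have hδ0 : 0 < δ := by positivity
  have hδη : δ < η := (min_le_left _ _).trans_lt (by linarith)
  have hδr : δ < r₁ := (min_le_right _ _).trans_lt (by linarith)
  have hmem : ∀ t : ℝ, |t| ≤ δ → ∀ q ∈ ball p δ, ((t, q) : ℝ × N) ∈ ball u.1 η := by
    intro t ht q hq
    rw [mem_ball, Prod.dist_eq, max_lt_iff]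
    exact ⟨by simpa [hu] using ht.trans_lt hδη, (mem_ball.1 hq).trans hδη⟩
  -- By the uniqueness in the implicit function theorem, the path for time `s δ` is the rescaled
  -- path for time `δ`. Thus the end point of the path for time `t`, which is analytic in `(t, q)`,
  -- runs along the single path `X (δ, q)` as `t` varies, and therefore solves the differential
  -- equation.
  have key : ∀ q ∈ ball p δ, ∀ s : Icc (-1 : ℝ) 1,
      X (s * δ, q) (⟨1, by simp⟩ : Icc (-1 : ℝ) 1) = X (δ, q) s := by
    intro q hq s
    have hz := hall _ (hmem δ (by rw [abs_of_pos hδ0]) q hq)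
    have hs : |(s : ℝ) * δ| ≤ δ := by
      rw [abs_mul, abs_of_pos hδ0]
      have := abs_le.2 s.2
      nlinarith
    have h1 : picardMap Φ ((s * δ, q), rescale s (X (δ, q))) = 0 :=
      picardMap_rescale (Y := Y) s hz.1
        (hcomp _ (ball_subset_ball (by simp [hR]) hz.2.1))
        (hcomp _ (ball_subset_ball (by simp [hR]) (hresc s _ hz.2.1)))
    have h2 : (((s * δ, q), rescale s (X (δ, q))) : (ℝ × N) × C(Icc (-1 : ℝ) 1, N)) ∈
        ball u r₁ := by
      rw [mem_ball, Prod.dist_eq, Prod.dist_eq, max_lt_iff, max_lt_iff]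
      refine ⟨⟨?_, (mem_ball.1 hq).trans hδr⟩, ?_⟩
      · simpa [hu] using hs.trans_lt hδr
      · exact (mem_ball.1 (hresc s _ hz.2.1)).trans_le (by simp [hR])
    have h3 := (hunif _ h2).1 h1
    rw [h3]
    change X (δ, q) (mulIcc s ⟨1, _⟩) = _
    congr 1
    exact Subtype.ext (mul_one _)
  refine ⟨fun z => X z (⟨1, by simp⟩ : Icc (-1 : ℝ) 1), δ, hδ0, fun q hq => ?_⟩
  have hz := hall _ (hmem δ (by rw [abs_of_pos hδ0]) q hq)
  have hdiv : ∀ t : ℝ, |t| < δ → t / δ ∈ Ioo (-1 : ℝ) 1 := by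
    intro t ht
    rw [mem_Ioo, ← abs_lt, abs_div, abs_of_pos hδ0]
    exact (div_lt_one hδ0).2 ht
  have key' : ∀ t : ℝ, ∀ ht : |t| < δ, X (t, q) (⟨1, by simp⟩ : Icc (-1 : ℝ) 1)
      = X (δ, q) ⟨t / δ, Ioo_subset_Icc_self (hdiv t ht)⟩ := by
    intro t ht
    rw [← key q hq]
    simp [hδ0.ne']
  refine ⟨?_, fun t ht => ⟨?_, ?_, ?_⟩⟩
  · refine (key' 0 (by simpa using hδ0)).trans ?_
    have h3 := congrArg (fun y : C(Icc (-1 : ℝ) 1, N) => y ⟨0, by simp⟩) hz.1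
    simp only [picardMap_apply, integralOp_apply, ContinuousMap.zero_apply, sub_sub, sub_eq_zero]
      at h3
    simpa using h3
  · have h1 := hasDerivAt_of_picardMap_eq_zero hz.1
      (hcomp _ (ball_subset_ball (by simp [hR]) hz.2.1)) (hdiv t ht)
    have h2 : HasDerivAt (fun t : ℝ => t / δ) δ⁻¹ t := by
      simpa using (hasDerivAt_id t).div_const δ
    have h3 := HasDerivAt.scomp t h1 h2
    rw [smul_smul, inv_mul_cancel₀ hδ0.ne', one_smul, ← key' t ht] at h3
    refine h3.congr_of_eventuallyEq ?_
    have : ∀ᶠ τ : ℝ in 𝓝 t, |τ| < δ := continuous_abs.continuousAt.eventually (gt_mem_nhds ht)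
    filter_upwards [this] with τ hτ
    rw [Function.comp_apply, IccExtend_of_mem _ _ (Ioo_subset_Icc_self (hdiv τ hτ)), ← key' τ hτ]
  · have hz := hall _ (hmem t ht.le q hq)
    refine hball ?_
    have := (X (t, q) - x₀).norm_coe_le_norm ⟨1, by simp⟩
    rw [mem_ball, dist_eq_norm]
    refine this.trans_lt ?_
    rw [← dist_eq_norm]
    exact (mem_ball.1 hz.2.1).trans_le (by simp [hR])
  · have hz := hall _ (hmem t ht.le q hq)
    exact AnalyticAt.fun_comp
      ((ContinuousMap.evalCLM ℝ (⟨1, by simp⟩ : Icc (-1 : ℝ) 1)).analyticAt _) hz.2.2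

end AnalyticFlow

end

/-! ### Uniqueness, global existence and analyticity of flows -/

section

open scoped Topology ContDiff NNReal
open Set Filter Metric

namespace AnalyticFlow

variable {N : Type*} [NormedAddCommGroup N] [NormedSpace ℝ N]

/-- Uniqueness of integral curves of locally Lipschitz time dependent vector fields. -/
theorem eqOn_of_locallyLipschitz {v : ℝ → N → N} {U : Set N} {s : Set ℝ} (hso : IsOpen s)
    (hs : IsPreconnected s)
    (hv : ∀ t ∈ s, ∀ x ∈ U, ∃ K : ℝ≥0, ∃ V ∈ 𝓝 x, ∀ᶠ τ in 𝓝 t, LipschitzOnWith K (v τ) V)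
    {γ₁ γ₂ : ℝ → N} (h₁ : ∀ t ∈ s, HasDerivAt γ₁ (v t (γ₁ t)) t ∧ γ₁ t ∈ U)
    (h₂ : ∀ t ∈ s, HasDerivAt γ₂ (v t (γ₂ t)) t) {t₀ : ℝ} (ht₀ : t₀ ∈ s)
    (heq : γ₁ t₀ = γ₂ t₀) : EqOn γ₁ γ₂ s := by
  have key : ∀ t ∈ s, γ₁ t = γ₂ t → γ₁ =ᶠ[𝓝 t] γ₂ := by
    intro t ht h
    obtain ⟨K, V, hV, hL⟩ := hv t ht (γ₁ t) (h₁ t ht).2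
    refine ODE_solution_unique_of_eventually (v := v) (s := fun _ => V) hL ?_ ?_ h
    · filter_upwards [hso.mem_nhds ht, (h₁ t ht).1.continuousAt hV] with τ hτ hτ'
      exact ⟨(h₁ τ hτ).1, hτ'⟩
    · rw [h] at hV
      filter_upwards [hso.mem_nhds ht, (h₂ t ht).continuousAt hV] with τ hτ hτ'
      exact ⟨h₂ τ hτ, hτ'⟩
  have hsub : s ⊆ {t | γ₁ =ᶠ[𝓝 t] γ₂} := by
    refine hs.subset_of_closure_inter_subset ?_ ⟨t₀, ht₀, key t₀ ht₀ heq⟩ ?_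
    · exact isOpen_setOfPred_eventually_nhds
    · rintro t ⟨htc, ht⟩
      refine key t ht ?_
      have hfr : ∃ᶠ τ in 𝓝 t, γ₁ τ - γ₂ τ = 0 :=
        (mem_closure_iff_frequently.1 htc).mono fun τ hτ => sub_eq_zero.2 hτ.eq_of_nhds
      have hcont : ContinuousAt (fun τ => γ₁ τ - γ₂ τ) t :=
        (h₁ t ht).1.continuousAt.sub (h₂ t ht).continuousAt
      by_contra hne
      exact hfr (hcont.eventually_ne (sub_ne_zero.2 hne))
  exact fun t ht => (hsub ht).eq_of_nhds

variable [CompleteSpace N]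

/-- Uniqueness of integral curves of analytic vector fields, multiplied with a function of time. -/
theorem eqOn_of_hasDerivAt_smul {Y : N → N} {U : Set N} (hY : AnalyticOnNhd ℝ Y U) {s : Set ℝ}
    (hso : IsOpen s) (hs : IsPreconnected s) {g : ℝ → ℝ} (hg : ContinuousOn g s)
    {γ₁ γ₂ : ℝ → N} (h₁ : ∀ t ∈ s, HasDerivAt γ₁ (g t • Y (γ₁ t)) t ∧ γ₁ t ∈ U)
    (h₂ : ∀ t ∈ s, HasDerivAt γ₂ (g t • Y (γ₂ t)) t) {t₀ : ℝ} (ht₀ : t₀ ∈ s)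
    (heq : γ₁ t₀ = γ₂ t₀) : EqOn γ₁ γ₂ s := by
  refine eqOn_of_locallyLipschitz (v := fun t x => g t • Y x) hso hs ?_ h₁ h₂ ht₀ heq
  intro t ht x hx
  obtain ⟨K, V, hV, hL⟩ := ((hY x hx).contDiffAt (n := 1)).exists_lipschitzOnWith
  refine ⟨(‖g t‖₊ + 1) * K, V, hV, ?_⟩
  have hgt : ContinuousAt (fun τ => ‖g τ‖₊) t :=
    ((hg t ht).continuousAt (hso.mem_nhds ht)).nnnorm
  filter_upwards [hgt.eventually (gt_mem_nhds (lt_add_of_pos_right ‖g t‖₊ one_pos))] with τ hτ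
  have : LipschitzWith ‖g τ‖₊ (fun x : N => g τ • x) := lipschitzWith_smul (g τ)
  refine (this.comp_lipschitzOnWith hL).weaken ?_
  gcongr

theorem eqOn_of_hasDerivAt {Y : N → N} {U : Set N} (hY : AnalyticOnNhd ℝ Y U) {s : Set ℝ}
    (hso : IsOpen s) (hs : IsPreconnected s)
    {γ₁ γ₂ : ℝ → N} (h₁ : ∀ t ∈ s, HasDerivAt γ₁ (Y (γ₁ t)) t ∧ γ₁ t ∈ U)
    (h₂ : ∀ t ∈ s, HasDerivAt γ₂ (Y (γ₂ t)) t) {t₀ : ℝ} (ht₀ : t₀ ∈ s)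
    (heq : γ₁ t₀ = γ₂ t₀) : EqOn γ₁ γ₂ s :=
  eqOn_of_hasDerivAt_smul hY hso hs (g := fun _ => 1) continuousOn_const (by simpa using h₁)
    (by simpa using h₂) ht₀ heq

/-- Uniqueness of the solutions of linear differential equations. -/
theorem eq_of_hasDerivAt_linear {A : ℝ → N →L[ℝ] N} (hA : Continuous A) {γ₁ γ₂ : ℝ → N}
    (h₁ : ∀ t, HasDerivAt γ₁ (A t (γ₁ t)) t) (h₂ : ∀ t, HasDerivAt γ₂ (A t (γ₂ t)) t)
    {t₀ : ℝ} (heq : γ₁ t₀ = γ₂ t₀) (t : ℝ) : γ₁ t = γ₂ t := by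
  refine eqOn_of_locallyLipschitz (v := fun t x => A t x) (U := univ) isOpen_univ
    isPreconnected_univ ?_ (by simpa using h₁) (by simpa using h₂) (mem_univ t₀) heq (mem_univ t)
  intro t _ x _
  refine ⟨‖A t‖₊ + 1, univ, univ_mem, ?_⟩
  filter_upwards [hA.nnnorm.continuousAt.eventually
    (gt_mem_nhds (lt_add_of_pos_right ‖A t‖₊ one_pos))] with τ hτ
  exact ((A τ).lipschitz.weaken hτ.le).lipschitzOnWith

/-- Every point of `U` lies in a compact subset of `U` that no integral curve in `U` leaves. -/
def HasCompactTraps (Y : N → N) (U : Set N) : Prop :=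
  ∀ q ∈ U, ∃ K ⊆ U, IsCompact K ∧ q ∈ K ∧ ∀ γ : ℝ → N, ∀ δ > 0,
    (∀ t, |t| < δ → HasDerivAt γ (Y (γ t)) t ∧ γ t ∈ U) → γ 0 ∈ K → ∀ t, |t| < δ → γ t ∈ K

variable {Y : N → N} {U : Set N}

/-- The local flow has one existence time for all initial values in a neighborhood of a point, and
finitely many such neighborhoods cover `K`. -/
theorem exists_uniform_time (hU : IsOpen U) (hY : AnalyticOnNhd ℝ Y U) {K : Set N} (hKU : K ⊆ U)
    (hK : IsCompact K) :
    ∃ δ > 0, ∀ q ∈ K, ∃ γ : ℝ → N, γ 0 = q ∧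
      ∀ t, |t| < δ → HasDerivAt γ (Y (γ t)) t ∧ γ t ∈ U := by
  refine hK.induction_on (p := fun S => ∃ δ > 0, ∀ q ∈ S, ∃ γ : ℝ → N, γ 0 = q ∧
      ∀ t, |t| < δ → HasDerivAt γ (Y (γ t)) t ∧ γ t ∈ U) ⟨1, one_pos, by simp⟩ ?_ ?_ ?_
  · rintro S T hST ⟨δ, hδ, h⟩
    exact ⟨δ, hδ, fun q hq => h q (hST hq)⟩
  · rintro S T ⟨δ, hδ, h⟩ ⟨δ', hδ', h'⟩
    refine ⟨min δ δ', lt_min hδ hδ', ?_⟩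
    rintro q (hq | hq)
    · obtain ⟨γ, h0, hγ⟩ := h q hq
      exact ⟨γ, h0, fun t ht => hγ t (ht.trans_le (min_le_left _ _))⟩
    · obtain ⟨γ, h0, hγ⟩ := h' q hq
      exact ⟨γ, h0, fun t ht => hγ t (ht.trans_le (min_le_right _ _))⟩
  · intro p hp
    obtain ⟨ψ, δ, hδ, h⟩ := exists_analytic_localFlow (hY p (hKU hp)) (hU.mem_nhds (hKU hp))
    refine ⟨ball p δ, mem_nhdsWithin_of_mem_nhds (ball_mem_nhds _ hδ), δ, hδ, fun q hq => ?_⟩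
    exact ⟨fun t => ψ (t, q), (h q hq).1, fun t ht =>
      ⟨((h q hq).2 t ht).1, ((h q hq).2 t ht).2.1⟩⟩

/-- A curve that starts in a compact trap stays there, so it can be continued again and again by the
same time step, forward and backward. -/
theorem exists_global_integralCurve (hU : IsOpen U) (hY : AnalyticOnNhd ℝ Y U)
    (hT : HasCompactTraps Y U) {q : N} (hq : q ∈ U) :
    ∃ γ : ℝ → N, γ 0 = q ∧ ∀ t, HasDerivAt γ (Y (γ t)) t ∧ γ t ∈ U := by
  obtain ⟨K, hKU, hK, hqK, htrap⟩ := hT q hq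
  obtain ⟨δ, hδ, hloc⟩ := exists_uniform_time hU hY hKU hK
  have hc : ∀ x : K, ∃ γ : ℝ → N, γ 0 = x ∧
      ∀ t, |t| < δ → HasDerivAt γ (Y (γ t)) t ∧ γ t ∈ U := fun x => hloc x x.2
  choose c hc0 hc using hc
  have hcK : ∀ x : K, ∀ t, |t| < δ → c x t ∈ K := fun x t ht =>
    htrap (c x) δ hδ (hc x) (by rw [hc0]; exact x.2) t ht
  -- With a third of the existence time, a time below `2 h` shifted by at most `h` is still below
  -- `δ`, so consecutive pieces overlap on an open interval.
  set h := δ / 3 with hh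
  have hh0 : 0 < h := by positivity
  have shift : ∀ a : ℝ, |a| ≤ h → ∀ (x y : K), (y : N) = c x a → ∀ s, |s| < 2 * h →
      c y s = c x (s + a) := by
    intro a ha x y hy
    have hlt : ∀ s, s ∈ Ioo (-(2 * h)) (2 * h) → |s| < δ ∧ |s + a| < δ := by
      intro s hs
      have hs' : |s| < 2 * h := abs_lt.2 hs
      refine ⟨by linarith, (abs_add_le s a).trans_lt (by linarith)⟩
    have := eqOn_of_hasDerivAt hY isOpen_Ioo (isPreconnected_Ioo (a := -(2 * h)) (b := 2 * h))
      (γ₁ := c y) (γ₂ := fun s => c x (s + a)) (fun t ht => hc y t (hlt t ht).1)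
      (fun t ht => (hc x _ (hlt t ht).2).1.comp_add_const t a) (t₀ := 0)
      ⟨by linarith, by linarith⟩ (by simp [hc0, hy])
    exact fun s hs => this (abs_lt.1 hs)
  have habs : |h| < δ := by rw [abs_of_pos hh0]; linarith
  have habs' : |-h| < δ := by rwa [abs_neg]
  -- The time-`h` map is a bijection of the trap, with the time-`(-h)` map as its inverse. Its
  -- integer powers give the starting points of all pieces in both directions of time.
  let e : Equiv.Perm K :=
    { toFun := fun x => ⟨c x h, hcK x h habs⟩
      invFun := fun x => ⟨c x (-h), hcK x (-h) habs'⟩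
      left_inv := by
        intro x
        refine Subtype.ext ?_
        change c ⟨c x h, _⟩ (-h) = x
        rw [shift h (abs_of_pos hh0).le x ⟨c x h, hcK x h habs⟩ rfl (-h)
          (by rw [abs_neg, abs_of_pos hh0]; linarith)]
        simp [hc0]
      right_inv := by
        intro x
        refine Subtype.ext ?_
        change c ⟨c x (-h), _⟩ h = x
        rw [shift (-h) (by rw [abs_neg, abs_of_pos hh0]) x ⟨c x (-h), hcK x (-h) habs'⟩ rfl h
          (by rw [abs_of_pos hh0]; linarith)]
        simp [hc0] }
  let x₀ : K := ⟨q, hqK⟩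
  let w : ℤ → ℝ → N := fun n t => c ((e ^ n) x₀) (t - n * h)
  have hw : ∀ n : ℤ, ∀ t, |t - (n + 1) * h| < 2 * h → w (n + 1) t = w n t := by
    intro n t ht
    have hy : (((e ^ (n + 1)) x₀ : K) : N) = c ((e ^ n) x₀) h := by
      rw [add_comm, zpow_add, zpow_one]
      rfl
    have := shift h (abs_of_pos hh0).le ((e ^ n) x₀) ((e ^ (n + 1)) x₀) hy (t - (n + 1) * h) ht
    simp only [w]
    push_cast
    rw [this]
    congr 1
    ring
  -- The floor selects the piece `n` on `[n h, (n + 1) h)`. By the overlap, the glued curve agrees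
  -- with this piece also just to the left of `n h`, which gives differentiability at the joints.
  let γ : ℝ → N := fun t => w ⌊t / h⌋ t
  have hγ : ∀ n : ℤ, ∀ t, |t - n * h| < h → γ t = w n t := by
    intro n t ht
    rw [abs_lt] at ht
    rcases le_or_gt (n * h) t with h1 | h1
    · have : ⌊t / h⌋ = n := by
        rw [Int.floor_eq_iff, le_div_iff₀ hh0, div_lt_iff₀ hh0]
        exact ⟨h1, by linarith⟩
      simp only [γ, this]
    · have : ⌊t / h⌋ = n - 1 := by
        rw [Int.floor_eq_iff, le_div_iff₀ hh0, div_lt_iff₀ hh0]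
        push_cast
        exact ⟨by linarith, by linarith⟩
      simp only [γ, this]
      have h2 := hw (n - 1) t (by
        push_cast
        rw [abs_lt]
        constructor <;> linarith)
      rw [sub_add_cancel] at h2
      exact h2.symm
  refine ⟨γ, ?_, fun t => ?_⟩
  · simp [γ, w, hc0, x₀]
  · have h1 : |t - ⌊t / h⌋ * h| < h := by
      have h2 := Int.floor_le (t / h)
      have h3 := Int.lt_floor_add_one (t / h)
      rw [le_div_iff₀ hh0] at h2
      rw [div_lt_iff₀ hh0] at h3
      rw [abs_lt]
      constructor <;> linarith
    have h2 := hc ((e ^ ⌊t / h⌋) x₀) (t - ⌊t / h⌋ * h) (h1.trans (by linarith))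
    have h3 : HasDerivAt (w ⌊t / h⌋) (Y (w ⌊t / h⌋ t)) t := h2.1.comp_sub_const t _
    have h4 : γ =ᶠ[𝓝 t] w ⌊t / h⌋ := by
      have : ContinuousAt (fun τ : ℝ => |τ - ⌊t / h⌋ * h|) t := by fun_prop
      filter_upwards [this.eventually (gt_mem_nhds h1)] with τ hτ
      exact hγ _ τ hτ
    rw [h4.eq_of_nhds]
    exact ⟨h3.congr_of_eventuallyEq h4, h2.2⟩

/-- `φ` is a complete flow of the vector field `Y` on `U`, analytic in time and initial value. -/
structure IsFlow (φ : ℝ → N → N) (Y : N → N) (U : Set N) : Prop where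
  zero : ∀ q ∈ U, φ 0 q = q
  mem : ∀ t, ∀ q ∈ U, φ t q ∈ U
  hasDerivAt : ∀ t, ∀ q ∈ U, HasDerivAt (fun s => φ s q) (Y (φ t q)) t
  analytic : ∀ t, ∀ q ∈ U, AnalyticAt ℝ (fun z : ℝ × N => φ z.1 z.2) (t, q)

/-- An analytic vector field with compact traps has an analytic flow. -/
theorem exists_isFlow (hU : IsOpen U) (hY : AnalyticOnNhd ℝ Y U) (hT : HasCompactTraps Y U) :
    ∃ φ, IsFlow φ Y U := by
  choose! c hc0 hc using fun q (hq : q ∈ U) => exists_global_integralCurve hU hY hT hq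
  have add : ∀ s t, ∀ q ∈ U, c q (s + t) = c (c q t) s := by
    intro s t q hq
    have hm := (hc q hq t).2
    exact eqOn_of_hasDerivAt hY isOpen_univ isPreconnected_univ (γ₁ := fun s => c q (s + t))
      (γ₂ := c (c q t)) (fun s _ => ⟨(hc q hq (s + t)).1.comp_add_const s t, (hc q hq (s + t)).2⟩)
      (fun s _ => (hc _ hm s).1) (mem_univ 0) (by simp [hc0 _ hm]) (mem_univ s)
  have local_analytic : ∀ p ∈ U, ∃ δ > 0, ∀ q ∈ ball p δ, ∀ t : ℝ, |t| < δ →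
      AnalyticAt ℝ (fun z : ℝ × N => c z.2 z.1) (t, q) := by
    intro p hp
    obtain ⟨ψ, δ, hδ, hψ⟩ := exists_analytic_localFlow (hY p hp) (hU.mem_nhds hp)
    have heq : ∀ q ∈ ball p δ, ∀ t : ℝ, |t| < δ → ψ (t, q) = c q t := by
      intro q hq t ht
      have hqU : q ∈ U := by
        have := ((hψ q hq).2 0 (by simpa using hδ)).2.1
        rwa [(hψ q hq).1] at this
      refine eqOn_of_hasDerivAt hY isOpen_Ioo (isPreconnected_Ioo (a := -δ) (b := δ))
        (γ₁ := fun t => ψ (t, q)) (γ₂ := c q) (fun t ht => ?_) (fun t _ => (hc q hqU t).1)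
        (t₀ := 0) ⟨by linarith, hδ⟩ (by rw [hc0 q hqU, (hψ q hq).1]) (abs_lt.1 ht)
      have := (hψ q hq).2 t (abs_lt.2 ht)
      exact ⟨this.1, this.2.1⟩
    refine ⟨δ, hδ, fun q hq t ht => ((hψ q hq).2 t ht).2.2.congr ?_⟩
    have h1 : ∀ᶠ z : ℝ × N in 𝓝 (t, q), |z.1| < δ :=
      (by fun_prop : ContinuousAt (fun z : ℝ × N => |z.1|) (t, q)).eventually (gt_mem_nhds ht)
    have h2 : ∀ᶠ z : ℝ × N in 𝓝 (t, q), z.2 ∈ ball p δ :=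
      (by fun_prop : ContinuousAt (fun z : ℝ × N => z.2) (t, q)).eventually (isOpen_ball.mem_nhds hq)
    filter_upwards [h1, h2] with z hz1 hz2
    exact heq z.2 hz2 z.1 hz1
  refine ⟨fun t q => c q t, hc0, fun t q hq => (hc q hq t).2, fun t q hq => (hc q hq t).1, ?_⟩
  intro t q hq
  -- Analyticity propagates along the time axis. Near a limit time `t₀` take an analytic time `t` so
  -- close that the local flow around `c q t₀` covers the remaining time `t₀ - t`; the flow near
  -- `t₀` is then the composition of two analytic maps.
  have hclopen : IsClopen {t : ℝ | AnalyticAt ℝ (fun z : ℝ × N => c z.2 z.1) (t, q)} := by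
    constructor
    · rw [← closure_subset_iff_isClosed]
      intro t₀ ht₀
      obtain ⟨δ, hδ, hloc⟩ := local_analytic _ (hc q hq t₀).2
      have h1 : ∀ᶠ t in 𝓝 t₀, c q t ∈ ball (c q t₀) δ ∧ |t₀ - t| < δ := by
        refine ((hc q hq t₀).1.continuousAt.eventually (ball_mem_nhds _ hδ)).and ?_
        have : ContinuousAt (fun t : ℝ => |t₀ - t|) t₀ := by fun_prop
        exact this.eventually (gt_mem_nhds (by simpa using hδ))
      obtain ⟨t, ht, h2, h3⟩ := ((mem_closure_iff_frequently.1 ht₀).and_eventually h1).exists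
      have hin : AnalyticAt ℝ (fun z : ℝ × N => (z.1 - t, c z.2 t)) (t₀, q) := by
        have h4 : AnalyticAt ℝ (fun z : ℝ × N => (t, z.2)) (t₀, q) :=
          analyticAt_const.prod analyticAt_snd
        have h5 : AnalyticAt ℝ (fun z : ℝ × N => c z.2 t) (t₀, q) :=
          AnalyticAt.fun_comp (g := fun z : ℝ × N => c z.2 z.1)
            (f := fun z : ℝ × N => (t, z.2)) ht h4
        exact (analyticAt_fst.sub analyticAt_const).prod h5
      have hout := AnalyticAt.fun_comp (g := fun z : ℝ × N => c z.2 z.1)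
        (f := fun z : ℝ × N => (z.1 - t, c z.2 t)) (hloc _ h2 _ h3) hin
      refine hout.congr ?_
      have h6 : ∀ᶠ z : ℝ × N in 𝓝 (t₀, q), z.2 ∈ U :=
        continuousAt_snd.eventually (hU.mem_nhds hq)
      filter_upwards [h6] with z hz
      rw [← add _ _ _ hz, sub_add_cancel]
    · have hcont : Continuous fun t : ℝ => (t, q) := by fun_prop
      exact (isOpen_analyticAt ℝ (fun z : ℝ × N => c z.2 z.1)).preimage hcont
  have h0 : (0 : ℝ) ∈ {t : ℝ | AnalyticAt ℝ (fun z : ℝ × N => c z.2 z.1) (t, q)} := by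
    obtain ⟨δ, hδ, hloc⟩ := local_analytic q hq
    exact hloc q (mem_ball_self hδ) 0 (by simpa using hδ)
  have := hclopen.eq_univ ⟨0, h0⟩
  exact eq_univ_iff_forall.1 this t

end AnalyticFlow

end

/-! ### Commuting flows and the action of ℝ² -/

section

open scoped Topology ContDiff NNReal
open Set Filter Metric

namespace AnalyticFlow

variable {N : Type*} [NormedAddCommGroup N] [NormedSpace ℝ N] [CompleteSpace N]
  {Y Z : N → N} {U : Set N} {φ ψ : ℝ → N → N}

namespace IsFlow

/-- The flow equation as an identity for the total derivative, a form in which it can be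
differentiated once more with respect to the initial value. -/
theorem eventually_hasDerivAt (hφ : IsFlow φ Y U) (t : ℝ) {q : N} (hq : q ∈ U) :
    fderiv ℝ (fun z : ℝ × N => φ z.1 z.2) (t, q) (1, 0) = Y (φ t q) := by
  have h1 : HasDerivAt (fun s : ℝ => (s, q)) ((1, 0) : ℝ × N) t :=
    (hasDerivAt_id t).prodMk (hasDerivAt_const t q)
  have h2 := (hφ.analytic t q hq).differentiableAt.hasFDerivAt.comp_hasDerivAt t h1
  exact h2.unique (hφ.hasDerivAt t q hq)

/-- The flow of `Y` leaves a vector field `Z` invariant that commutes with `Y`. -/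
theorem fderiv_apply_of_commute (hU : IsOpen U) (hφ : IsFlow φ Y U) (hY : AnalyticOnNhd ℝ Y U)
    (hZ : AnalyticOnNhd ℝ Z U)
    (hcomm : ∀ q ∈ U, fderiv ℝ Z q (Y q) = fderiv ℝ Y q (Z q)) (t : ℝ) {q : N} (hq : q ∈ U) :
    fderiv ℝ (fun z : ℝ × N => φ z.1 z.2) (t, q) (0, Z q) = Z (φ t q) := by
  set Φ : ℝ × N → N := fun z => φ z.1 z.2 with hΦ
  have hA : Continuous fun t => fderiv ℝ Y (φ t q) := by
    rw [continuous_iff_continuousAt]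
    intro t
    exact ContinuousAt.comp' ((hY _ (hφ.mem t q hq)).fderiv.continuousAt)
      (hφ.hasDerivAt t q hq).continuousAt
  -- Both sides solve the variational equation `v' = DY(φ t q) v` and start at `Z q`. The left side
  -- does so by symmetry of the second derivative of the flow, the right side by the commutation
  -- hypothesis.
  refine eq_of_hasDerivAt_linear hA (t₀ := 0) ?_ ?_ ?_ t
    (γ₁ := fun t => fderiv ℝ Φ (t, q) (0, Z q)) (γ₂ := fun t => Z (φ t q))
  · intro t
    have han := hφ.analytic t q hq
    have h1 : HasDerivAt (fun s : ℝ => (s, q)) ((1, 0) : ℝ × N) t :=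
      (hasDerivAt_id t).prodMk (hasDerivAt_const t q)
    have h2 : HasFDerivAt (fderiv ℝ Φ) (fderiv ℝ (fderiv ℝ Φ) (t, q)) (t, q) :=
      han.fderiv.differentiableAt.hasFDerivAt
    have h3 : HasDerivAt (fun s : ℝ => fderiv ℝ Φ (s, q)) (fderiv ℝ (fderiv ℝ Φ) (t, q) (1, 0)) t :=
      h2.comp_hasDerivAt t h1
    have h4 : HasDerivAt (fun s : ℝ => fderiv ℝ Φ (s, q) (0, Z q))
        (fderiv ℝ (fderiv ℝ Φ) (t, q) (1, 0) (0, Z q)) t := by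
      simpa using h3.clm_apply (hasDerivAt_const t ((0, Z q) : ℝ × N))
    have hsymm : fderiv ℝ (fderiv ℝ Φ) (t, q) (1, 0) (0, Z q)
        = fderiv ℝ (fderiv ℝ Φ) (t, q) (0, Z q) (1, 0) :=
      (han.contDiffAt (n := 2)).isSymmSndFDerivAt (by simp) _ _
    have h5 : HasFDerivAt (fun z => fderiv ℝ Φ z (1, 0))
        ((ContinuousLinearMap.apply ℝ N ((1, 0) : ℝ × N)) ∘L fderiv ℝ (fderiv ℝ Φ) (t, q)) (t, q) :=
      (ContinuousLinearMap.apply ℝ N ((1, 0) : ℝ × N)).hasFDerivAt.comp (t, q) h2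
    have h6 : HasFDerivAt (fun z => Y (Φ z)) (fderiv ℝ Y (φ t q) ∘L fderiv ℝ Φ (t, q)) (t, q) :=
      HasFDerivAt.comp (t, q) (g := Y) (f := Φ)
        (hY _ (hφ.mem t q hq)).differentiableAt.hasFDerivAt han.differentiableAt.hasFDerivAt
    have h7 : (fun z => fderiv ℝ Φ z (1, 0)) =ᶠ[𝓝 (t, q)] fun z => Y (Φ z) := by
      have h6 : ∀ᶠ z : ℝ × N in 𝓝 (t, q), z.2 ∈ U :=
        continuousAt_snd.eventually (hU.mem_nhds hq)
      filter_upwards [h6] with z hz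
      exact hφ.eventually_hasDerivAt z.1 hz
    have h8 := congrArg (fun L : ℝ × N →L[ℝ] N => L (0, Z q))
      (h5.unique (h6.congr_of_eventuallyEq h7))
    simp only [ContinuousLinearMap.comp_apply, ContinuousLinearMap.apply_apply] at h8
    rw [hsymm, h8] at h4
    exact h4
  · intro t
    have h1 := (hZ _ (hφ.mem t q hq)).differentiableAt.hasFDerivAt.comp_hasDerivAt t
      (hφ.hasDerivAt t q hq)
    rwa [hcomm _ (hφ.mem t q hq)] at h1
  · have h1 : HasDerivAt (fun s : ℝ => ((0 : ℝ), q + s • Z q)) ((0, Z q) : ℝ × N) 0 := by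
      refine (hasDerivAt_const _ _).prodMk ?_
      simpa using ((hasDerivAt_id (0 : ℝ)).smul_const (Z q)).const_add q
    have h2 := (hφ.analytic 0 q hq).differentiableAt.hasFDerivAt
    have h2' : HasFDerivAt Φ (fderiv ℝ Φ (0, q)) ((fun s : ℝ => ((0 : ℝ), q + s • Z q)) 0) := by
      simpa using h2
    have h3 := h2'.comp_hasDerivAt (0 : ℝ) h1
    have h4 : HasDerivAt (fun s : ℝ => q + s • Z q) (Z q) 0 := by
      simpa using ((hasDerivAt_id (0 : ℝ)).smul_const (Z q)).const_add q
    have h5 : (Φ ∘ fun s : ℝ => ((0 : ℝ), q + s • Z q)) =ᶠ[𝓝 0] fun s : ℝ => q + s • Z q := by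
      have : ContinuousAt (fun s : ℝ => q + s • Z q) 0 := by fun_prop
      filter_upwards [this.eventually (hU.mem_nhds (by simpa using hq))] with s hs
      exact hφ.zero _ hs
    have h6 := h3.unique (h4.congr_of_eventuallyEq h5)
    simp only [h6, hφ.zero q hq]

/-- The flows of commuting vector fields commute. -/
theorem commute (hU : IsOpen U) (hφ : IsFlow φ Y U) (hψ : IsFlow ψ Z U) (hY : AnalyticOnNhd ℝ Y U)
    (hZ : AnalyticOnNhd ℝ Z U)
    (hcomm : ∀ q ∈ U, fderiv ℝ Z q (Y q) = fderiv ℝ Y q (Z q)) (s t : ℝ) {q : N} (hq : q ∈ U) :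
    φ t (ψ s q) = ψ s (φ t q) := by
  -- As functions of `s`, both sides are integral curves of `Z`, the left one because the time-`t`
  -- map of `φ` carries `Z` to itself.
  refine eqOn_of_hasDerivAt hZ isOpen_univ isPreconnected_univ (γ₁ := fun s => φ t (ψ s q))
    (γ₂ := fun s => ψ s (φ t q)) ?_ ?_ (mem_univ 0) ?_ (mem_univ s)
  · intro s _
    refine ⟨?_, hφ.mem _ _ (hψ.mem _ _ hq)⟩
    have h1 : HasDerivAt (fun s : ℝ => (t, ψ s q)) ((0, Z (ψ s q)) : ℝ × N) s :=
      (hasDerivAt_const _ _).prodMk (hψ.hasDerivAt s q hq)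
    have h2 := (hφ.analytic t _ (hψ.mem s q hq)).differentiableAt.hasFDerivAt.comp_hasDerivAt s h1
    rwa [hφ.fderiv_apply_of_commute hU hY hZ hcomm t (hψ.mem s q hq)] at h2
  · exact fun s _ => hψ.hasDerivAt s _ (hφ.mem t q hq)
  · simp only [hψ.zero q hq, hψ.zero _ (hφ.mem t q hq)]

theorem add (hφ : IsFlow φ Y U) (hY : AnalyticOnNhd ℝ Y U) (s t : ℝ) {q : N} (hq : q ∈ U) :
    φ (s + t) q = φ s (φ t q) := by
  have hm := hφ.mem t q hq
  exact eqOn_of_hasDerivAt hY isOpen_univ isPreconnected_univ (γ₁ := fun s => φ (s + t) q)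
    (γ₂ := fun s => φ s (φ t q))
    (fun s _ => ⟨(hφ.hasDerivAt (s + t) q hq).comp_add_const s t, hφ.mem _ q hq⟩)
    (fun s _ => hφ.hasDerivAt s _ hm) (mem_univ 0) (by simp [hφ.zero _ hm]) (mem_univ s)

end IsFlow

/-- `G` is an analytic action of `ℝ²` on the open set `U`, generated by the vector fields `Y i`. -/
structure IsAction (G : (Fin 2 → ℝ) → N → N) (Y : Fin 2 → N → N) (U : Set N) : Prop where
  zero : ∀ q ∈ U, G 0 q = q
  mem : ∀ t, ∀ q ∈ U, G t q ∈ U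
  add : ∀ s t, ∀ q ∈ U, G (s + t) q = G s (G t q)
  analytic : ∀ t, ∀ q ∈ U, AnalyticAt ℝ (fun z : (Fin 2 → ℝ) × N => G z.1 z.2) (t, q)
  hasDerivAt : ∀ q ∈ U, ∀ i, HasDerivAt (fun s : ℝ => G (Pi.single i s) q) (Y i q) 0

/-- Commuting analytic vector fields with compact traps generate an analytic action of `ℝ²`. -/
theorem exists_isAction (hU : IsOpen U) {Y : Fin 2 → N → N} (hY : ∀ i, AnalyticOnNhd ℝ (Y i) U)
    (hT : ∀ i, HasCompactTraps (Y i) U)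
    (hcomm : ∀ q ∈ U, fderiv ℝ (Y 1) q (Y 0 q) = fderiv ℝ (Y 0) q (Y 1 q)) :
    ∃ G, IsAction G Y U := by
  obtain ⟨φ, hφ⟩ := exists_isFlow hU (hY 0) (hT 0)
  obtain ⟨ψ, hψ⟩ := exists_isFlow hU (hY 1) (hT 1)
  refine ⟨fun t q => φ (t 0) (ψ (t 1) q), ?_, ?_, ?_, ?_, ?_⟩
  · intro q hq
    simp [hψ.zero q hq, hφ.zero q hq]
  · exact fun t q hq => hφ.mem _ _ (hψ.mem _ _ hq)
  · intro s t q hq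
    have h1 := hψ.mem (t 1) q hq
    have h2 := hψ.mem (s 1) _ h1
    simp only [Pi.add_apply]
    rw [hψ.add (hY 1) _ _ hq, hφ.add (hY 0) _ _ h2,
      hφ.commute hU hψ (hY 0) (hY 1) hcomm _ _ h1]
  · intro t q hq
    have h1 : AnalyticAt ℝ (fun z : (Fin 2 → ℝ) × N => (z.1 1, z.2)) (t, q) :=
      ((ContinuousLinearMap.proj 1 ∘L ContinuousLinearMap.fst ℝ (Fin 2 → ℝ) N).prod
        (ContinuousLinearMap.snd ℝ (Fin 2 → ℝ) N)).analyticAt _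
    have h2 : AnalyticAt ℝ (fun z : (Fin 2 → ℝ) × N => z.1 0) (t, q) :=
      (ContinuousLinearMap.proj 0 ∘L ContinuousLinearMap.fst ℝ (Fin 2 → ℝ) N).analyticAt _
    have h3 : AnalyticAt ℝ (fun z : (Fin 2 → ℝ) × N => ψ (z.1 1) z.2) (t, q) :=
      AnalyticAt.fun_comp (g := fun z : ℝ × N => ψ z.1 z.2)
        (f := fun z : (Fin 2 → ℝ) × N => (z.1 1, z.2)) (hψ.analytic _ _ hq) h1
    exact AnalyticAt.fun_comp (g := fun z : ℝ × N => φ z.1 z.2)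
        (f := fun z : (Fin 2 → ℝ) × N => (z.1 0, ψ (z.1 1) z.2))
        (hφ.analytic _ _ (hψ.mem _ _ hq)) (h2.prod h3)
  · intro q hq i
    fin_cases i
    · have := hφ.hasDerivAt 0 q hq
      rw [hφ.zero q hq] at this
      simpa [hψ.zero q hq] using this
    · have := hψ.hasDerivAt 0 q hq
      rw [hψ.zero q hq] at this
      simpa [hφ.zero _ (hψ.mem _ _ hq)] using this

end AnalyticFlow

end

/-! ### Adapted charts, orbits, and the lattice of periods -/

section

open scoped Topology ContDiff NNReal
open Set Filter Metric

namespace AnalyticFlow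

/-- The inverse function theorem for analytic functions. -/
theorem exists_analytic_openPartialHomeomorph {E F : Type*} [NormedAddCommGroup E]
    [NormedSpace ℝ E] [CompleteSpace E] [NormedAddCommGroup F] [NormedSpace ℝ F] [CompleteSpace F]
    {f : E → F} {a : E}
    (hf : AnalyticAt ℝ f a) {f' : E ≃L[ℝ] F} (hf' : HasFDerivAt f (f' : E →L[ℝ] F) a) {S : Set E}
    (hS : IsOpen S) (haS : a ∈ S) :
    ∃ e : OpenPartialHomeomorph E F, a ∈ e.source ∧ e.source ⊆ S ∧ (∀ z, e z = f z) ∧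
      ∀ q ∈ e.target, AnalyticAt ℝ e.symm q := by
  have hC : ContDiffAt ℝ ω f a := hf.contDiffAt
  let e₀ := (hC.toOpenPartialHomeomorph f hf' (by simp)).restrOpen S hS
  have ha₀ : a ∈ e₀.source := ⟨hC.mem_toOpenPartialHomeomorph_source hf' (by simp), haS⟩
  have he₀ : ∀ z, e₀ z = f z := fun z => rfl
  have hsymm : AnalyticAt ℝ e₀.symm (e₀ a) := by
    refine ContDiffAt.analyticAt ?_
    refine e₀.contDiffAt_symm (f₀' := f') (e₀.map_source ha₀) ?_ ?_
    · rw [e₀.left_inv ha₀]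
      exact hf'
    · rw [e₀.left_inv ha₀]
      exact hC
  -- Analyticity of the inverse is known only at the image of `a`. The set where it holds is open,
  -- so shrinking the target makes the inverse analytic on all of it.
  let A : Set F := {q | AnalyticAt ℝ e₀.symm q}
  have hA : IsOpen A := isOpen_analyticAt ℝ _
  let e := (e₀.symm.restrOpen A hA).symm
  have hsrc : e.source = e₀.source ∩ e₀ ⁻¹' A := by
    change (e₀.symm.restrOpen A hA).target = _
    have := (e₀.symm.restrOpen A hA).toPartialEquiv.image_source_eq_target
    rw [← this]
    ext z
    constructor
    · rintro ⟨q, ⟨hq, hqA⟩, rfl⟩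
      change e₀.symm q ∈ _
      exact ⟨e₀.map_target hq, by
        rw [mem_preimage, e₀.right_inv hq]
        exact hqA⟩
    · rintro ⟨hz, hzA⟩
      exact ⟨e₀ z, ⟨e₀.map_source hz, hzA⟩, e₀.left_inv hz⟩
  refine ⟨e, ?_, ?_, he₀, ?_⟩
  · rw [hsrc]
    exact ⟨ha₀, hsymm⟩
  · rw [hsrc]
    exact fun z hz => hz.1.2
  · exact fun q hq => hq.2

set_option linter.unusedSectionVars false

variable {N Q : Type*} [NormedAddCommGroup N] [NormedSpace ℝ N] [CompleteSpace N]
  [NormedAddCommGroup Q] [NormedSpace ℝ Q] [FiniteDimensional ℝ Q]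
  {Y : Fin 2 → N → N} {U : Set N} {G : (Fin 2 → ℝ) → N → N} {F : N → Q}

/-- An analytic submersion has analytic local sections. -/
theorem exists_analytic_section {p : N} (hF : AnalyticAt ℝ F p)
    (hs : Function.Surjective (fderiv ℝ F p)) :
    ∃ σ : Q → N, σ (F p) = p ∧ AnalyticAt ℝ σ (F p) ∧ ∀ᶠ ε in 𝓝 (F p), F (σ ε) = ε := by
  have : CompleteSpace Q := FiniteDimensional.complete ℝ Q
  obtain ⟨R, hR⟩ := (fderiv ℝ F p).exists_rightInverse_of_surjective (LinearMap.range_eq_top.2 hs)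
  -- On the affine subspace `p + R ε`, with `R` a right inverse of the derivative, `F` has
  -- derivative the identity and can be inverted.
  have h1 : AnalyticAt ℝ (fun ε : Q => p + R ε) 0 := analyticAt_const.add (R.analyticAt 0)
  have h2 : AnalyticAt ℝ (fun ε : Q => F (p + R ε)) 0 :=
    AnalyticAt.fun_comp (g := F) (f := fun ε : Q => p + R ε) (by simpa using hF) h1
  have h3 : HasFDerivAt (fun ε : Q => F (p + R ε))
      ((ContinuousLinearEquiv.refl ℝ Q : Q ≃L[ℝ] Q) : Q →L[ℝ] Q) 0 := by
    have h4 : HasFDerivAt (fun ε : Q => p + R ε) R 0 := R.hasFDerivAt.const_add p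
    have h5 : HasFDerivAt F (fderiv ℝ F p) (p + R 0) := by
      simpa using hF.differentiableAt.hasFDerivAt
    have := h5.comp (0 : Q) h4
    rw [hR] at this
    exact this
  obtain ⟨e, he0, -, hef, hea⟩ := exists_analytic_openPartialHomeomorph h2 h3 isOpen_univ
    (mem_univ 0)
  have he : e 0 = F p := by simp [hef]
  have ht : F p ∈ e.target := he ▸ e.map_source he0
  have h6 : e.symm (F p) = 0 := by rw [← he, e.left_inv he0]
  refine ⟨fun ε => p + R (e.symm ε), by simp [h6], ?_, ?_⟩
  · exact analyticAt_const.add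
      (AnalyticAt.fun_comp (g := R) (f := e.symm) (R.analyticAt _) (hea _ ht))
  · filter_upwards [e.open_target.mem_nhds ht] with ε hε
    rw [← hef, e.right_inv hε]

/-- At `p`, the fields `Y i` are independent, `F` is a submersion, and the kernel of its derivative
is spanned by the fields. -/
structure IsRegularAt (F : N → Q) (Y : Fin 2 → N → N) (p : N) : Prop where
  independent : ∀ v : Fin 2 → ℝ, v 0 • Y 0 p + v 1 • Y 1 p = 0 → v = 0
  surjective : Function.Surjective (fderiv ℝ F p)
  ker_le : ∀ x, fderiv ℝ F p x = 0 → ∃ v : Fin 2 → ℝ, x = v 0 • Y 0 p + v 1 • Y 1 p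

theorem IsAction.fderiv_apply (hG : IsAction G Y U) {q : N} (hq : q ∈ U) (v : Fin 2 → ℝ) :
    fderiv ℝ (fun t => G t q) 0 v = v 0 • Y 0 q + v 1 • Y 1 q := by
  have han : AnalyticAt ℝ (fun t => G t q) 0 :=
    AnalyticAt.fun_comp (g := fun z : (Fin 2 → ℝ) × N => G z.1 z.2) (f := fun t => (t, q))
      (hG.analytic 0 q hq) (analyticAt_id.prod analyticAt_const)
  have h1 : ∀ i, fderiv ℝ (fun t => G t q) 0 (Pi.single i 1) = Y i q := by
    intro i
    have h2 : HasDerivAt (fun s : ℝ => (Pi.single i s : Fin 2 → ℝ)) (Pi.single i 1) 0 :=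
      (ContinuousLinearMap.single ℝ (fun _ : Fin 2 => ℝ) i).hasFDerivAt.hasDerivAt
    have h3 : HasFDerivAt (fun t => G t q) (fderiv ℝ (fun t => G t q) 0)
        ((fun s : ℝ => (Pi.single i s : Fin 2 → ℝ)) 0) := by
      simpa using han.differentiableAt.hasFDerivAt
    exact (h3.comp_hasDerivAt (0 : ℝ) h2).unique (hG.hasDerivAt q hq i)
  have h4 : v = v 0 • Pi.single 0 1 + v 1 • Pi.single 1 1 := by
    ext i
    fin_cases i <;> simp
  conv_lhs => rw [h4]
  rw [map_add, map_smul, map_smul, h1, h1]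

theorem IsAction.analyticAt_comp (hG : IsAction G Y U) {E : Type*} [NormedAddCommGroup E]
    [NormedSpace ℝ E] {f : E → Fin 2 → ℝ} {g : E → N} {a : E} (hf : AnalyticAt ℝ f a)
    (hg : AnalyticAt ℝ g a) (hga : g a ∈ U) : AnalyticAt ℝ (fun x => G (f x) (g x)) a :=
  AnalyticAt.fun_comp (g := fun z : (Fin 2 → ℝ) × N => G z.1 z.2) (f := fun x => (f x, g x))
    (hG.analytic _ _ hga) (hf.prod hg)

/-- `e` is a chart near `p` in which the action is a translation and `F` the projection. -/
structure IsChart (G : (Fin 2 → ℝ) → N → N) (U : Set N) (F : N → Q) (p : N) (σ : Q → N)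
    (e : OpenPartialHomeomorph ((Fin 2 → ℝ) × Q) N) : Prop where
  section_apply : σ (F p) = p
  zero_mem : (0, F p) ∈ e.source
  apply : ∀ z, e z = G z.1 (σ z.2)
  section_mem : ∀ z ∈ e.source, σ z.2 ∈ U
  map_section : ∀ z ∈ e.source, F (σ z.2) = z.2
  analytic_section : ∀ z ∈ e.source, AnalyticAt ℝ σ z.2
  analytic_symm : ∀ q ∈ e.target, AnalyticAt ℝ e.symm q

/-- The map `(t, ε) ↦ G t (σ ε)`, with `σ` a local section of `F`, has bijective derivative at `(0,
F p)`: the first factor is mapped isomorphically onto the kernel of `dF`, spanned by the fields, and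
`dF` maps the image of the second factor back identically. -/
theorem exists_isChart (hU : IsOpen U) (hG : IsAction G Y U) (hF : AnalyticOnNhd ℝ F U)
    (hFG : ∀ t, ∀ q ∈ U, F (G t q) = F q) {p : N} (hp : p ∈ U) (hreg : IsRegularAt F Y p) : ∃ σ e, IsChart G U F p σ e := by
  have : CompleteSpace Q := FiniteDimensional.complete ℝ Q
  obtain ⟨σ, hσp, hσa, hσ⟩ := exists_analytic_section (hF p hp) hreg.surjective
  set a : (Fin 2 → ℝ) × Q := (0, F p) with ha
  have hfst : AnalyticAt ℝ (fun z : (Fin 2 → ℝ) × Q => z.1) a := analyticAt_fst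
  have hsnd : AnalyticAt ℝ (fun z : (Fin 2 → ℝ) × Q => σ z.2) a :=
    AnalyticAt.fun_comp (g := σ) (f := fun z : (Fin 2 → ℝ) × Q => z.2) hσa analyticAt_snd
  have hΘ : AnalyticAt ℝ (fun z : (Fin 2 → ℝ) × Q => G z.1 (σ z.2)) a :=
    hG.analyticAt_comp hfst hsnd (by rw [hσp]; exact hp)
  set D := fderiv ℝ (fun z : (Fin 2 → ℝ) × Q => G z.1 (σ z.2)) a with hD
  have hD1 : HasFDerivAt (fun z : (Fin 2 → ℝ) × Q => G z.1 (σ z.2)) D a :=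
    hΘ.differentiableAt.hasFDerivAt
  have hDl : ∀ v : Fin 2 → ℝ, D (v, 0) = v 0 • Y 0 p + v 1 • Y 1 p := by
    intro v
    rw [← hG.fderiv_apply hp]
    have h1 : HasFDerivAt (fun t : Fin 2 → ℝ => (t, F p))
        (ContinuousLinearMap.inl ℝ (Fin 2 → ℝ) Q) 0 := hasFDerivAt_prodMk_left _ _
    have h2 := HasFDerivAt.comp (0 : Fin 2 → ℝ) hD1 h1
    have h3 : ((fun z : (Fin 2 → ℝ) × Q => G z.1 (σ z.2)) ∘ fun t : Fin 2 → ℝ => (t, F p))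
        = fun t => G t p := by
      ext t
      simp [hσp]
    rw [h3] at h2
    rw [h2.fderiv]
    rfl
  have hDr : ∀ v : Q, fderiv ℝ F p (D (0, v)) = v := by
    intro v
    have h1 : HasFDerivAt (fun t : Q => ((0 : Fin 2 → ℝ), t))
        (ContinuousLinearMap.inr ℝ (Fin 2 → ℝ) Q) (F p) := hasFDerivAt_prodMk_right _ _
    have h2 := HasFDerivAt.comp (F p) hD1 h1
    have h4 : HasFDerivAt F (fderiv ℝ F p)
        (((fun z : (Fin 2 → ℝ) × Q => G z.1 (σ z.2)) ∘ fun t : Q => ((0 : Fin 2 → ℝ), t)) (F p)) := by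
      simp only [Function.comp_apply, hσp, hG.zero p hp]
      exact (hF p hp).differentiableAt.hasFDerivAt
    have h5 := HasFDerivAt.comp (F p) h4 h2
    have h6 : (F ∘ (fun z : (Fin 2 → ℝ) × Q => G z.1 (σ z.2)) ∘ fun t : Q => ((0 : Fin 2 → ℝ), t))
        =ᶠ[𝓝 (F p)] id := by
      have h7 : ∀ᶠ ε in 𝓝 (F p), σ ε ∈ U :=
        hσa.continuousAt.eventually (hU.mem_nhds (by rw [hσp]; exact hp))
      filter_upwards [hσ, h7] with ε h8 h9
      simp [hG.zero _ h9, h8]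
    have h8 := h5.unique ((hasFDerivAt_id (F p)).congr_of_eventuallyEq h6)
    exact congrArg (fun L : Q →L[ℝ] Q => L v) h8
  have hYker : ∀ v : Fin 2 → ℝ, ∀ w : Q, D (v, w) = (v 0 • Y 0 p + v 1 • Y 1 p) + D (0, w) := by
    intro v w
    rw [← hDl, ← map_add]
    simp
  have hFD : ∀ v : Fin 2 → ℝ, fderiv ℝ F p (v 0 • Y 0 p + v 1 • Y 1 p) = 0 := by
    intro v
    have han : AnalyticAt ℝ (fun t => G t p) 0 :=
      hG.analyticAt_comp analyticAt_id analyticAt_const hp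
    have h1 : HasFDerivAt F (fderiv ℝ F p) (G 0 p) := by
      rw [hG.zero p hp]
      exact (hF p hp).differentiableAt.hasFDerivAt
    have h2 := HasFDerivAt.comp (0 : Fin 2 → ℝ) h1 han.differentiableAt.hasFDerivAt
    have h3 : (F ∘ fun t => G t p) = fun _ => F p := funext fun t => hFG t p hp
    rw [h3] at h2
    have h4 := h2.unique (hasFDerivAt_const _ _)
    rw [← hG.fderiv_apply hp]
    exact congrArg (fun L : (Fin 2 → ℝ) →L[ℝ] Q => L v) h4
  have hinj : ∀ z, D z = 0 → z = 0 := by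
    rintro ⟨v, w⟩ h
    rw [hYker] at h
    have h1 := congrArg (fderiv ℝ F p) h
    rw [map_add, hFD, hDr, zero_add, map_zero] at h1
    subst h1
    rw [← Prod.zero_eq_mk, map_zero, add_zero] at h
    rw [hreg.independent v h]
    rfl
  have hsurj : ∀ x : N, ∃ z, D z = x := by
    intro x
    obtain ⟨v, hv⟩ := hreg.ker_le (x - D (0, fderiv ℝ F p x)) (by rw [map_sub, hDr, sub_self])
    refine ⟨(v, fderiv ℝ F p x), ?_⟩
    rw [hYker, ← hv, sub_add_cancel]
  let L : ((Fin 2 → ℝ) × Q) ≃L[ℝ] N := ContinuousLinearEquiv.ofBijective D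
    (LinearMap.ker_eq_bot'.2 hinj) (LinearMap.range_eq_top.2 hsurj)
  have hL : HasFDerivAt (fun z : (Fin 2 → ℝ) × Q => G z.1 (σ z.2))
      (L : ((Fin 2 → ℝ) × Q) →L[ℝ] N) a := hD1
  have hev : ∀ᶠ ε in 𝓝 (F p), σ ε ∈ U ∧ F (σ ε) = ε ∧ AnalyticAt ℝ σ ε :=
    (hσa.continuousAt.eventually (hU.mem_nhds (by rw [hσp]; exact hp))).and
      (hσ.and hσa.eventually_analyticAt)
  obtain ⟨S, hS, hSo, hpS⟩ := _root_.eventually_nhds_iff.1 hev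
  obtain ⟨e, hea, heS, hef, hes⟩ := exists_analytic_openPartialHomeomorph hΘ hL
    (hSo.preimage continuous_snd) (show a ∈ Prod.snd ⁻¹' S from hpS)
  exact ⟨σ, e, hσp, hea, hef, fun z hz => (hS _ (heS hz)).1, fun z hz => (hS _ (heS hz)).2.1,
    fun z hz => (hS _ (heS hz)).2.2, hes⟩

namespace IsChart

variable {p : N} {σ : Q → N} {e : OpenPartialHomeomorph ((Fin 2 → ℝ) × Q) N}

theorem apply_zero (h : IsChart G U F p σ e) (hG : IsAction G Y U) {ε : Q}
    (hε : (0, ε) ∈ e.source) : e (0, ε) = σ ε := by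
  rw [h.apply]
  exact hG.zero _ (h.section_mem _ hε)

theorem section_mem_target (h : IsChart G U F p σ e) (hG : IsAction G Y U) {ε : Q}
    (hε : (0, ε) ∈ e.source) : σ ε ∈ e.target := by
  rw [← h.apply_zero hG hε]
  exact e.map_source hε

theorem symm_section (h : IsChart G U F p σ e) (hG : IsAction G Y U) {ε : Q}
    (hε : (0, ε) ∈ e.source) : e.symm (σ ε) = (0, ε) := by
  rw [← h.apply_zero hG hε, e.left_inv hε]

theorem eq_apply_symm (h : IsChart G U F p σ e) {q : N} (hq : q ∈ e.target) :
    q = G (e.symm q).1 (σ (e.symm q).2) := by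
  rw [← h.apply, e.right_inv hq]

theorem snd_symm (h : IsChart G U F p σ e) (hFG : ∀ t, ∀ q ∈ U, F (G t q) = F q) {q : N}
    (hq : q ∈ e.target) : (e.symm q).2 = F q := by
  have hz := e.map_target hq
  conv_rhs => rw [h.eq_apply_symm hq]
  rw [hFG _ _ (h.section_mem _ hz), h.map_section _ hz]

theorem eq_apply_symm' (h : IsChart G U F p σ e) (hFG : ∀ t, ∀ q ∈ U, F (G t q) = F q) {q : N}
    (hq : q ∈ e.target) : q = G (e.symm q).1 (σ (F q)) := by
  conv_lhs => rw [h.eq_apply_symm hq]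
  rw [h.snd_symm hFG hq]

/-- Near `p`, the points of the level set of `p` are in the orbit of `p`. -/
theorem eventually_mem_orbit (h : IsChart G U F p σ e) (hG : IsAction G Y U)
    (hFG : ∀ t, ∀ q ∈ U, F (G t q) = F q) :
    ∀ᶠ q in 𝓝 p, F q = F p → ∃ t, ‖t‖ < 1 ∧ q = G t p := by
  have ht : p ∈ e.target := by
    have := h.section_mem_target hG h.zero_mem
    rwa [h.section_apply] at this
  have h0 : e.symm p = (0, F p) := by
    have := h.symm_section hG h.zero_mem
    rwa [h.section_apply] at this
  have h1 : ContinuousAt (fun q => ‖(e.symm q).1‖) p :=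
    ((e.continuousAt_symm ht).fst).norm
  have h2 : ‖(e.symm p).1‖ < 1 := by simp [h0]
  filter_upwards [e.open_target.mem_nhds ht, h1.eventually (gt_mem_nhds h2)] with q hq hq1 hqF
  refine ⟨(e.symm q).1, hq1, ?_⟩
  conv_lhs => rw [h.eq_apply_symm' hFG hq]
  rw [hqF, h.section_apply]

end IsChart

/-- The periods of the action at a point. -/
def IsAction.stabilizer (hG : IsAction G Y U) {q : N} (hq : q ∈ U) :
    Submodule ℤ (Fin 2 → ℝ) :=
  AddSubgroup.toIntSubmodule
    { carrier := {t | G t q = q}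
      zero_mem' := hG.zero q hq
      add_mem' := by
        intro s t hs ht
        simp only [mem_ofPred_eq] at *
        rw [hG.add _ _ q hq, ht, hs]
      neg_mem' := by
        intro t ht
        simp only [mem_ofPred_eq] at *
        conv_lhs => rw [← ht]
        rw [← hG.add _ _ q hq, neg_add_cancel, hG.zero q hq] }

theorem IsAction.mem_stabilizer (hG : IsAction G Y U) {q : N} (hq : q ∈ U) {t : Fin 2 → ℝ} :
    t ∈ hG.stabilizer hq ↔ G t q = q := Iff.rfl

/-- Each point of the level set has a neighborhood in which the level set is reached from it by
times of norm below one. By compactness finitely many such neighborhoods suffice, so the whole orbit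
is reached from `p` by bounded times. This prevents the lattice of periods from having rank less
than two. -/
theorem IsAction.isCompact_orbit_bound (hU : IsOpen U) (hG : IsAction G Y U)
    (hF : AnalyticOnNhd ℝ F U) (hFG : ∀ t, ∀ q ∈ U, F (G t q) = F q) {p : N} (hp : p ∈ U)
    (hK : IsCompact {q | q ∈ U ∧ F q = F p}) (hreg : ∀ q ∈ U, F q = F p → IsRegularAt F Y q) :
    ∃ R : ℝ, ∀ t, ∃ s : Fin 2 → ℝ, ‖s‖ ≤ R ∧ G t p = G s p := by
  have hloc : ∀ q ∈ U, F q = F p → ∀ᶠ q' in 𝓝 q, F q' = F q → ∃ t, ‖t‖ < 1 ∧ q' = G t q := by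
    intro q hq hqF
    obtain ⟨σ, e, h⟩ := exists_isChart hU hG hF hFG hq (hreg q hq hqF)
    exact h.eventually_mem_orbit hG hFG
  have key : ∃ R : ℝ, ∀ q ∈ {q | q ∈ U ∧ F q = F p}, (∃ t, q = G t p) →
      ∃ s : Fin 2 → ℝ, ‖s‖ ≤ R ∧ q = G s p := by
    refine hK.induction_on (p := fun S => ∃ R : ℝ, ∀ q ∈ S, (∃ t, q = G t p) →
      ∃ s : Fin 2 → ℝ, ‖s‖ ≤ R ∧ q = G s p) ⟨0, by simp⟩ ?_ ?_ ?_
    · rintro S T hST ⟨R, hR⟩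
      exact ⟨R, fun q hq => hR q (hST hq)⟩
    · rintro S T ⟨R, hR⟩ ⟨R', hR'⟩
      refine ⟨max R R', ?_⟩
      rintro q (hq | hq) ht
      · obtain ⟨s, hs, h⟩ := hR q hq ht
        exact ⟨s, hs.trans (le_max_left _ _), h⟩
      · obtain ⟨s, hs, h⟩ := hR' q hq ht
        exact ⟨s, hs.trans (le_max_right _ _), h⟩
    · rintro q ⟨hq, hqF⟩
      by_cases horb : ∃ t, q = G t p
      · obtain ⟨t, rfl⟩ := horb
        refine ⟨{q' | F q' = F (G t p) → ∃ s, ‖s‖ < 1 ∧ q' = G s (G t p)},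
          mem_nhdsWithin_of_mem_nhds (hloc _ hq hqF), ‖t‖ + 1, ?_⟩
        rintro q' hq' ⟨t', rfl⟩
        obtain ⟨s, hs, h⟩ := hq' (by rw [hFG _ _ hp, hFG _ _ hp])
        refine ⟨s + t, (norm_add_le _ _).trans (by linarith), ?_⟩
        rw [h, hG.add _ _ p hp]
      -- A point outside the orbit has a neighborhood free of orbit points, since a nearby orbit
      -- point would lie in the orbit of `q` as well. The bound `0` is thus vacuous.
      · refine ⟨{q' | F q' = F q → ∃ s, ‖s‖ < 1 ∧ q' = G s q},
          mem_nhdsWithin_of_mem_nhds (hloc _ hq hqF), 0, ?_⟩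
        rintro q' hq' ⟨t', rfl⟩
        obtain ⟨s, hs, h⟩ := hq' (by rw [hFG _ _ hp, hqF])
        refine absurd ⟨-s + t', ?_⟩ horb
        rw [hG.add _ _ p hp, h, ← hG.add _ _ q hq, neg_add_cancel, hG.zero q hq]
  obtain ⟨R, hR⟩ := key
  exact ⟨R, fun t => hR (G t p) ⟨hG.mem t p hp, hFG t p hp⟩ ⟨t, rfl⟩⟩

/-- The linear map `x ↦ x₀ b₀ + x₁ b₁`. -/
def comb (b : Fin 2 → Fin 2 → ℝ) (x : Fin 2 → ℝ) : Fin 2 → ℝ := x 0 • b 0 + x 1 • b 1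

/-- The determinant of two vectors. -/
def det₂ (b : Fin 2 → Fin 2 → ℝ) : ℝ := b 0 0 * b 1 1 - b 0 1 * b 1 0

/-- The inverse of the linear map `comb b`. -/
noncomputable def combInv (b : Fin 2 → Fin 2 → ℝ) (t : Fin 2 → ℝ) : Fin 2 → ℝ :=
  (det₂ b)⁻¹ • ![t 0 * b 1 1 - t 1 * b 1 0, b 0 0 * t 1 - b 0 1 * t 0]

theorem comb_combInv {b : Fin 2 → Fin 2 → ℝ} (hb : det₂ b ≠ 0) (t : Fin 2 → ℝ) :
    comb b (combInv b t) = t := by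
  ext i
  fin_cases i <;> simp [comb, combInv] <;> field_simp <;> simp [det₂] <;> ring

theorem combInv_comb {b : Fin 2 → Fin 2 → ℝ} (hb : det₂ b ≠ 0) (x : Fin 2 → ℝ) :
    combInv b (comb b x) = x := by
  ext i
  fin_cases i <;> simp [comb, combInv] <;> field_simp <;> simp [det₂] <;> ring

theorem comb_add (b : Fin 2 → Fin 2 → ℝ) (x y : Fin 2 → ℝ) :
    comb b (x + y) = comb b x + comb b y := by
  ext i
  simp [comb]
  ring

theorem comb_smul (b : Fin 2 → Fin 2 → ℝ) (c : ℝ) (x : Fin 2 → ℝ) :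
    comb b (c • x) = c • comb b x := by
  ext i
  simp [comb]
  ring

/-- The periods at a regular point with a compact regular level set form a lattice. -/
theorem IsAction.exists_lattice_basis (hU : IsOpen U) (hG : IsAction G Y U)
    (hF : AnalyticOnNhd ℝ F U) (hFG : ∀ t, ∀ q ∈ U, F (G t q) = F q) {p : N} (hp : p ∈ U)
    (hK : IsCompact {q | q ∈ U ∧ F q = F p}) (hreg : ∀ q ∈ U, F q = F p → IsRegularAt F Y q) :
    ∃ b : Fin 2 → Fin 2 → ℝ, det₂ b ≠ 0 ∧
      ∀ t, G t p = p ↔ ∃ n : Fin 2 → ℤ, t = comb b fun i => (n i : ℝ) := by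
  set Λ := hG.stabilizer hp with hΛ
  -- In an adapted chart `t ↦ G t p` is injective near `0`, so there are no small nonzero periods.
  have hdisc : DiscreteTopology Λ := by
    obtain ⟨σ, e, h⟩ := exists_isChart hU hG hF hFG hp (hreg p hp rfl)
    have h1 : ∀ᶠ t : Fin 2 → ℝ in 𝓝 0, (t, F p) ∈ e.source :=
      (by fun_prop : ContinuousAt (fun t : Fin 2 → ℝ => (t, F p)) 0).eventually
        (e.open_source.mem_nhds h.zero_mem)
    have h2 : ∀ᶠ t : Fin 2 → ℝ in 𝓝 0, t ∈ Λ → t = 0 := by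
      filter_upwards [h1] with t ht htΛ
      have h3 : e (t, F p) = e (0, F p) := by
        rw [h.apply_zero hG h.zero_mem, h.apply, h.section_apply]
        exact htΛ
      exact congrArg Prod.fst (e.injOn ht h.zero_mem h3)
    rw [discreteTopology_iff_isOpen_singleton_zero, isOpen_singleton_iff_nhds_eq_pure]
    refine le_antisymm ?_ (pure_le_nhds 0)
    have h3 : ∀ᶠ t : Λ in 𝓝 0, t = 0 := by
      have : ContinuousAt (fun t : Λ => (t : Fin 2 → ℝ)) 0 := continuous_subtype_val.continuousAt
      filter_upwards [this.eventually h2] with t ht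
      exact Subtype.ext (ht t.2)
    exact le_pure_iff.2 h3
  -- Otherwise some nonzero linear form vanishes on all periods. Every time is congruent to a
  -- bounded one modulo periods, so the form would be bounded on the plane.
  have hspan : Submodule.span ℝ (Λ : Set (Fin 2 → ℝ)) = ⊤ := by
    by_contra hne
    obtain ⟨f, hf0, hf⟩ := Submodule.exists_le_ker_of_lt_top _ (lt_top_iff_ne_top.2 hne)
    obtain ⟨R, hR⟩ := hG.isCompact_orbit_bound hU hF hFG hp hK hreg
    obtain ⟨v, hv⟩ : ∃ v, f v ≠ 0 := by
      by_contra! h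
      exact hf0 (LinearMap.ext h)
    set f' := LinearMap.toContinuousLinearMap f with hf'
    have hbound : ∀ t, |f t| ≤ ‖f'‖ * R := by
      intro t
      obtain ⟨s, hs, hst⟩ := hR t
      have h1 : t - s ∈ Λ := by
        rw [hΛ, hG.mem_stabilizer, sub_eq_neg_add, hG.add _ _ p hp, hst, ← hG.add _ _ p hp,
          neg_add_cancel, hG.zero p hp]
      have h2 : f (t - s) = 0 := hf (Submodule.subset_span h1)
      rw [map_sub, sub_eq_zero] at h2
      rw [h2]
      calc |f s| = ‖f' s‖ := rfl
        _ ≤ ‖f'‖ * ‖s‖ := f'.le_opNorm s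
        _ ≤ _ := by gcongr
    have h3 := hbound (((‖f'‖ * R + 1) / |f v|) • v)
    have hpos : 0 < |f v| := abs_pos.2 hv
    have hC : 0 ≤ ‖f'‖ * R := (abs_nonneg _).trans (hbound 0)
    rw [map_smul, smul_eq_mul, abs_mul, abs_div, abs_abs, div_mul_cancel₀ _ hpos.ne',
      abs_of_pos (by linarith)] at h3
    linarith
  have hlat : IsZLattice ℝ Λ := ⟨hspan⟩
  let B := IsZLattice.basis Λ
  refine ⟨fun i => B i, ?_, ?_⟩
  · have h1 : LinearIndependent ℝ fun i => ((B i : Λ) : Fin 2 → ℝ) := by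
      have := (B.ofZLatticeBasis ℝ Λ).linearIndependent
      rwa [show ⇑(B.ofZLatticeBasis ℝ Λ) = fun i => ((B i : Λ) : Fin 2 → ℝ) from
        funext fun i => B.ofZLatticeBasis_apply ℝ Λ i] at this
    have h2 := Matrix.linearIndependent_rows_iff_isUnit
      (A := Matrix.of fun i => ((B i : Λ) : Fin 2 → ℝ)) |>.1 h1
    rw [Matrix.isUnit_iff_isUnit_det, Matrix.det_fin_two] at h2
    simpa [det₂] using h2.ne_zero
  · intro t
    rw [← hG.mem_stabilizer hp, ← hΛ]
    constructor
    · intro ht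
      refine ⟨B.repr ⟨t, ht⟩, ?_⟩
      have h1 := congrArg (Subtype.val) (B.sum_repr ⟨t, ht⟩)
      simp only [Fin.sum_univ_two] at h1
      refine h1.symm.trans ?_
      ext i
      simp [comb]
    · rintro ⟨n, rfl⟩
      have h1 : comb (fun i => ((B i : Λ) : Fin 2 → ℝ)) (fun i => (n i : ℝ))
          = ((n 0 • B 0 + n 1 • B 1 : Λ) : Fin 2 → ℝ) := by
        ext i
        simp [comb]
      rw [h1]
      exact Subtype.mem _

end AnalyticFlow

end

/-! ### Analytic dependence of the periods, and the tori -/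

section

open scoped Topology ContDiff NNReal
open Set Filter Metric

namespace Chaplygin

theorem toTorus_add (x y : Fin 2 → ℝ) : toTorus (x + y) = toTorus x + toTorus y := rfl

theorem toTorus_surjective : Function.Surjective toTorus := by
  intro z
  choose x hx using fun i => QuotientAddGroup.mk_surjective (z i)
  exact ⟨x, funext hx⟩

theorem toTorus_eq_zero_iff {x : Fin 2 → ℝ} :
    toTorus x = 0 ↔ ∃ n : Fin 2 → ℤ, x = fun i => (n i : ℝ) := by
  have h : ∀ i, (x i : UnitAddCircle) = 0 ↔ ∃ n : ℤ, x i = n := by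
    intro i
    rw [AddCircle.coe_eq_zero_iff]
    simp [eq_comm]
  constructor
  · intro hx
    choose n hn using fun i => (h i).1 (congrFun hx i)
    exact ⟨n, funext hn⟩
  · rintro ⟨n, rfl⟩
    exact funext fun i => (h i).2 ⟨n i, rfl⟩

theorem toTorus_eq_iff {x y : Fin 2 → ℝ} :
    toTorus x = toTorus y ↔ ∃ n : Fin 2 → ℤ, x - y = fun i => (n i : ℝ) := by
  rw [← toTorus_eq_zero_iff, ← sub_eq_zero]
  rfl

end Chaplygin

namespace AnalyticFlow

set_option linter.unusedSectionVars false

variable {N Q : Type*} [NormedAddCommGroup N] [NormedSpace ℝ N] [CompleteSpace N]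
  [NormedAddCommGroup Q] [NormedSpace ℝ Q] [FiniteDimensional ℝ Q]
  {Y : Fin 2 → N → N} {U : Set N} {G : (Fin 2 → ℝ) → N → N} {F : N → Q}

theorem analyticAt_combInv {E : Type*} [NormedAddCommGroup E] [NormedSpace ℝ E]
    {b : E → Fin 2 → Fin 2 → ℝ} {t : E → Fin 2 → ℝ} {a : E} (hb : AnalyticAt ℝ b a)
    (ht : AnalyticAt ℝ t a) (h0 : det₂ (b a) ≠ 0) :
    AnalyticAt ℝ (fun x => combInv (b x) (t x)) a := by
  have hb' : ∀ i j, AnalyticAt ℝ (fun x => b x i j) a := fun i j =>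
    analyticAt_pi_iff.1 (analyticAt_pi_iff.1 hb i) j
  have ht' : ∀ i, AnalyticAt ℝ (fun x => t x i) a := fun i => analyticAt_pi_iff.1 ht i
  have hd : AnalyticAt ℝ (fun x => (det₂ (b x))⁻¹) a :=
    (((hb' 0 0).mul (hb' 1 1)).sub ((hb' 0 1).mul (hb' 1 0))).inv h0
  refine hd.smul (AnalyticAt.pi fun i => ?_)
  fin_cases i
  · exact ((ht' 0).mul (hb' 1 1)).sub ((ht' 1).mul (hb' 1 0))
  · exact ((hb' 0 0).mul (ht' 1)).sub ((hb' 0 1).mul (ht' 0))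

theorem analyticAt_comb {E : Type*} [NormedAddCommGroup E] [NormedSpace ℝ E]
    {b : E → Fin 2 → Fin 2 → ℝ} {t : E → Fin 2 → ℝ} {a : E} (hb : AnalyticAt ℝ b a)
    (ht : AnalyticAt ℝ t a) : AnalyticAt ℝ (fun x => comb (b x) (t x)) a := by
  have ht' : ∀ i, AnalyticAt ℝ (fun x => t x i) a := fun i => analyticAt_pi_iff.1 ht i
  exact ((ht' 0).smul (analyticAt_pi_iff.1 hb 0)).add ((ht' 1).smul (analyticAt_pi_iff.1 hb 1))

/-- The periods of the action depend analytically on the value of the integrals. -/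
theorem IsChart.exists_period {p : N} {σ : Q → N}
    {e : OpenPartialHomeomorph ((Fin 2 → ℝ) × Q) N} (h : IsChart G U F p σ e)
    (hG : IsAction G Y U) (hp : p ∈ U) (hFG : ∀ t, ∀ q ∈ U, F (G t q) = F q)
    {b : Fin 2 → ℝ} (hb : G b p = p) :
    ∃ β : Q → Fin 2 → ℝ, β (F p) = b ∧ AnalyticAt ℝ β (F p) ∧
      ∀ᶠ ε in 𝓝 (F p), G (β ε) (σ ε) = σ ε := by
  have hb' : G (-b) p = p := (hG.stabilizer hp).neg_mem hb
  have ht : p ∈ e.target := by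
    have := h.section_mem_target hG h.zero_mem
    rwa [h.section_apply] at this
  have h0 : e.symm p = (0, F p) := by
    have := h.symm_section hG h.zero_mem
    rwa [h.section_apply] at this
  have hσ : AnalyticAt ℝ σ (F p) := h.analytic_section _ h.zero_mem
  have h1 : AnalyticAt ℝ (fun ε => G (-b) (σ ε)) (F p) :=
    hG.analyticAt_comp analyticAt_const hσ (by rw [h.section_apply]; exact hp)
  have h2 : G (-b) (σ (F p)) = p := by rw [h.section_apply, hb']
  have h3 : AnalyticAt ℝ (fun ε => e.symm (G (-b) (σ ε))) (F p) :=
    AnalyticAt.fun_comp (g := e.symm) (f := fun ε => G (-b) (σ ε))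
      (h.analytic_symm _ (by rw [h2]; exact ht)) h1
  have h4 : AnalyticAt ℝ (fun ε => (e.symm (G (-b) (σ ε))).1) (F p) :=
    AnalyticAt.fun_comp (g := Prod.fst) (f := fun ε => e.symm (G (-b) (σ ε))) analyticAt_fst h3
  -- The point `G (-b) (σ ε)` is close to `p` and on the level of `σ ε`. The chart writes it as `G s
  -- (σ ε)` with `s` small, so `b + s` is a period at `σ ε`.
  refine ⟨fun ε => b + (e.symm (G (-b) (σ ε))).1, ?_, analyticAt_const.add h4, ?_⟩
  · simp only [h2, h0, add_zero]
  · have h5 : ∀ᶠ ε in 𝓝 (F p), G (-b) (σ ε) ∈ e.target :=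
      h1.continuousAt.eventually (e.open_target.mem_nhds (by simpa only [h2] using ht))
    have h6 : ∀ᶠ ε in 𝓝 (F p), ((0, ε) : (Fin 2 → ℝ) × Q) ∈ e.source :=
      (by fun_prop : ContinuousAt (fun ε : Q => ((0, ε) : (Fin 2 → ℝ) × Q)) (F p)).eventually
        (e.open_source.mem_nhds h.zero_mem)
    filter_upwards [h5, h6] with ε h7 h8
    have hσU : σ ε ∈ U := h.section_mem _ h8
    have hFσ : F (σ ε) = ε := h.map_section _ h8
    have h9 := h.eq_apply_symm' hFG h7
    rw [hFG _ _ hσU, hFσ] at h9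
    rw [hG.add _ _ _ hσU, ← h9, ← hG.add _ _ _ hσU, add_neg_cancel, hG.zero _ hσU]

/-- The lattices of the periods of the action depend analytically on the value of the
integrals. -/
theorem IsAction.exists_period_lattice (hU : IsOpen U) (hG : IsAction G Y U)
    (hF : AnalyticOnNhd ℝ F U) (hFG : ∀ t, ∀ q ∈ U, F (G t q) = F q) {p : N} (hp : p ∈ U)
    (hK : IsCompact {q | q ∈ U ∧ F q = F p}) (hreg : ∀ q ∈ U, F q = F p → IsRegularAt F Y q) :
    ∃ (σ : Q → N) (e : OpenPartialHomeomorph ((Fin 2 → ℝ) × Q) N) (β : Q → Fin 2 → Fin 2 → ℝ)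
      (E : Set Q), IsChart G U F p σ e ∧ IsOpen E ∧ F p ∈ E ∧ ∀ ε ∈ E, (0, ε) ∈ e.source ∧
        AnalyticAt ℝ β ε ∧ det₂ (β ε) ≠ 0 ∧
        ∀ x, G (comb (β ε) x) (σ ε) = σ ε ↔ ∃ n : Fin 2 → ℤ, x = fun i => (n i : ℝ) := by
  obtain ⟨b, hdet, hlat⟩ := hG.exists_lattice_basis hU hF hFG hp hK hreg
  obtain ⟨σ, e, h⟩ := exists_isChart hU hG hF hFG hp (hreg p hp rfl)
  have hbi : ∀ i, G (b i) p = p := by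
    intro i
    refine (hlat _).2 ⟨Pi.single i 1, ?_⟩
    fin_cases i <;> simp [comb]
  choose β' hβb hβa hβ using fun i => h.exists_period hG hp hFG (hbi i)
  set β : Q → Fin 2 → Fin 2 → ℝ := fun ε i => β' i ε with hβdef
  have hβ0 : β (F p) = b := funext hβb
  have hβan : AnalyticAt ℝ β (F p) := AnalyticAt.pi hβa
  have hσ : AnalyticAt ℝ σ (F p) := h.analytic_section _ h.zero_mem
  have h1 : ∀ᶠ ε in 𝓝 (F p), ((0, ε) : (Fin 2 → ℝ) × Q) ∈ e.source :=
    (by fun_prop : ContinuousAt (fun ε : Q => ((0, ε) : (Fin 2 → ℝ) × Q)) (F p)).eventually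
      (e.open_source.mem_nhds h.zero_mem)
  have h3 : ∀ᶠ ε in 𝓝 (F p), det₂ (β ε) ≠ 0 := by
    have hc : ContinuousAt (fun ε => det₂ (β ε)) (F p) := by
      have hβ' : ∀ i j, ContinuousAt (fun ε => β ε i j) (F p) := fun i j =>
        continuousAt_pi.1 (continuousAt_pi.1 hβan.continuousAt i) j
      exact ((hβ' 0 0).mul (hβ' 1 1)).sub ((hβ' 0 1).mul (hβ' 1 0))
    exact hc.eventually_ne (by rw [hβ0]; exact hdet)
  have h4 : ∀ᶠ ε in 𝓝 (F p), ∀ i, G (β ε i) (σ ε) = σ ε := eventually_all.2 hβ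
  -- The continued periods must still generate all periods. It suffices that no nonzero `y` in the
  -- fundamental cube gives one, and by compactness this is local in `(ε, y)`: near `y = 0` by
  -- injectivity of the chart, elsewhere by continuity, since at `F p` only integral `y` give
  -- periods.
  have h5 : ∀ᶠ ε in 𝓝 (F p), ∀ y ∈ closedBall (0 : Fin 2 → ℝ) (1 / 2),
      G (comb (β ε) y) (σ ε) = σ ε → y = 0 := by
    refine (isCompact_closedBall _ _).eventually_forall_of_forall_eventually ?_
    intro y hy
    have hβz : AnalyticAt ℝ (fun z : Q × (Fin 2 → ℝ) => β z.1) (F p, y) :=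
      AnalyticAt.fun_comp (g := β) (f := fun z : Q × (Fin 2 → ℝ) => z.1) hβan analyticAt_fst
    have hσz : AnalyticAt ℝ (fun z : Q × (Fin 2 → ℝ) => σ z.1) (F p, y) :=
      AnalyticAt.fun_comp (g := σ) (f := fun z : Q × (Fin 2 → ℝ) => z.1) hσ analyticAt_fst
    have hcz : AnalyticAt ℝ (fun z : Q × (Fin 2 → ℝ) => comb (β z.1) z.2) (F p, y) :=
      analyticAt_comb hβz analyticAt_snd
    by_cases hy0 : y = 0
    · subst hy0
      have hc : ContinuousAt (fun z : Q × (Fin 2 → ℝ) => (comb (β z.1) z.2, z.1))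
          (F p, 0) := hcz.continuousAt.prodMk continuousAt_fst
      have h6 := hc.eventually (e.open_source.mem_nhds (by simpa [comb] using h.zero_mem))
      have h7 : ∀ᶠ z : Q × (Fin 2 → ℝ) in 𝓝 (F p, 0),
          ((0, z.1) : (Fin 2 → ℝ) × Q) ∈ e.source ∧ det₂ (β z.1) ≠ 0 :=
        (show ContinuousAt (Prod.fst : Q × (Fin 2 → ℝ) → Q) (F p, 0) from
          continuousAt_fst).eventually (h1.and h3)
      filter_upwards [h6, h7] with z hz1 hz2 hz3
      have h8 : e (comb (β z.1) z.2, z.1) = e (0, z.1) := by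
        rw [h.apply_zero hG hz2.1, h.apply]
        exact hz3
      have h9 := congrArg Prod.fst (e.injOn hz1 hz2.1 h8)
      have h10 := combInv_comb hz2.2 z.2
      simp only at h9
      rw [← h10, h9]
      ext i
      fin_cases i <;> simp [combInv]
    · have hc : AnalyticAt ℝ (fun z : Q × (Fin 2 → ℝ) => G (comb (β z.1) z.2) (σ z.1)) (F p, y) :=
        hG.analyticAt_comp hcz hσz (by rw [h.section_apply]; exact hp)
      have hne : G (comb (β (F p)) y) (σ (F p)) - σ (F p) ≠ 0 := by
        rw [h.section_apply, sub_ne_zero, hβ0]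
        intro hyp
        obtain ⟨n, hn⟩ := (hlat _).1 hyp
        refine hy0 ?_
        have h6 : y = fun i => (n i : ℝ) := by
          rw [← combInv_comb hdet y, hn, combInv_comb hdet]
        rw [mem_closedBall_zero_iff, pi_norm_le_iff_of_nonneg (by norm_num)] at hy
        ext i
        have h7 := hy i
        rw [h6, Real.norm_eq_abs, ← Int.cast_abs] at h7
        have h8 : |n i| < 1 := by
          have : ((|n i| : ℤ) : ℝ) < 1 := h7.trans_lt (by norm_num)
          exact_mod_cast this
        simp [h6, Int.abs_lt_one_iff.1 h8]
      filter_upwards [(hc.continuousAt.sub hσz.continuousAt).eventually_ne hne] with z hz hz'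
      exact absurd (sub_eq_zero.2 hz') hz
  obtain ⟨E, hE, hEo, hpE⟩ := _root_.eventually_nhds_iff.1
    (h1.and (hβan.eventually_analyticAt.and (h3.and (h4.and h5))))
  refine ⟨σ, e, β, E, h, hEo, hpE, fun ε hε => ?_⟩
  obtain ⟨g1, g2, g3, g4, g5⟩ := hE ε hε
  refine ⟨g1, g2, g3, fun x => ?_⟩
  have hσU := h.section_mem _ g1
  have hint : ∀ n : Fin 2 → ℤ, comb (β ε) (fun i => (n i : ℝ)) ∈ hG.stabilizer hσU := by
    intro n
    have h6 : comb (β ε) (fun i => (n i : ℝ)) = n 0 • β ε 0 + n 1 • β ε 1 := by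
      ext i
      simp [comb]
    rw [h6]
    exact add_mem ((hG.stabilizer hσU).smul_mem _ (g4 0)) ((hG.stabilizer hσU).smul_mem _ (g4 1))
  constructor
  · intro hx
    -- Rounding leaves a remainder with entries of absolute value at most `1 / 2`, which explains
    -- the radius of the ball in `h5`.
    refine ⟨fun i => round (x i), ?_⟩
    have h6 : comb (β ε) (x - fun i => (round (x i) : ℝ)) ∈ hG.stabilizer hσU := by
      have h7 := (hG.stabilizer hσU).sub_mem hx (hint fun i => round (x i))
      have h8 := comb_add (β ε) (x - fun i => (round (x i) : ℝ)) fun i => (round (x i) : ℝ)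
      rw [sub_add_cancel] at h8
      rwa [h8, add_sub_cancel_right] at h7
    have h7 := g5 _ (by
      rw [mem_closedBall_zero_iff, pi_norm_le_iff_of_nonneg (by norm_num)]
      exact fun i => abs_sub_round (x i)) h6
    exact sub_eq_zero.1 h7
  · rintro ⟨n, rfl⟩
    exact hint n

/-- The tori of an analytic action of `ℝ²` with compact regular level sets. -/
theorem IsAction.exists_tori (hU : IsOpen U) (hG : IsAction G Y U)
    (hF : AnalyticOnNhd ℝ F U) (hFG : ∀ t, ∀ q ∈ U, F (G t q) = F q) {p : N} (hp : p ∈ U)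
    (hK : IsCompact {q | q ∈ U ∧ F q = F p}) (hreg : ∀ q ∈ U, F q = F p → IsRegularAt F Y q) :
    ∃ (E : Set Q) (Φ : UnitAddTorus (Fin 2) → Q → N) (ν : Q → Fin 2 → ℝ),
      IsOpen E ∧ F p ∈ E ∧ AnalyticOnNhd ℝ ν E ∧ (∃ z, Φ z (F p) = p) ∧
      (∀ z, ∀ ε ∈ E, Φ z ε ∈ U ∧ F (Φ z ε) = ε) ∧
      (∀ ε ∈ E, Function.Injective fun z => Φ z ε) ∧
      AnalyticOnNhd ℝ (fun z : (Fin 2 → ℝ) × Q => Φ (Chaplygin.toTorus z.1) z.2) (univ ×ˢ E) ∧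
      (∀ z, ∀ ε ∈ E, ∃ g : N → (Fin 2 → ℝ) × Q, AnalyticAt ℝ g (Φ z ε) ∧
        ∀ᶠ q in 𝓝 (Φ z ε), (g q).2 ∈ E ∧ Φ (Chaplygin.toTorus (g q).1) (g q).2 = q) ∧
      (∀ z, ∀ ε ∈ E, ∀ s : ℝ,
        Φ (z + Chaplygin.toTorus (s • ν ε)) ε = G (Pi.single 0 s) (Φ z ε)) := by
  obtain ⟨σ, e, β, E, h, hE, hpE, hall⟩ := hG.exists_period_lattice hU hF hFG hp hK hreg
  -- An arbitrary lift of `z` is used; for `ε ∈ E` the value does not depend on it, by `hiff`.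
  -- Outside `E` the definition is meaningless and not used.
  set Φ : UnitAddTorus (Fin 2) → Q → N := fun z ε =>
    G (comb (β ε) (Function.surjInv Chaplygin.toTorus_surjective z)) (σ ε) with hΦdef
  have hiff : ∀ x y, ∀ ε ∈ E, G (comb (β ε) x) (σ ε) = G (comb (β ε) y) (σ ε) ↔
      Chaplygin.toTorus x = Chaplygin.toTorus y := by
    intro x y ε hε
    obtain ⟨g1, g2, g3, g4⟩ := hall ε hε
    have hσU := h.section_mem _ g1
    rw [Chaplygin.toTorus_eq_iff, ← g4 (x - y)]
    have h1 : comb (β ε) x = comb (β ε) y + comb (β ε) (x - y) := by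
      rw [← comb_add, add_sub_cancel]
    constructor
    · intro hxy
      have h2 : comb (β ε) (x - y) = -comb (β ε) y + comb (β ε) x := by rw [h1]; abel
      rw [h2, hG.add _ _ _ hσU, hxy, ← hG.add _ _ _ hσU, neg_add_cancel, hG.zero _ hσU]
    · intro hxy
      rw [h1, hG.add _ _ _ hσU, hxy]
  have hΦ : ∀ x, ∀ ε ∈ E, Φ (Chaplygin.toTorus x) ε = G (comb (β ε) x) (σ ε) := by
    intro x ε hε
    exact (hiff _ _ ε hε).2 (Function.surjInv_eq Chaplygin.toTorus_surjective _)
  have hEz : ∀ z : (Fin 2 → ℝ) × Q, z.2 ∈ E → ∀ᶠ w in 𝓝 z, w.2 ∈ E := fun z hz =>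
    continuousAt_snd.eventually (hE.mem_nhds hz)
  -- The frequencies are the coordinates, in the basis of periods, of the direction of the first
  -- field.
  refine ⟨E, Φ, fun ε => combInv (β ε) (Pi.single 0 1), hE, hpE, ?_, ?_, ?_, ?_, ?_, ?_, ?_⟩
  · intro ε hε
    exact analyticAt_combInv (hall ε hε).2.1 analyticAt_const (hall ε hε).2.2.1
  · refine ⟨Chaplygin.toTorus 0, ?_⟩
    rw [hΦ _ _ hpE, h.section_apply]
    simp [comb, hG.zero p hp]
  · intro z ε hε
    have g1 := (hall ε hε).1
    have hσU := h.section_mem _ g1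
    exact ⟨hG.mem _ _ hσU, by rw [hFG _ _ hσU, h.map_section _ g1]⟩
  · intro ε hε z w hzw
    obtain ⟨x, rfl⟩ := Chaplygin.toTorus_surjective z
    obtain ⟨y, rfl⟩ := Chaplygin.toTorus_surjective w
    simp only [hΦ _ _ hε] at hzw
    exact (hiff x y ε hε).1 hzw
  · rintro ⟨x, ε⟩ ⟨-, hε⟩
    obtain ⟨g1, g2, g3, g4⟩ := hall ε hε
    have h1 : AnalyticAt ℝ (fun z : (Fin 2 → ℝ) × Q => β z.2) (x, ε) :=
      AnalyticAt.fun_comp (g := β) (f := fun z : (Fin 2 → ℝ) × Q => z.2) g2 analyticAt_snd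
    have h2 : AnalyticAt ℝ (fun z : (Fin 2 → ℝ) × Q => σ z.2) (x, ε) :=
      AnalyticAt.fun_comp (g := σ) (f := fun z : (Fin 2 → ℝ) × Q => z.2)
        (h.analytic_section (0, ε) g1) analyticAt_snd
    refine (hG.analyticAt_comp (analyticAt_comb h1 analyticAt_fst) h2 (h.section_mem (0, ε) g1)).congr ?_
    filter_upwards [hEz (x, ε) hε] with z hz
    exact (hΦ z.1 z.2 hz).symm
  · intro z ε hε
    obtain ⟨x, rfl⟩ := Chaplygin.toTorus_surjective z
    obtain ⟨g1, g2, g3, g4⟩ := hall ε hε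
    have hσU := h.section_mem _ g1
    set t := comb (β ε) x with ht
    set q₀ := Φ (Chaplygin.toTorus x) ε with hq₀
    have hq₀' : q₀ = G t (σ ε) := hΦ x ε hε
    have hq₀U : q₀ ∈ U := hq₀' ▸ hG.mem _ _ hσU
    have hback : G (-t) q₀ = σ ε := by
      rw [hq₀', ← hG.add _ _ _ hσU, neg_add_cancel, hG.zero _ hσU]
    have ha : AnalyticAt ℝ (fun q => G (-t) q) q₀ :=
      hG.analyticAt_comp analyticAt_const analyticAt_id hq₀U
    have hmem : G (-t) q₀ ∈ e.target := by
      rw [hback]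
      exact h.section_mem_target hG g1
    have hz : AnalyticAt ℝ (fun q => e.symm (G (-t) q)) q₀ :=
      AnalyticAt.fun_comp (g := e.symm) (f := fun q => G (-t) q) (h.analytic_symm _ hmem) ha
    have hz0 : e.symm (G (-t) q₀) = (0, ε) := by rw [hback, h.symm_section hG g1]
    have hz1 : AnalyticAt ℝ (fun q => (e.symm (G (-t) q)).1) q₀ :=
      AnalyticAt.fun_comp (g := Prod.fst) (f := fun q => e.symm (G (-t) q)) analyticAt_fst hz
    have hz2 : AnalyticAt ℝ (fun q => (e.symm (G (-t) q)).2) q₀ :=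
      AnalyticAt.fun_comp (g := Prod.snd) (f := fun q => e.symm (G (-t) q)) analyticAt_snd hz
    -- The chart lives near the section only: `q` is moved back by `-t`, its chart coordinates are
    -- read off, and `t` is added to the time again.
    refine ⟨fun q => (combInv (β (e.symm (G (-t) q)).2) (t + (e.symm (G (-t) q)).1),
      (e.symm (G (-t) q)).2), (analyticAt_combInv ?_ (analyticAt_const.add hz1) ?_).prod hz2, ?_⟩
    · exact AnalyticAt.fun_comp (g := β) (f := fun q => (e.symm (G (-t) q)).2)
        (by rw [hz0]; exact g2) hz2
    · rw [hz0]
      exact g3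
    · have e1 : ∀ᶠ q in 𝓝 q₀, G (-t) q ∈ e.target :=
        ha.continuousAt.eventually (e.open_target.mem_nhds hmem)
      have e2 : ∀ᶠ q in 𝓝 q₀, (e.symm (G (-t) q)).2 ∈ E :=
        hz2.continuousAt.eventually (hE.mem_nhds (by simpa only [hz0] using hε))
      filter_upwards [e1, e2, hU.mem_nhds hq₀U] with q h1 h2 h3
      refine ⟨h2, ?_⟩
      have hσ' := h.section_mem _ (hall _ h2).1
      rw [hΦ _ _ h2, comb_combInv (hall _ h2).2.2.1, hG.add _ _ _ hσ', ← h.eq_apply_symm h1,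
        ← hG.add _ _ _ h3, add_neg_cancel, hG.zero _ h3]
  · intro z ε hε s
    obtain ⟨x, rfl⟩ := Chaplygin.toTorus_surjective z
    obtain ⟨g1, g2, g3, g4⟩ := hall ε hε
    have hσU := h.section_mem _ g1
    have h1 : (Pi.single 0 s : Fin 2 → ℝ) = s • Pi.single 0 1 := by
      ext i
      fin_cases i <;> simp
    rw [← Chaplygin.toTorus_add, hΦ _ _ hε, hΦ _ _ hε, add_comm, comb_add, comb_smul,
      comb_combInv g3, ← h1, hG.add _ _ _ hσU]

end AnalyticFlow

end

/-! ### Calculus and algebra of vectors and matrices in three-space -/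

section

open scoped Matrix Matrix.Norms.Elementwise Topology
open Set Filter

namespace Chaplygin

theorem dot_eq (x y : Vec) : x ⬝ᵥ y = x 0 * y 0 + x 1 * y 1 + x 2 * y 2 := by
  simp [dotProduct, Fin.sum_univ_three]

theorem cross_apply_zero (x y : Vec) : (x ⨯₃ y) 0 = x 1 * y 2 - x 2 * y 1 := rfl

theorem cross_apply_one (x y : Vec) : (x ⨯₃ y) 1 = x 2 * y 0 - x 0 * y 2 := rfl

theorem cross_apply_two (x y : Vec) : (x ⨯₃ y) 2 = x 0 * y 1 - x 1 * y 0 := rfl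

theorem vec_ext {x y : Vec} (h0 : x 0 = y 0) (h1 : x 1 = y 1) (h2 : x 2 = y 2) : x = y := by
  ext i
  fin_cases i <;> assumption

section Calculus

theorem hasDerivAt_dotProduct {f g : ℝ → Vec} {f' g' : Vec} {t : ℝ} (hf : HasDerivAt f f' t)
    (hg : HasDerivAt g g' t) :
    HasDerivAt (fun s => f s ⬝ᵥ g s) (f' ⬝ᵥ g t + f t ⬝ᵥ g') t := by
  rw [hasDerivAt_pi] at hf hg
  simp only [dot_eq]
  exact ((((hf 0).mul (hg 0)).add ((hf 1).mul (hg 1))).add ((hf 2).mul (hg 2))).congr_deriv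
    (by ring)

theorem hasDerivAt_cross {f g : ℝ → Vec} {f' g' : Vec} {t : ℝ} (hf : HasDerivAt f f' t)
    (hg : HasDerivAt g g' t) :
    HasDerivAt (fun s => f s ⨯₃ g s) (f' ⨯₃ g t + f t ⨯₃ g') t := by
  rw [hasDerivAt_pi] at hf hg ⊢
  intro i
  fin_cases i
  · exact (((hf 1).mul (hg 2)).sub ((hf 2).mul (hg 1))).congr_deriv
      (by simp [cross_apply]; ring)
  · exact (((hf 2).mul (hg 0)).sub ((hf 0).mul (hg 2))).congr_deriv
      (by simp [cross_apply]; ring)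
  · exact (((hf 0).mul (hg 1)).sub ((hf 1).mul (hg 0))).congr_deriv
      (by simp [cross_apply]; ring)

theorem hasDerivAt_matrix {f : ℝ → Matrix (Fin 3) (Fin 3) ℝ} {f' : Matrix (Fin 3) (Fin 3) ℝ}
    {t : ℝ} : HasDerivAt f f' t ↔ ∀ i j, HasDerivAt (fun s => f s i j) (f' i j) t :=
  hasDerivAt_pi.trans (forall_congr' fun _ => hasDerivAt_pi)

theorem hasDerivAt_mulVec {f : ℝ → Matrix (Fin 3) (Fin 3) ℝ} {g : ℝ → Vec}
    {f' : Matrix (Fin 3) (Fin 3) ℝ} {g' : Vec} {t : ℝ} (hf : HasDerivAt f f' t)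
    (hg : HasDerivAt g g' t) :
    HasDerivAt (fun s => f s *ᵥ g s) (f' *ᵥ g t + f t *ᵥ g') t := by
  rw [hasDerivAt_pi]
  intro i
  exact hasDerivAt_dotProduct (hasDerivAt_pi.1 hf i) hg

theorem hasDerivAt_mul {f g : ℝ → Matrix (Fin 3) (Fin 3) ℝ}
    {f' g' : Matrix (Fin 3) (Fin 3) ℝ} {t : ℝ} (hf : HasDerivAt f f' t)
    (hg : HasDerivAt g g' t) :
    HasDerivAt (fun s => f s * g s) (f' * g t + f t * g') t := by
  rw [hasDerivAt_matrix] at hg ⊢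
  intro i j
  exact hasDerivAt_dotProduct (g := fun s k => g s k j) (g' := fun k => g' k j)
    (hasDerivAt_pi.1 hf i) (hasDerivAt_pi.2 fun k => hg k j)

theorem hasDerivAt_transpose {f : ℝ → Matrix (Fin 3) (Fin 3) ℝ}
    {f' : Matrix (Fin 3) (Fin 3) ℝ} {t : ℝ} (hf : HasDerivAt f f' t) :
    HasDerivAt (fun s => (f s)ᵀ) f'ᵀ t := by
  rw [hasDerivAt_matrix] at hf ⊢
  exact fun i j => hf j i

theorem hasDerivAt_hat {f : ℝ → Vec} {f' : Vec} {t : ℝ} (hf : HasDerivAt f f' t) :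
    HasDerivAt (fun s => hat (f s)) (hat f') t := by
  rw [hasDerivAt_pi] at hf
  rw [hasDerivAt_matrix]
  intro i j
  fin_cases i <;> fin_cases j <;> simp only [hat] <;>
    first
    | exact hasDerivAt_const t (0 : ℝ)
    | exact hf _
    | exact (hf _).neg

variable {E : Type*} [NormedAddCommGroup E] [NormedSpace ℝ E] {x : E}

theorem analyticAt_dotProduct {f g : E → Vec} (hf : AnalyticAt ℝ f x) (hg : AnalyticAt ℝ g x) :
    AnalyticAt ℝ (fun y => f y ⬝ᵥ g y) x := by
  rw [analyticAt_pi_iff] at hf hg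
  simp only [dot_eq]
  exact (((hf 0).mul (hg 0)).add ((hf 1).mul (hg 1))).add ((hf 2).mul (hg 2))

theorem analyticAt_cross {f g : E → Vec} (hf : AnalyticAt ℝ f x) (hg : AnalyticAt ℝ g x) :
    AnalyticAt ℝ (fun y => f y ⨯₃ g y) x := by
  rw [analyticAt_pi_iff] at hf hg ⊢
  intro i
  fin_cases i
  · exact ((hf 1).mul (hg 2)).sub ((hf 2).mul (hg 1))
  · exact ((hf 2).mul (hg 0)).sub ((hf 0).mul (hg 2))
  · exact ((hf 0).mul (hg 1)).sub ((hf 1).mul (hg 0))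

theorem analyticAt_matrix {f : E → Matrix (Fin 3) (Fin 3) ℝ} :
    AnalyticAt ℝ f x ↔ ∀ i j, AnalyticAt ℝ (fun y => f y i j) x :=
  analyticAt_pi_iff.trans (forall_congr' fun _ => analyticAt_pi_iff)

theorem analyticAt_mulVec {f : E → Matrix (Fin 3) (Fin 3) ℝ} {g : E → Vec}
    (hf : AnalyticAt ℝ f x) (hg : AnalyticAt ℝ g x) : AnalyticAt ℝ (fun y => f y *ᵥ g y) x := by
  rw [analyticAt_pi_iff]
  intro i
  exact analyticAt_dotProduct (analyticAt_pi_iff.1 hf i) hg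

theorem analyticAt_mul {f g : E → Matrix (Fin 3) (Fin 3) ℝ}
    (hf : AnalyticAt ℝ f x) (hg : AnalyticAt ℝ g x) : AnalyticAt ℝ (fun y => f y * g y) x := by
  rw [analyticAt_matrix] at hg ⊢
  intro i j
  exact analyticAt_dotProduct (g := fun s k => g s k j)
    (analyticAt_pi_iff.1 hf i) (analyticAt_pi_iff.2 fun k => hg k j)

theorem analyticAt_transpose {f : E → Matrix (Fin 3) (Fin 3) ℝ} (hf : AnalyticAt ℝ f x) :
    AnalyticAt ℝ (fun y => (f y)ᵀ) x := by
  rw [analyticAt_matrix] at hf ⊢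
  exact fun i j => hf j i

theorem analyticAt_hat {f : E → Vec} (hf : AnalyticAt ℝ f x) :
    AnalyticAt ℝ (fun y => hat (f y)) x := by
  rw [analyticAt_pi_iff] at hf
  rw [analyticAt_matrix]
  intro i j
  fin_cases i <;> fin_cases j <;> simp only [hat] <;>
    first
    | exact analyticAt_const
    | exact hf _
    | exact (hf _).neg

end Calculus

section Algebra

theorem bodyVertical_mul_hat (A : Matrix (Fin 3) (Fin 3) ℝ) (ν : Vec) :
    bodyVertical (A * hat ν) = bodyVertical A ⨯₃ ν := by
  have h : (hat ν)ᵀ = -hat ν := by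
    ext i j
    fin_cases i <;> fin_cases j <;> simp [hat]
  rw [bodyVertical, Matrix.transpose_mul, h, ← Matrix.mulVec_mulVec, Matrix.neg_mulVec, hat_mulVec,
    ← cross_anticomm, neg_neg]
  rfl

theorem hat_add (x y : Vec) : hat (x + y) = hat x + hat y := by
  ext i j
  fin_cases i <;> fin_cases j <;> simp [hat] <;> ring

theorem hat_smul (c : ℝ) (x : Vec) : hat (c • x) = c • hat x := by
  ext i j
  fin_cases i <;> fin_cases j <;> simp [hat]

theorem hat_mul_hat_sub (x y : Vec) : hat x * hat y - hat y * hat x = hat (x ⨯₃ y) := by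
  ext i j
  fin_cases i <;> fin_cases j <;>
    simp [hat, cross_apply] <;> ring

theorem hat_injective : Function.Injective hat := by
  intro x y h
  ext i
  fin_cases i
  · exact congrFun (congrFun h 2) 1
  · exact congrFun (congrFun h 0) 2
  · exact congrFun (congrFun h 1) 0

theorem exists_eq_hat {S : Matrix (Fin 3) (Fin 3) ℝ} (h : ∀ i j, S i j + S j i = 0) :
    ∃ ν, S = hat ν := by
  refine ⟨![S 2 1, S 0 2, S 1 0], ?_⟩
  ext i j
  have h' := h i j
  fin_cases i <;> fin_cases j <;> simp [hat] at h' ⊢ <;> linarith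

/-- A vector orthogonal to `y × x` is a combination of `x` and `y`. -/
theorem exists_eq_smul_add_smul {x y ν : Vec} (h : y ⨯₃ x ≠ 0) (hν : ν ⬝ᵥ (y ⨯₃ x) = 0) :
    ∃ c₀ c₁ : ℝ, ν = c₀ • x + c₁ • y := by
  have hpos : (y ⨯₃ x) ⬝ᵥ (y ⨯₃ x) ≠ 0 := fun h' => h (dotProduct_self_eq_zero.1 h')
  refine ⟨(ν ⬝ᵥ x * (y ⬝ᵥ y) - ν ⬝ᵥ y * (x ⬝ᵥ y)) / ((y ⨯₃ x) ⬝ᵥ (y ⨯₃ x)),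
    (ν ⬝ᵥ y * (x ⬝ᵥ x) - ν ⬝ᵥ x * (x ⬝ᵥ y)) / ((y ⨯₃ x) ⬝ᵥ (y ⨯₃ x)), ?_⟩
  -- The expansion of `ν` in `x`, `y` and their normal, by Cramer's rule for the Gram matrix of `x`
  -- and `y`, whose determinant is `|y × x|²`.
  have key : ((y ⨯₃ x) ⬝ᵥ (y ⨯₃ x)) • ν - (ν ⬝ᵥ (y ⨯₃ x)) • (y ⨯₃ x) =
      (ν ⬝ᵥ x * (y ⬝ᵥ y) - ν ⬝ᵥ y * (x ⬝ᵥ y)) • x +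
      (ν ⬝ᵥ y * (x ⬝ᵥ x) - ν ⬝ᵥ x * (x ⬝ᵥ y)) • y := by
    apply vec_ext <;>
      simp only [dot_eq, cross_apply_zero, cross_apply_one, cross_apply_two, Pi.add_apply,
        Pi.sub_apply, Pi.smul_apply, smul_eq_mul] <;> ring
  rw [hν, zero_smul, sub_zero] at key
  rw [div_eq_inv_mul, div_eq_inv_mul, mul_smul, mul_smul, ← smul_add, ← key, smul_smul,
    inv_mul_cancel₀ hpos, one_smul]

end Algebra

end Chaplygin

end

/-! ### The two vector fields on the extended phase space -/

section

open scoped Matrix Matrix.Norms.Elementwise Topology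
open Set Filter

namespace Chaplygin

/-- The matrix `I + ρ`. -/
def inertia (I : Matrix (Fin 3) (Fin 3) ℝ) (ρ : ℝ) : Matrix (Fin 3) (Fin 3) ℝ :=
  I + ρ • (1 : Matrix (Fin 3) (Fin 3) ℝ)

/-- The vector `η = (I + ρ) ω`. -/
def eta (I : Matrix (Fin 3) (Fin 3) ℝ) (ρ : ℝ) (p : Phase) : Vec := inertia I ρ *ᵥ p.2

/-- The vector `η × ω = (I ω) × ω`. -/
def torque (I : Matrix (Fin 3) (Fin 3) ℝ) (ρ : ℝ) (p : Phase) : Vec := eta I ρ p ⨯₃ p.2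

/-- The vector `(I + ρ)⁻¹ u`. -/
noncomputable def invVertical (I : Matrix (Fin 3) (Fin 3) ℝ) (ρ : ℝ) (p : Phase) : Vec :=
  (inertia I ρ)⁻¹ *ᵥ bodyVertical p.1

/-- The homogeneous extension `ρ⁻¹ ⟨u, u⟩ - ⟨u, (I + ρ)⁻¹ u⟩` of the function `X`. -/
noncomputable def conf (I : Matrix (Fin 3) (Fin 3) ℝ) (ρ : ℝ) (p : Phase) : ℝ :=
  ρ⁻¹ * (bodyVertical p.1 ⬝ᵥ bodyVertical p.1) - bodyVertical p.1 ⬝ᵥ invVertical I ρ p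

/-- The velocity field of the rotational motion, extended to all matrices `A`. -/
noncomputable def field₁ (I : Matrix (Fin 3) (Fin 3) ℝ) (ρ : ℝ) (p : Phase) : Phase :=
  (p.1 * hat p.2, (inertia I ρ)⁻¹ *ᵥ torque I ρ p +
    (invVertical I ρ p ⬝ᵥ torque I ρ p / conf I ρ p) • invVertical I ρ p)

/-- The second vector field, with angular velocity `η`. -/
noncomputable def field₂ (I : Matrix (Fin 3) (Fin 3) ℝ) (ρ : ℝ) (p : Phase) : Phase :=
  (p.1 * hat (eta I ρ p),
    (bodyVertical p.1 ⬝ᵥ torque I ρ p / conf I ρ p) • invVertical I ρ p)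

/-- The two commuting vector fields. -/
noncomputable def field (I : Matrix (Fin 3) (Fin 3) ℝ) (ρ : ℝ) (i : Fin 2) (p : Phase) : Phase :=
  √(conf I ρ p) • (if i = 0 then field₁ I ρ p else field₂ I ρ p)

section Inertia

variable {I : Matrix (Fin 3) (Fin 3) ℝ} {ρ : ℝ}

theorem posDef_inertia (hI : I.PosDef) (hρ : 0 < ρ) : (inertia I ρ).PosDef :=
  hI.add (Matrix.PosDef.one.smul hρ)

theorem inertia_mul_inv (hI : I.PosDef) (hρ : 0 < ρ) : inertia I ρ * (inertia I ρ)⁻¹ = 1 :=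
  Matrix.mul_nonsing_inv _ ((Matrix.isUnit_iff_isUnit_det _).1 (posDef_inertia hI hρ).isUnit)

theorem inertia_inv_mul (hI : I.PosDef) (hρ : 0 < ρ) : (inertia I ρ)⁻¹ * inertia I ρ = 1 :=
  Matrix.nonsing_inv_mul _ ((Matrix.isUnit_iff_isUnit_det _).1 (posDef_inertia hI hρ).isUnit)

theorem inertia_mulVec_inv (hI : I.PosDef) (hρ : 0 < ρ) (x : Vec) :
    inertia I ρ *ᵥ ((inertia I ρ)⁻¹ *ᵥ x) = x := by
  rw [Matrix.mulVec_mulVec, inertia_mul_inv hI hρ, Matrix.one_mulVec]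

theorem inv_mulVec_inertia (hI : I.PosDef) (hρ : 0 < ρ) (x : Vec) :
    (inertia I ρ)⁻¹ *ᵥ (inertia I ρ *ᵥ x) = x := by
  rw [Matrix.mulVec_mulVec, inertia_inv_mul hI hρ, Matrix.one_mulVec]

theorem dot_mulVec_of_isHermitian {M : Matrix (Fin 3) (Fin 3) ℝ} (hM : M.IsHermitian) (x y : Vec) :
    x ⬝ᵥ (M *ᵥ y) = (M *ᵥ x) ⬝ᵥ y := by
  have h : Mᵀ = M := by rw [← Matrix.conjTranspose_eq_transpose_of_trivial, hM.eq]
  rw [Matrix.dotProduct_mulVec, ← Matrix.mulVec_transpose, h]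

theorem dot_inv_mulVec (hI : I.PosDef) (hρ : 0 < ρ) (x y : Vec) :
    x ⬝ᵥ ((inertia I ρ)⁻¹ *ᵥ y) = ((inertia I ρ)⁻¹ *ᵥ x) ⬝ᵥ y :=
  dot_mulVec_of_isHermitian (posDef_inertia hI hρ).isHermitian.inv x y

theorem dot_mulVec_pos (hI : I.PosDef) {x : Vec} (hx : x ≠ 0) : 0 < x ⬝ᵥ (I *ᵥ x) := by
  simpa using hI.dotProduct_mulVec_pos hx

theorem inertia_mulVec (x : Vec) : inertia I ρ *ᵥ x = I *ᵥ x + ρ • x := by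
  rw [inertia, Matrix.add_mulVec, Matrix.smul_mulVec, Matrix.one_mulVec]

/-- With `v = (I + ρ)⁻¹ u`, so that `u = I v + ρ v`, one has `ρ` times the function equal to `⟨u, u
- ρ v⟩ = ⟨u, I v⟩ = |I v|² + ρ ⟨v, I v⟩`. -/
theorem conf_pos (hI : I.PosDef) (hρ : 0 < ρ) {p : Phase} (hp : bodyVertical p.1 ≠ 0) :
    0 < conf I ρ p := by
  set u := bodyVertical p.1 with hu
  set v := invVertical I ρ p with hv
  have huv : u = I *ᵥ v + ρ • v := by
    rw [← inertia_mulVec, hv, invVertical, inertia_mulVec_inv hI hρ]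
  have hv0 : v ≠ 0 := by
    intro h
    rw [h] at huv
    simp at huv
    exact hp huv
  have h1 := dot_mulVec_pos hI hv0
  have h2 : 0 ≤ (I *ᵥ v) ⬝ᵥ (I *ᵥ v) := by
    rw [dot_eq]
    nlinarith [sq_nonneg ((I *ᵥ v) 0), sq_nonneg ((I *ᵥ v) 1), sq_nonneg ((I *ᵥ v) 2)]
  have h3 : conf I ρ p = ρ⁻¹ * (u ⬝ᵥ u - ρ * (u ⬝ᵥ v)) := by
    rw [conf, mul_sub, ← mul_assoc, inv_mul_cancel₀ hρ.ne', one_mul]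
  have h4 : u ⬝ᵥ u - ρ * (u ⬝ᵥ v) = (I *ᵥ v) ⬝ᵥ (I *ᵥ v) + ρ * (v ⬝ᵥ (I *ᵥ v)) := by
    rw [huv]
    simp only [dot_eq, Pi.add_apply, Pi.smul_apply, smul_eq_mul]
    ring
  rw [h3, h4]
  positivity

theorem bodyVertical_ne_zero {A : Matrix (Fin 3) (Fin 3) ℝ} (hA : 0 < A.det) :
    bodyVertical A ≠ 0 := by
  intro h
  have h1 : IsUnit Aᵀ.det := by
    rw [Matrix.det_transpose]
    exact isUnit_iff_ne_zero.2 hA.ne'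
  have h2 := Matrix.eq_zero_of_mulVec_eq_zero (M := Aᵀ) h1.ne_zero h
  have h3 := congrFun h2 2
  simp [e3] at h3

end Inertia

section Derivatives

variable {I : Matrix (Fin 3) (Fin 3) ℝ} {ρ : ℝ} {c : ℝ → Phase} {ν δ : Vec} {t : ℝ}

theorem hasDerivAt_fst_comp (hc : HasDerivAt c ((c t).1 * hat ν, δ) t) :
    HasDerivAt (fun s => (c s).1) ((c t).1 * hat ν) t :=
  (ContinuousLinearMap.fst ℝ (Matrix (Fin 3) (Fin 3) ℝ) Vec).hasFDerivAt.comp_hasDerivAt t hc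

theorem hasDerivAt_snd_comp (hc : HasDerivAt c ((c t).1 * hat ν, δ) t) :
    HasDerivAt (fun s => (c s).2) δ t :=
  (ContinuousLinearMap.snd ℝ (Matrix (Fin 3) (Fin 3) ℝ) Vec).hasFDerivAt.comp_hasDerivAt t hc

theorem hasDerivAt_mulVec_const (M : Matrix (Fin 3) (Fin 3) ℝ) {f : ℝ → Vec} {f' : Vec}
    (hf : HasDerivAt f f' t) : HasDerivAt (fun s => M *ᵥ f s) (M *ᵥ f') t := by
  simpa using hasDerivAt_mulVec (hasDerivAt_const t M) hf

/-- Both fields have the form `(A ∘ (ν × ·), δ)`, so derivatives are needed only in such directions.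
There `u' = u × ν`, which holds for every matrix `A`, and `⟨u, u⟩` is stationary. -/
theorem hasDerivAt_bodyVertical (hc : HasDerivAt c ((c t).1 * hat ν, δ) t) :
    HasDerivAt (fun s => bodyVertical (c s).1) (bodyVertical (c t).1 ⨯₃ ν) t := by
  have h := hasDerivAt_mulVec (hasDerivAt_transpose (hasDerivAt_fst_comp hc))
    (hasDerivAt_const t e3)
  rw [← bodyVertical_mul_hat]
  simpa [bodyVertical] using h

theorem hasDerivAt_eta (hc : HasDerivAt c ((c t).1 * hat ν, δ) t) :
    HasDerivAt (fun s => eta I ρ (c s)) (inertia I ρ *ᵥ δ) t :=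
  hasDerivAt_mulVec_const _ (hasDerivAt_snd_comp hc)

theorem hasDerivAt_torque (hc : HasDerivAt c ((c t).1 * hat ν, δ) t) :
    HasDerivAt (fun s => torque I ρ (c s))
      ((inertia I ρ *ᵥ δ) ⨯₃ (c t).2 + eta I ρ (c t) ⨯₃ δ) t :=
  hasDerivAt_cross (hasDerivAt_eta hc) (hasDerivAt_snd_comp hc)

theorem hasDerivAt_invVertical (hc : HasDerivAt c ((c t).1 * hat ν, δ) t) :
    HasDerivAt (fun s => invVertical I ρ (c s))
      ((inertia I ρ)⁻¹ *ᵥ (bodyVertical (c t).1 ⨯₃ ν)) t :=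
  hasDerivAt_mulVec_const _ (hasDerivAt_bodyVertical hc)

theorem hasDerivAt_conf (hI : I.PosDef) (hρ : 0 < ρ) (hc : HasDerivAt c ((c t).1 * hat ν, δ) t) :
    HasDerivAt (fun s => conf I ρ (c s))
      (-2 * (invVertical I ρ (c t) ⬝ᵥ (bodyVertical (c t).1 ⨯₃ ν))) t := by
  have h1 := hasDerivAt_bodyVertical hc
  have h2 := ((hasDerivAt_dotProduct h1 h1).const_mul ρ⁻¹).sub
    (hasDerivAt_dotProduct h1 (hasDerivAt_invVertical (I := I) (ρ := ρ) hc))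
  refine h2.congr_deriv ?_
  have h3 : (bodyVertical (c t).1 ⨯₃ ν) ⬝ᵥ bodyVertical (c t).1 = 0 := by
    simp only [dot_eq, cross_apply_zero, cross_apply_one, cross_apply_two]
    ring
  rw [dotProduct_comm (bodyVertical (c t).1) (bodyVertical (c t).1 ⨯₃ ν), h3,
    dot_inv_mulVec hI hρ, dotProduct_comm (bodyVertical (c t).1 ⨯₃ ν) (invVertical I ρ (c t))]
  simp only [invVertical]
  ring

theorem hasDerivAt_prodMk' {f : ℝ → Matrix (Fin 3) (Fin 3) ℝ} {g : ℝ → Vec}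
    {f' : Matrix (Fin 3) (Fin 3) ℝ} {g' : Vec} (hf : HasDerivAt f f' t) (hg : HasDerivAt g g' t) :
    HasDerivAt (fun s => ((f s, g s) : Phase)) (f', g') t := hf.prodMk hg

theorem hasDerivAt_field₁ (hI : I.PosDef) (hρ : 0 < ρ)
    (hc : HasDerivAt c ((c t).1 * hat ν, δ) t) (hX : conf I ρ (c t) ≠ 0) :
    HasDerivAt (fun s => field₁ I ρ (c s))
      ((c t).1 * hat ν * hat (c t).2 + (c t).1 * hat δ,
        (inertia I ρ)⁻¹ *ᵥ ((inertia I ρ *ᵥ δ) ⨯₃ (c t).2 + eta I ρ (c t) ⨯₃ δ) +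
        ((invVertical I ρ (c t) ⬝ᵥ torque I ρ (c t) / conf I ρ (c t)) •
            ((inertia I ρ)⁻¹ *ᵥ (bodyVertical (c t).1 ⨯₃ ν)) +
        (((((inertia I ρ)⁻¹ *ᵥ (bodyVertical (c t).1 ⨯₃ ν)) ⬝ᵥ torque I ρ (c t) +
            invVertical I ρ (c t) ⬝ᵥ ((inertia I ρ *ᵥ δ) ⨯₃ (c t).2 + eta I ρ (c t) ⨯₃ δ)) *
            conf I ρ (c t) - (invVertical I ρ (c t) ⬝ᵥ torque I ρ (c t)) *
            (-2 * (invVertical I ρ (c t) ⬝ᵥ (bodyVertical (c t).1 ⨯₃ ν)))) /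
            conf I ρ (c t) ^ 2) • invVertical I ρ (c t))) t := by
  have hT := hasDerivAt_torque (I := I) (ρ := ρ) hc
  have hV := hasDerivAt_invVertical (I := I) (ρ := ρ) hc
  exact hasDerivAt_prodMk'
    (hasDerivAt_mul (hasDerivAt_fst_comp hc) (hasDerivAt_hat (hasDerivAt_snd_comp hc)))
    ((hasDerivAt_mulVec_const _ hT).add
      (((hasDerivAt_dotProduct hV hT).div (hasDerivAt_conf hI hρ hc) hX).smul hV))

theorem hasDerivAt_field₂ (hI : I.PosDef) (hρ : 0 < ρ)
    (hc : HasDerivAt c ((c t).1 * hat ν, δ) t) (hX : conf I ρ (c t) ≠ 0) :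
    HasDerivAt (fun s => field₂ I ρ (c s))
      ((c t).1 * hat ν * hat (eta I ρ (c t)) + (c t).1 * hat (inertia I ρ *ᵥ δ),
        (bodyVertical (c t).1 ⬝ᵥ torque I ρ (c t) / conf I ρ (c t)) •
            ((inertia I ρ)⁻¹ *ᵥ (bodyVertical (c t).1 ⨯₃ ν)) +
        ((((bodyVertical (c t).1 ⨯₃ ν) ⬝ᵥ torque I ρ (c t) +
            bodyVertical (c t).1 ⬝ᵥ ((inertia I ρ *ᵥ δ) ⨯₃ (c t).2 + eta I ρ (c t) ⨯₃ δ)) *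
            conf I ρ (c t) - (bodyVertical (c t).1 ⬝ᵥ torque I ρ (c t)) *
            (-2 * (invVertical I ρ (c t) ⬝ᵥ (bodyVertical (c t).1 ⨯₃ ν)))) /
            conf I ρ (c t) ^ 2) • invVertical I ρ (c t)) t := by
  have hT := hasDerivAt_torque (I := I) (ρ := ρ) hc
  have hV := hasDerivAt_invVertical (I := I) (ρ := ρ) hc
  exact hasDerivAt_prodMk'
    (hasDerivAt_mul (hasDerivAt_fst_comp hc) (hasDerivAt_hat (hasDerivAt_eta hc)))
    (((hasDerivAt_dotProduct (hasDerivAt_bodyVertical hc) hT).div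
      (hasDerivAt_conf hI hρ hc) hX).smul hV)

end Derivatives

section Analytic

variable {I : Matrix (Fin 3) (Fin 3) ℝ} {ρ : ℝ} {p : Phase}

theorem analyticAt_bodyVertical : AnalyticAt ℝ (fun p : Phase => bodyVertical p.1) p :=
  analyticAt_mulVec (analyticAt_transpose analyticAt_fst) analyticAt_const

theorem analyticAt_eta : AnalyticAt ℝ (eta I ρ) p :=
  analyticAt_mulVec analyticAt_const analyticAt_snd

theorem analyticAt_torque : AnalyticAt ℝ (torque I ρ) p :=
  analyticAt_cross analyticAt_eta analyticAt_snd

theorem analyticAt_invVertical : AnalyticAt ℝ (invVertical I ρ) p :=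
  analyticAt_mulVec analyticAt_const analyticAt_bodyVertical

theorem analyticAt_conf : AnalyticAt ℝ (conf I ρ) p :=
  (analyticAt_const.mul (analyticAt_dotProduct analyticAt_bodyVertical analyticAt_bodyVertical)).sub
    (analyticAt_dotProduct analyticAt_bodyVertical analyticAt_invVertical)

theorem analyticAt_field₁ (hX : conf I ρ p ≠ 0) : AnalyticAt ℝ (field₁ I ρ) p :=
  (analyticAt_mul analyticAt_fst (analyticAt_hat analyticAt_snd)).prod
    ((analyticAt_mulVec analyticAt_const analyticAt_torque).add
      (((analyticAt_dotProduct analyticAt_invVertical analyticAt_torque).div analyticAt_conf hX).smul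
        analyticAt_invVertical))

theorem analyticAt_field₂ (hX : conf I ρ p ≠ 0) : AnalyticAt ℝ (field₂ I ρ) p :=
  (analyticAt_mul analyticAt_fst (analyticAt_hat analyticAt_eta)).prod
    (((analyticAt_dotProduct analyticAt_bodyVertical analyticAt_torque).div analyticAt_conf hX).smul
      analyticAt_invVertical)

theorem analyticAt_sqrt_conf (hX : 0 < conf I ρ p) : AnalyticAt ℝ (fun p => √(conf I ρ p)) p := by
  have h : ContDiffAt ℝ ⊤ (fun p => √(conf I ρ p)) p :=
    (Real.contDiffAt_sqrt hX.ne').comp p analyticAt_conf.contDiffAt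
  exact h.analyticAt

theorem analyticAt_field (hX : 0 < conf I ρ p) (i : Fin 2) : AnalyticAt ℝ (field I ρ i) p := by
  refine (analyticAt_sqrt_conf hX).smul ?_
  split_ifs
  · exact analyticAt_field₁ hX.ne'
  · exact analyticAt_field₂ hX.ne'

end Analytic

end Chaplygin

end

/-! ### Commutation of the rescaled fields -/

section

open scoped Matrix Matrix.Norms.Elementwise Topology
open Set Filter

namespace Chaplygin

section Line

variable {V W : Type*} [NormedAddCommGroup V] [NormedSpace ℝ V] [NormedAddCommGroup W]
  [NormedSpace ℝ W]

theorem fderiv_apply_eq {F : V → W} {p v : V} {d : W} (hF : DifferentiableAt ℝ F p)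
    (h : HasDerivAt (fun s : ℝ => F (p + s • v)) d 0) : fderiv ℝ F p v = d := by
  rw [← hF.lineDeriv_eq_fderiv]
  exact HasLineDerivAt.lineDeriv h

theorem hasDerivAt_line (p v : V) (t : ℝ) : HasDerivAt (fun s : ℝ => p + s • v) v t := by
  simpa using ((hasDerivAt_id t).smul_const v).const_add p

theorem fderiv_sqrt_smul {f : V → ℝ} {F : V → W} {p : V} (hf : DifferentiableAt ℝ f p)
    (hX : 0 < f p) (hF : DifferentiableAt ℝ F p) (v : V) :
    fderiv ℝ (fun q => √(f q) • F q) p (√(f p) • v) =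
      f p • fderiv ℝ F p v + (1 / 2 * fderiv ℝ f p v) • F p := by
  have hs := (Real.sqrt_pos.2 hX).ne'
  have h : HasFDerivAt (fun q => √(f q) • F q) _ p :=
    (hf.hasFDerivAt.sqrt hX.ne').smul hF.hasFDerivAt
  rw [h.fderiv]
  simp only [map_smul, add_apply, smul_apply, ContinuousLinearMap.smulRight_apply, smul_add,
    smul_smul, smul_eq_mul, Real.mul_self_sqrt hX.le]
  congr 2
  field_simp

/-- The product rule adds `½ df(F₁) F₂ - ½ df(F₂) F₁ = -P F₂ + Q F₁` to `f` times the unscaled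
bracket, and this cancels it. So `√f` is an integrating factor. -/
theorem fderiv_sqrt_smul_comm {f : V → ℝ} {F₁ F₂ : V → V} {p : V} {P Q : ℝ}
    (hf : DifferentiableAt ℝ f p) (hX : 0 < f p) (hF₁ : DifferentiableAt ℝ F₁ p)
    (hF₂ : DifferentiableAt ℝ F₂ p)
    (h : f p • (fderiv ℝ F₂ p (F₁ p) - fderiv ℝ F₁ p (F₂ p)) = P • F₂ p - Q • F₁ p)
    (h₁ : fderiv ℝ f p (F₁ p) = -2 * P) (h₂ : fderiv ℝ f p (F₂ p) = -2 * Q) :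
    fderiv ℝ (fun q => √(f q) • F₂ q) p (√(f p) • F₁ p) =
      fderiv ℝ (fun q => √(f q) • F₁ q) p (√(f p) • F₂ p) := by
  rw [fderiv_sqrt_smul hf hX hF₁, fderiv_sqrt_smul hf hX hF₂, h₁, h₂]
  rw [smul_sub, sub_eq_iff_eq_add] at h
  rw [h]
  module

/-- The zero multiple is kept in the velocity to match the form `(c t).1 * hat ν` in the derivative
formulas along curves. -/
theorem hasDerivAt_line_zero (p : Phase) (ν δ : Vec) :
    HasDerivAt (fun s : ℝ => p + s • ((p.1 * hat ν, δ) : Phase))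
      ((p + (0 : ℝ) • ((p.1 * hat ν, δ) : Phase)).1 * hat ν, δ) 0 := by
  have h := hasDerivAt_line p (p.1 * hat ν, δ) 0
  rwa [zero_smul, add_zero]

end Line

section Commutation

/-- Two expansions of `(η × ω) × (u × w)`. It settles the `A`-component of the bracket. -/
theorem bracket_matrix_identity (u w η ω : Vec) :
    (w ⬝ᵥ (η ⨯₃ ω)) • u - (u ⬝ᵥ (η ⨯₃ ω)) • w =
      (w ⬝ᵥ (u ⨯₃ ω)) • η - (w ⬝ᵥ (u ⨯₃ η)) • ω := by
  apply vec_ext <;>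
    simp only [dot_eq, cross_apply_zero, cross_apply_one, cross_apply_two,
      Pi.sub_apply, Pi.smul_apply, smul_eq_mul] <;> ring

/-- The cross product of `η` with `bracket_matrix_identity`. Under `(I + ρ)⁻¹` it yields the part of
the `ω`-component of the bracket that is not a multiple of `w`. -/
theorem bracket_vector_identity (u w η ω : Vec) :
    (u ⬝ᵥ (η ⨯₃ ω)) • (η ⨯₃ w) + (w ⬝ᵥ (η ⨯₃ ω)) • (u ⨯₃ η) =
      (w ⬝ᵥ (u ⨯₃ η)) • (η ⨯₃ ω) := by
  apply vec_ext <;>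
    simp only [dot_eq, cross_apply_zero, cross_apply_one, cross_apply_two,
      Pi.add_apply, Pi.smul_apply, smul_eq_mul] <;> ring

/-- The coefficient of `w` in the `ω`-component of the bracket; `b` stands for `(I + ρ)⁻¹ (η × ω)`,
and its contributions cancel. -/
theorem bracket_scalar_identity (u w η ω b : Vec) (α β : ℝ) :
    (u ⨯₃ ω) ⬝ᵥ (η ⨯₃ ω) + u ⬝ᵥ ((η ⨯₃ ω + α • u) ⨯₃ ω + η ⨯₃ (b + α • w)) -
      ((u ⨯₃ η) ⬝ᵥ b + w ⬝ᵥ ((β • u) ⨯₃ ω + η ⨯₃ (β • w))) =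
      (w ⬝ᵥ (u ⨯₃ η)) * α - (w ⬝ᵥ (u ⨯₃ ω)) * β := by
  simp only [dot_eq, cross_apply_zero, cross_apply_one, cross_apply_two,
    Pi.add_apply, Pi.smul_apply, smul_eq_mul]
  ring

variable {I : Matrix (Fin 3) (Fin 3) ℝ} {ρ : ℝ} {p : Phase}

theorem fderiv_field₁_apply (hI : I.PosDef) (hρ : 0 < ρ) (hX : conf I ρ p ≠ 0) (ν δ : Vec) :
    fderiv ℝ (field₁ I ρ) p (p.1 * hat ν, δ) =
      (p.1 * hat ν * hat p.2 + p.1 * hat δ,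
        (inertia I ρ)⁻¹ *ᵥ ((inertia I ρ *ᵥ δ) ⨯₃ p.2 + eta I ρ p ⨯₃ δ) +
        ((invVertical I ρ p ⬝ᵥ torque I ρ p / conf I ρ p) •
            ((inertia I ρ)⁻¹ *ᵥ (bodyVertical p.1 ⨯₃ ν)) +
        (((((inertia I ρ)⁻¹ *ᵥ (bodyVertical p.1 ⨯₃ ν)) ⬝ᵥ torque I ρ p +
            invVertical I ρ p ⬝ᵥ ((inertia I ρ *ᵥ δ) ⨯₃ p.2 + eta I ρ p ⨯₃ δ)) *
            conf I ρ p - (invVertical I ρ p ⬝ᵥ torque I ρ p) *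
            (-2 * (invVertical I ρ p ⬝ᵥ (bodyVertical p.1 ⨯₃ ν)))) /
            conf I ρ p ^ 2) • invVertical I ρ p)) := by
  refine fderiv_apply_eq (analyticAt_field₁ hX).differentiableAt ?_
  have h := hasDerivAt_field₁ hI hρ (hasDerivAt_line_zero p ν δ) (by simpa using hX)
  simp only [zero_smul, add_zero] at h
  exact h

theorem fderiv_field₂_apply (hI : I.PosDef) (hρ : 0 < ρ) (hX : conf I ρ p ≠ 0) (ν δ : Vec) :
    fderiv ℝ (field₂ I ρ) p (p.1 * hat ν, δ) =
      (p.1 * hat ν * hat (eta I ρ p) + p.1 * hat (inertia I ρ *ᵥ δ),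
        (bodyVertical p.1 ⬝ᵥ torque I ρ p / conf I ρ p) •
            ((inertia I ρ)⁻¹ *ᵥ (bodyVertical p.1 ⨯₃ ν)) +
        ((((bodyVertical p.1 ⨯₃ ν) ⬝ᵥ torque I ρ p +
            bodyVertical p.1 ⬝ᵥ ((inertia I ρ *ᵥ δ) ⨯₃ p.2 + eta I ρ p ⨯₃ δ)) *
            conf I ρ p - (bodyVertical p.1 ⬝ᵥ torque I ρ p) *
            (-2 * (invVertical I ρ p ⬝ᵥ (bodyVertical p.1 ⨯₃ ν)))) /
            conf I ρ p ^ 2) • invVertical I ρ p) := by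
  refine fderiv_apply_eq (analyticAt_field₂ hX).differentiableAt ?_
  have h := hasDerivAt_field₂ hI hρ (hasDerivAt_line_zero p ν δ) (by simpa using hX)
  simp only [zero_smul, add_zero] at h
  exact h

theorem fderiv_conf_apply (hI : I.PosDef) (hρ : 0 < ρ) (ν δ : Vec) :
    fderiv ℝ (conf I ρ) p (p.1 * hat ν, δ) =
      -2 * (invVertical I ρ p ⬝ᵥ (bodyVertical p.1 ⨯₃ ν)) := by
  refine fderiv_apply_eq analyticAt_conf.differentiableAt ?_
  simpa only [zero_smul, add_zero] using hasDerivAt_conf hI hρ (hasDerivAt_line_zero p ν δ)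

/-- The bracket of the two vector fields before rescaling of time. -/
theorem bracket_field (hI : I.PosDef) (hρ : 0 < ρ) (hX : conf I ρ p ≠ 0) :
    conf I ρ p • (fderiv ℝ (field₂ I ρ) p (field₁ I ρ p) -
        fderiv ℝ (field₁ I ρ) p (field₂ I ρ p)) =
      (invVertical I ρ p ⬝ᵥ (bodyVertical p.1 ⨯₃ p.2)) • field₂ I ρ p -
        (invVertical I ρ p ⬝ᵥ (bodyVertical p.1 ⨯₃ eta I ρ p)) • field₁ I ρ p := by
  have e₁ : inertia I ρ *ᵥ ((inertia I ρ)⁻¹ *ᵥ torque I ρ p +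
      (invVertical I ρ p ⬝ᵥ torque I ρ p / conf I ρ p) • invVertical I ρ p) =
      torque I ρ p + (invVertical I ρ p ⬝ᵥ torque I ρ p / conf I ρ p) • bodyVertical p.1 := by
    rw [Matrix.mulVec_add, Matrix.mulVec_smul, inertia_mulVec_inv hI hρ, invVertical,
      inertia_mulVec_inv hI hρ]
  have e₂ : inertia I ρ *ᵥ
      ((bodyVertical p.1 ⬝ᵥ torque I ρ p / conf I ρ p) • invVertical I ρ p) =
      (bodyVertical p.1 ⬝ᵥ torque I ρ p / conf I ρ p) • bodyVertical p.1 := by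
    rw [Matrix.mulVec_smul, invVertical, inertia_mulVec_inv hI hρ]
  rw [show field₁ I ρ p = (p.1 * hat p.2, _) from rfl,
    show field₂ I ρ p = (p.1 * hat (eta I ρ p), _) from rfl,
    fderiv_field₁_apply hI hρ hX, fderiv_field₂_apply hI hρ hX, e₁, e₂, ← dot_inv_mulVec hI hρ]
  generalize hu : bodyVertical p.1 = u
  generalize hw : invVertical I ρ p = w
  generalize hη : eta I ρ p = η
  have ha : torque I ρ p = η ⨯₃ p.2 := by rw [← hη]; rfl
  rw [ha]
  generalize hω : p.2 = ω
  generalize hJ : (inertia I ρ)⁻¹ = J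
  generalize conf I ρ p = x at hX
  -- The coefficients of `w` in the `ω`-components of the two fields. Only their products with `x`
  -- enter the vector identities.
  obtain ⟨α, hα⟩ : ∃ α, α = w ⬝ᵥ (η ⨯₃ ω) / x := ⟨_, rfl⟩
  obtain ⟨β, hβ⟩ : ∃ β, β = u ⬝ᵥ (η ⨯₃ ω) / x := ⟨_, rfl⟩
  have hα' : w ⬝ᵥ (η ⨯₃ ω) = x * α := by rw [hα]; field_simp
  have hβ' : u ⬝ᵥ (η ⨯₃ ω) = x * β := by rw [hβ]; field_simp
  rw [← hα, ← hβ]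
  refine Prod.ext ?_ ?_
  · have h1 := bracket_matrix_identity u w η ω
    rw [hα', hβ'] at h1
    -- The commutator of the two rotations cancels the torque in `(I + ρ) ω'` along the first field;
    -- what remains is the angular velocity `α u - β w`.
    have h2 : p.1 * hat ω * hat η - p.1 * hat η * hat ω = -(p.1 * hat (η ⨯₃ ω)) := by
      rw [mul_assoc, mul_assoc, ← mul_sub, hat_mul_hat_sub, ← cross_anticomm, ← neg_one_smul ℝ,
        hat_smul, mul_smul_comm, neg_one_smul]
    have h3 : (w ⬝ᵥ (u ⨯₃ ω)) • hat η - (w ⬝ᵥ (u ⨯₃ η)) • hat ω =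
        (x * α) • hat u - (x * β) • hat w := by
      have h4 := congrArg hat h1
      simp only [sub_eq_add_neg, ← neg_smul, hat_add, hat_smul] at h4
      simp only [sub_eq_add_neg, ← neg_smul]
      exact h4.symm
    have h5 := congrArg (p.1 * ·) h3
    simp only [mul_sub, mul_smul_comm] at h5
    simp only [Prod.fst_sub, Prod.smul_fst]
    rw [h5, hat_add, hat_smul, hat_smul, mul_add, mul_smul_comm, mul_smul_comm,
      show ∀ a b c d e : Matrix (Fin 3) (Fin 3) ℝ, a + (b + c) - (d + e) = (a - d) + b + c - e by
        intros; abel, h2]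
    module
  · have h1 := congrArg (J *ᵥ ·) (bracket_vector_identity u w η ω)
    simp only [Matrix.mulVec_add, Matrix.mulVec_smul] at h1
    rw [hα', hβ'] at h1
    have h2 := bracket_scalar_identity u w η ω (J *ᵥ (η ⨯₃ ω)) α β
    have h3 : J *ᵥ ((β • u) ⨯₃ ω + η ⨯₃ (β • w)) =
        β • (J *ᵥ (u ⨯₃ ω)) + β • (J *ᵥ (η ⨯₃ w)) := by
      rw [← Matrix.mulVec_smul, ← Matrix.mulVec_smul, ← Matrix.mulVec_add]
      simp
    simp only [Prod.snd_sub, Prod.smul_snd]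
    rw [h3, hα', hβ']
    generalize (u ⨯₃ ω) ⬝ᵥ (η ⨯₃ ω) + u ⬝ᵥ ((η ⨯₃ ω + α • u) ⨯₃ ω +
      η ⨯₃ (J *ᵥ (η ⨯₃ ω) + α • w)) = N₁ at h2 ⊢
    generalize (u ⨯₃ η) ⬝ᵥ (J *ᵥ (η ⨯₃ ω)) + w ⬝ᵥ ((β • u) ⨯₃ ω + η ⨯₃ (β • w)) = N₂ at h2 ⊢
    ext i
    have h4 := congrFun h1 i
    simp only [Pi.add_apply, Pi.sub_apply, Pi.smul_apply, smul_eq_mul] at h4 ⊢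
    field_simp
    linear_combination (w i) * h2 - h4

theorem field_zero (p : Phase) : field I ρ 0 p = √(conf I ρ p) • field₁ I ρ p := rfl

theorem field_one (p : Phase) : field I ρ 1 p = √(conf I ρ p) • field₂ I ρ p := rfl

theorem fderiv_field_comm (hI : I.PosDef) (hρ : 0 < ρ) (hX : 0 < conf I ρ p) :
    fderiv ℝ (field I ρ 1) p (field I ρ 0 p) = fderiv ℝ (field I ρ 0) p (field I ρ 1 p) := by
  exact fderiv_sqrt_smul_comm analyticAt_conf.differentiableAt hX
    (analyticAt_field₁ hX.ne').differentiableAt (analyticAt_field₂ hX.ne').differentiableAt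
    (bracket_field hI hρ hX.ne') (fderiv_conf_apply hI hρ p.2 _)
    (fderiv_conf_apply hI hρ (eta I ρ p) _)

end Commutation

end Chaplygin

end

/-! ### Conservation of the extended integrals -/

section

open scoped Matrix Matrix.Norms.Elementwise Topology
open Set Filter

namespace Chaplygin

/-- The entries of a symmetric matrix. -/
def symEntries (S : Matrix (Fin 3) (Fin 3) ℝ) : Fin 6 → ℝ :=
  ![S 0 0, S 1 1, S 2 2, S 0 1, S 0 2, S 1 2]

/-- The moment of momentum, extended to all matrices `A`. -/
def momentExt (I : Matrix (Fin 3) (Fin 3) ℝ) (ρ : ℝ) (p : Phase) : Vec :=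
  p.1 *ᵥ ((bodyVertical p.1 ⬝ᵥ bodyVertical p.1) • eta I ρ p -
    (ρ * (bodyVertical p.1 ⬝ᵥ p.2)) • bodyVertical p.1)

/-- The kinetic energy, extended to all matrices `A`. -/
noncomputable def energyExt (I : Matrix (Fin 3) (Fin 3) ℝ) (ρ : ℝ) (p : Phase) : ℝ :=
  1 / 2 * ((bodyVertical p.1 ⬝ᵥ bodyVertical p.1) * (eta I ρ p ⬝ᵥ p.2) -
    ρ * ((bodyVertical p.1 ⬝ᵥ p.2) * (bodyVertical p.1 ⬝ᵥ p.2)))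

/-- The integrals of the extended vector fields. -/
noncomputable def invariants (I : Matrix (Fin 3) (Fin 3) ℝ) (ρ : ℝ) (p : Phase) :
    Param × (Fin 6 → ℝ) :=
  ((momentExt I ρ p, energyExt I ρ p), symEntries (p.1 * p.1ᵀ))

/-- The derivative of the moment of momentum in body coordinates along `(A ∘ (ν × ·), δ)`. -/
def momentRate (I : Matrix (Fin 3) (Fin 3) ℝ) (ρ : ℝ) (p : Phase) (ν δ : Vec) : Vec :=
  ν ⨯₃ ((bodyVertical p.1 ⬝ᵥ bodyVertical p.1) • eta I ρ p -
      (ρ * (bodyVertical p.1 ⬝ᵥ p.2)) • bodyVertical p.1) +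
    ((bodyVertical p.1 ⬝ᵥ bodyVertical p.1) • (inertia I ρ *ᵥ δ) -
      ((ρ * ((bodyVertical p.1 ⨯₃ ν) ⬝ᵥ p.2 + bodyVertical p.1 ⬝ᵥ δ)) • bodyVertical p.1 +
        (ρ * (bodyVertical p.1 ⬝ᵥ p.2)) • (bodyVertical p.1 ⨯₃ ν)))

variable {I : Matrix (Fin 3) (Fin 3) ℝ} {ρ : ℝ}

section Derivatives

variable {c : ℝ → Phase} {ν δ : Vec} {t : ℝ}

theorem hasDerivAt_dot_bodyVertical (hc : HasDerivAt c ((c t).1 * hat ν, δ) t) :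
    HasDerivAt (fun s => bodyVertical (c s).1 ⬝ᵥ bodyVertical (c s).1) 0 t := by
  have h := hasDerivAt_bodyVertical hc
  refine (hasDerivAt_dotProduct h h).congr_deriv ?_
  simp only [dot_eq, cross_apply_zero, cross_apply_one, cross_apply_two]
  ring

theorem hasDerivAt_momentExt (hc : HasDerivAt c ((c t).1 * hat ν, δ) t) :
    HasDerivAt (fun s => momentExt I ρ (c s)) ((c t).1 *ᵥ momentRate I ρ (c t) ν δ) t := by
  have hu := hasDerivAt_bodyVertical hc
  have hs := hasDerivAt_dotProduct hu (hasDerivAt_snd_comp hc)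
  refine (hasDerivAt_mulVec (hasDerivAt_fst_comp hc)
    (((hasDerivAt_dot_bodyVertical hc).smul (hasDerivAt_eta hc)).sub
      ((hs.const_mul ρ).smul hu))).congr_deriv ?_
  rw [momentRate, Matrix.mulVec_add, ← hat_mulVec ν, Matrix.mulVec_mulVec, zero_smul, add_zero,
    add_comm ((ρ * (bodyVertical (c t).1 ⬝ᵥ (c t).2)) • _)]
  rfl

/-- The energy is half the product of `ω` with the moment `k` in body coordinates, and `k` depends
linearly and symmetrically on `ω`. Once the moment is conserved, only a term proportional to `⟨ν, η
× ω⟩` remains, which vanishes for the angular velocities `ω` and `η`. -/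
theorem hasDerivAt_energyExt (hI : I.PosDef) (hρ : 0 < ρ)
    (hc : HasDerivAt c ((c t).1 * hat ν, δ) t) :
    HasDerivAt (fun s => energyExt I ρ (c s))
      ((c t).2 ⬝ᵥ momentRate I ρ (c t) ν δ -
        (bodyVertical (c t).1 ⬝ᵥ bodyVertical (c t).1) * (ν ⬝ᵥ torque I ρ (c t))) t := by
  have hu := hasDerivAt_bodyVertical hc
  have hω := hasDerivAt_snd_comp hc
  have hs := hasDerivAt_dotProduct hu hω
  refine ((((hasDerivAt_dot_bodyVertical hc).mul
    (hasDerivAt_dotProduct (hasDerivAt_eta (I := I) (ρ := ρ) hc) hω)).sub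
      ((hs.mul hs).const_mul ρ)).const_mul (1 / 2)).congr_deriv ?_
  have h : (inertia I ρ *ᵥ δ) ⬝ᵥ (c t).2 = δ ⬝ᵥ eta I ρ (c t) :=
    (dot_mulVec_of_isHermitian (posDef_inertia hI hρ).isHermitian _ _).symm
  have h' : (c t).2 ⬝ᵥ (inertia I ρ *ᵥ δ) = δ ⬝ᵥ eta I ρ (c t) := by rw [dotProduct_comm, h]
  rw [h, momentRate, torque]
  rw [dotProduct_add, dotProduct_sub, dotProduct_smul, h']
  simp only [dot_eq, cross_apply_zero, cross_apply_one, cross_apply_two,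
    Pi.add_apply, Pi.sub_apply, Pi.smul_apply, smul_eq_mul]
  ring

theorem hasDerivAt_symEntries_mul_transpose {B : Matrix (Fin 3) (Fin 3) ℝ}
    {f : ℝ → Matrix (Fin 3) (Fin 3) ℝ} (hf : HasDerivAt f B t) :
    HasDerivAt (fun s => symEntries (f s * (f s)ᵀ)) (symEntries (B * (f t)ᵀ + f t * Bᵀ)) t := by
  have h := hasDerivAt_matrix.1 (hasDerivAt_mul hf (hasDerivAt_transpose hf))
  rw [hasDerivAt_pi]
  intro i
  fin_cases i <;> exact h _ _

theorem hat_transpose (ν : Vec) : (hat ν)ᵀ = -hat ν := by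
  ext i j
  fin_cases i <;> fin_cases j <;> simp [hat]

theorem hasDerivAt_invariants (hI : I.PosDef) (hρ : 0 < ρ)
    (hc : HasDerivAt c ((c t).1 * hat ν, δ) t) :
    HasDerivAt (fun s => invariants I ρ (c s))
      (((c t).1 *ᵥ momentRate I ρ (c t) ν δ, (c t).2 ⬝ᵥ momentRate I ρ (c t) ν δ -
        (bodyVertical (c t).1 ⬝ᵥ bodyVertical (c t).1) * (ν ⬝ᵥ torque I ρ (c t))), 0) t := by
  refine ((hasDerivAt_momentExt hc).prodMk (hasDerivAt_energyExt hI hρ hc)).prodMk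
    ((hasDerivAt_symEntries_mul_transpose (hasDerivAt_fst_comp hc)).congr_deriv ?_)
  rw [Matrix.transpose_mul, hat_transpose, mul_assoc, neg_mul, mul_neg, add_neg_cancel]
  ext i
  fin_cases i <;> rfl

end Derivatives

section Analytic

variable {p : Phase}

theorem analyticAt_momentExt : AnalyticAt ℝ (momentExt I ρ) p :=
  analyticAt_mulVec analyticAt_fst
    (((analyticAt_dotProduct analyticAt_bodyVertical analyticAt_bodyVertical).smul
      analyticAt_eta).sub ((analyticAt_const.mul
        (analyticAt_dotProduct analyticAt_bodyVertical analyticAt_snd)).smul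
          analyticAt_bodyVertical))

theorem analyticAt_energyExt : AnalyticAt ℝ (energyExt I ρ) p := by
  have hs := analyticAt_dotProduct analyticAt_bodyVertical (analyticAt_snd (p := p))
  exact analyticAt_const.mul
    (((analyticAt_dotProduct analyticAt_bodyVertical analyticAt_bodyVertical).mul
      (analyticAt_dotProduct analyticAt_eta analyticAt_snd)).sub
        (analyticAt_const.mul (hs.mul hs)))

theorem analyticAt_symEntries_mul_transpose :
    AnalyticAt ℝ (fun p : Phase => symEntries (p.1 * p.1ᵀ)) p := by
  have h := analyticAt_matrix.1 (analyticAt_mul analyticAt_fst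
    (analyticAt_transpose (analyticAt_fst (p := p))))
  rw [analyticAt_pi_iff]
  intro i
  fin_cases i <;> exact h _ _

theorem analyticAt_invariants : AnalyticAt ℝ (invariants I ρ) p :=
  (analyticAt_momentExt.prod analyticAt_energyExt).prod analyticAt_symEntries_mul_transpose

theorem analyticAt_integrals : AnalyticAt ℝ (integrals I ρ) p := by
  have hu := analyticAt_bodyVertical (p := p)
  have hω := analyticAt_snd (𝕜 := ℝ) (p := p)
  have hJ := analyticAt_mulVec (analyticAt_const (v := I)) hω
  have hc := analyticAt_cross hu hω
  exact (analyticAt_mulVec analyticAt_fst (hJ.add ((analyticAt_const (v := ρ)).smul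
    (analyticAt_cross hu (analyticAt_cross hω hu))))).prod
      ((analyticAt_const.mul (analyticAt_dotProduct hJ hω)).add
        (analyticAt_const.mul (analyticAt_dotProduct hc hc)))

end Analytic

section Conservation

variable {p : Phase}

theorem fderiv_invariants_apply (hI : I.PosDef) (hρ : 0 < ρ) (ν δ : Vec) :
    fderiv ℝ (invariants I ρ) p (p.1 * hat ν, δ) =
      ((p.1 *ᵥ momentRate I ρ p ν δ, p.2 ⬝ᵥ momentRate I ρ p ν δ -
        (bodyVertical p.1 ⬝ᵥ bodyVertical p.1) * (ν ⬝ᵥ torque I ρ p)), 0) := by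
  refine fderiv_apply_eq analyticAt_invariants.differentiableAt ?_
  have h := hasDerivAt_invariants hI hρ (hasDerivAt_line_zero p ν δ)
  simp only [zero_smul, add_zero] at h
  exact h

/-- By `ρ X = ⟨u, u⟩ - ρ ⟨u, w⟩`, with `X` extended homogeneously, the coefficient `α` of `w` in
`ω'` satisfies `ρ ⟨u, ω'⟩ = α ⟨u, u⟩`. Then the multiples of `u` cancel, for every `A`. -/
theorem momentRate_field₁ (hI : I.PosDef) (hρ : 0 < ρ) (hX : conf I ρ p ≠ 0) :
    momentRate I ρ p p.2 (field₁ I ρ p).2 = 0 := by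
  have e₁ : inertia I ρ *ᵥ (field₁ I ρ p).2 =
      torque I ρ p + (invVertical I ρ p ⬝ᵥ torque I ρ p / conf I ρ p) • bodyVertical p.1 := by
    rw [field₁, Matrix.mulVec_add, Matrix.mulVec_smul, inertia_mulVec_inv hI hρ, invVertical,
      inertia_mulVec_inv hI hρ]
  have e₂ : bodyVertical p.1 ⬝ᵥ (field₁ I ρ p).2 = invVertical I ρ p ⬝ᵥ torque I ρ p +
      invVertical I ρ p ⬝ᵥ torque I ρ p / conf I ρ p *
        (bodyVertical p.1 ⬝ᵥ invVertical I ρ p) := by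
    rw [field₁, dotProduct_add, dotProduct_smul, dot_inv_mulVec hI hρ, smul_eq_mul]
    rfl
  have e₃ : ρ * conf I ρ p = bodyVertical p.1 ⬝ᵥ bodyVertical p.1 -
      ρ * (bodyVertical p.1 ⬝ᵥ invVertical I ρ p) := by
    rw [conf]
    field_simp
  obtain ⟨α, hα⟩ : ∃ α, α = invVertical I ρ p ⬝ᵥ torque I ρ p / conf I ρ p := ⟨_, rfl⟩
  have hα' : invVertical I ρ p ⬝ᵥ torque I ρ p = α * conf I ρ p := by rw [hα]; field_simp
  have e₄ : ρ * (bodyVertical p.1 ⬝ᵥ (field₁ I ρ p).2) =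
      α * (bodyVertical p.1 ⬝ᵥ bodyVertical p.1) := by
    rw [e₂, ← hα, hα']
    linear_combination α * e₃
  rw [momentRate, e₁, ← hα, mul_add, e₄, torque]
  apply vec_ext <;>
    simp only [dot_eq, cross_apply_zero, cross_apply_one, cross_apply_two,
      Pi.add_apply, Pi.sub_apply, Pi.smul_apply, smul_eq_mul, Pi.zero_apply] <;> ring

/-- As for the first field, but here `⟨u × η, ω⟩ = ⟨u, η × ω⟩` also enters the rate of `⟨u, ω⟩`.
This determines the numerator of the coefficient of `w` in `field₂`. -/
theorem momentRate_field₂ (hI : I.PosDef) (hρ : 0 < ρ) (hX : conf I ρ p ≠ 0) :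
    momentRate I ρ p (eta I ρ p) (field₂ I ρ p).2 = 0 := by
  have e₁ : inertia I ρ *ᵥ (field₂ I ρ p).2 =
      (bodyVertical p.1 ⬝ᵥ torque I ρ p / conf I ρ p) • bodyVertical p.1 := by
    rw [field₂, Matrix.mulVec_smul, invVertical, inertia_mulVec_inv hI hρ]
  have e₂ : bodyVertical p.1 ⬝ᵥ (field₂ I ρ p).2 =
      bodyVertical p.1 ⬝ᵥ torque I ρ p / conf I ρ p *
        (bodyVertical p.1 ⬝ᵥ invVertical I ρ p) := by
    rw [field₂, dotProduct_smul, smul_eq_mul]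
  have e₃ : ρ * conf I ρ p = bodyVertical p.1 ⬝ᵥ bodyVertical p.1 -
      ρ * (bodyVertical p.1 ⬝ᵥ invVertical I ρ p) := by
    rw [conf]
    field_simp
  obtain ⟨β, hβ⟩ : ∃ β, β = bodyVertical p.1 ⬝ᵥ torque I ρ p / conf I ρ p := ⟨_, rfl⟩
  have hβ' : bodyVertical p.1 ⬝ᵥ torque I ρ p = β * conf I ρ p := by rw [hβ]; field_simp
  have e₄ : (bodyVertical p.1 ⨯₃ eta I ρ p) ⬝ᵥ p.2 = bodyVertical p.1 ⬝ᵥ torque I ρ p := by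
    simp only [torque, dot_eq, cross_apply_zero, cross_apply_one, cross_apply_two]
    ring
  have e₅ : ρ * ((bodyVertical p.1 ⨯₃ eta I ρ p) ⬝ᵥ p.2 +
      bodyVertical p.1 ⬝ᵥ (field₂ I ρ p).2) = β * (bodyVertical p.1 ⬝ᵥ bodyVertical p.1) := by
    rw [e₄, e₂, ← hβ, hβ']
    linear_combination β * e₃
  rw [momentRate, e₁, ← hβ, e₅]
  apply vec_ext <;>
    simp only [dot_eq, cross_apply_zero, cross_apply_one, cross_apply_two,
      Pi.add_apply, Pi.sub_apply, Pi.smul_apply, smul_eq_mul, Pi.zero_apply] <;> ring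

theorem fderiv_invariants_field₁ (hI : I.PosDef) (hρ : 0 < ρ) (hX : conf I ρ p ≠ 0) :
    fderiv ℝ (invariants I ρ) p (field₁ I ρ p) = 0 := by
  refine (fderiv_invariants_apply hI hρ p.2 (field₁ I ρ p).2).trans ?_
  have h : p.2 ⬝ᵥ torque I ρ p = 0 := by rw [torque, dot_cross_self]
  rw [momentRate_field₁ hI hρ hX, h]
  simp

theorem fderiv_invariants_field₂ (hI : I.PosDef) (hρ : 0 < ρ) (hX : conf I ρ p ≠ 0) :
    fderiv ℝ (invariants I ρ) p (field₂ I ρ p) = 0 := by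
  refine (fderiv_invariants_apply hI hρ (eta I ρ p) (field₂ I ρ p).2).trans ?_
  have h : eta I ρ p ⬝ᵥ torque I ρ p = 0 := by rw [torque, dot_self_cross]
  rw [momentRate_field₂ hI hρ hX, h]
  simp

theorem fderiv_invariants_field (hI : I.PosDef) (hρ : 0 < ρ) (hX : conf I ρ p ≠ 0) (i : Fin 2) :
    fderiv ℝ (invariants I ρ) p (field I ρ i p) = 0 := by
  rw [field, map_smul]
  split_ifs
  · rw [fderiv_invariants_field₁ hI hρ hX, smul_zero]
  · rw [fderiv_invariants_field₂ hI hρ hX, smul_zero]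

end Conservation

end Chaplygin

end

/-! ### Restriction to rotations, and regular points -/

section

open scoped Matrix Matrix.Norms.Elementwise Topology
open Set Filter

namespace Chaplygin

variable {I : Matrix (Fin 3) (Fin 3) ℝ} {ρ : ℝ} {p : Phase}

section Rotation

theorem mem_phaseSpace_iff : p ∈ phaseSpace ↔ p.1 * p.1ᵀ = 1 ∧ p.1.det = 1 := by
  change p.1 ∈ Matrix.specialOrthogonalGroup (Fin 3) ℝ ↔ _
  rw [Matrix.mem_specialOrthogonalGroup_iff, Matrix.mem_orthogonalGroup_iff]

theorem transpose_mul_self (hp : p ∈ phaseSpace) : p.1ᵀ * p.1 = 1 :=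
  mul_eq_one_comm.1 (mem_phaseSpace_iff.1 hp).1

theorem bodyVertical_dot_self (A : Matrix (Fin 3) (Fin 3) ℝ) :
    bodyVertical A ⬝ᵥ bodyVertical A = (A * Aᵀ) 2 2 := by
  have h : ∀ i, bodyVertical A i = A 2 i := by
    intro i
    simp [bodyVertical, e3, Matrix.mulVec, dotProduct, Fin.sum_univ_three]
  simp [dot_eq, h, Matrix.mul_apply, Fin.sum_univ_three]

theorem bodyVertical_dot_self_of_mem (hp : p ∈ phaseSpace) :
    bodyVertical p.1 ⬝ᵥ bodyVertical p.1 = 1 := by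
  rw [bodyVertical_dot_self, (mem_phaseSpace_iff.1 hp).1, Matrix.one_apply_eq]

theorem conf_eq_X (hp : p ∈ phaseSpace) : conf I ρ p = X I ρ (bodyVertical p.1) := by
  rw [conf, bodyVertical_dot_self_of_mem hp, mul_one]
  rfl

theorem conf_pos_of_det (hI : I.PosDef) (hρ : 0 < ρ) (hp : 0 < p.1.det) : 0 < conf I ρ p :=
  conf_pos hI hρ (bodyVertical_ne_zero hp)

theorem det_pos_of_mem (hp : p ∈ phaseSpace) : 0 < p.1.det := by
  rw [(mem_phaseSpace_iff.1 hp).2]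
  exact one_pos

theorem mulVec_injective_of_mem (hp : p ∈ phaseSpace) {x : Vec} (h : p.1 *ᵥ x = 0) : x = 0 := by
  rw [← Matrix.one_mulVec x, ← transpose_mul_self hp, ← Matrix.mulVec_mulVec, h,
    Matrix.mulVec_zero]

/-- The correction carries the factor `1 - ⟨u, u⟩`, which is zero on rotations and stationary in the
directions `(A ∘ (ν × ·), δ)`. So both forms of the integral have the same value and the same
tangential derivative on `SO(3) × ℝ³`. -/
theorem moment_eq_momentExt (p : Phase) : moment I ρ p = momentExt I ρ p +
    (1 - bodyVertical p.1 ⬝ᵥ bodyVertical p.1) • (p.1 *ᵥ (I *ᵥ p.2)) := by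
  rw [moment, momentExt, ← Matrix.mulVec_smul, ← Matrix.mulVec_add, eta, inertia_mulVec]
  congr 1
  generalize I *ᵥ p.2 = y
  apply vec_ext <;>
    simp only [dot_eq, cross_apply_zero, cross_apply_one, cross_apply_two,
      Pi.add_apply, Pi.sub_apply, Pi.smul_apply, smul_eq_mul] <;> ring

theorem energy_eq_energyExt (p : Phase) : energy I ρ p = energyExt I ρ p +
    (1 - bodyVertical p.1 ⬝ᵥ bodyVertical p.1) * (1 / 2 * ((I *ᵥ p.2) ⬝ᵥ p.2)) := by
  rw [energy, energyExt, eta, inertia_mulVec]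
  generalize I *ᵥ p.2 = y
  simp only [dot_eq, cross_apply_zero, cross_apply_one, cross_apply_two,
      Pi.add_apply, Pi.smul_apply, smul_eq_mul]
  ring

theorem invariants_eq (hp : p ∈ phaseSpace) :
    invariants I ρ p = (integrals I ρ p, symEntries 1) := by
  rw [invariants, integrals, moment_eq_momentExt, energy_eq_energyExt,
    bodyVertical_dot_self_of_mem hp, (mem_phaseSpace_iff.1 hp).1]
  simp

theorem eq_of_symEntries_eq {A B : Matrix (Fin 3) (Fin 3) ℝ}
    (hA : Aᵀ = A) (hB : Bᵀ = B) (h : symEntries A = symEntries B) : A = B := by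
  have h0 := congrFun h 0
  have h1 := congrFun h 1
  have h2 := congrFun h 2
  have h3 := congrFun h 3
  have h4 := congrFun h 4
  have h5 := congrFun h 5
  have sA : ∀ i j, A i j = A j i := fun i j => congrFun (congrFun hA j) i
  have sB : ∀ i j, B i j = B j i := fun i j => congrFun (congrFun hB j) i
  simp only [symEntries] at h0 h1 h2 h3 h4 h5
  ext i j
  fin_cases i <;> fin_cases j <;>
    first
    | assumption
    | (rw [sA, sB]; assumption)

theorem mem_phaseSpace_of_symEntries (hp : 0 < p.1.det)
    (h : symEntries (p.1 * p.1ᵀ) = symEntries 1) : p ∈ phaseSpace := by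
  have h1 : p.1 * p.1ᵀ = 1 := eq_of_symEntries_eq
    (by rw [Matrix.transpose_mul, Matrix.transpose_transpose]) Matrix.transpose_one h
  refine mem_phaseSpace_iff.2 ⟨h1, ?_⟩
  have h2 := congrArg Matrix.det h1
  rw [Matrix.det_mul, Matrix.det_transpose, Matrix.det_one] at h2
  nlinarith

end Rotation

section Regular

theorem fderiv_integrals_apply (hI : I.PosDef) (hρ : 0 < ρ) (hp : p ∈ phaseSpace) (ν δ : Vec) :
    fderiv ℝ (integrals I ρ) p (p.1 * hat ν, δ) =
      (p.1 *ᵥ momentRate I ρ p ν δ, p.2 ⬝ᵥ momentRate I ρ p ν δ - ν ⬝ᵥ torque I ρ p) := by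
  refine fderiv_apply_eq analyticAt_integrals.differentiableAt ?_
  have hc := hasDerivAt_line_zero p ν δ
  have h₀ := hasDerivAt_dot_bodyVertical hc
  have h₁ := hasDerivAt_momentExt (I := I) (ρ := ρ) hc
  have h₂ := hasDerivAt_energyExt hI hρ hc
  have hJ := hasDerivAt_mulVec_const I (hasDerivAt_snd_comp hc)
  have k₁ := h₁.add ((h₀.const_sub 1).smul (hasDerivAt_mulVec (hasDerivAt_fst_comp hc) hJ))
  have k₂ := h₂.add ((h₀.const_sub 1).mul
    ((hasDerivAt_dotProduct hJ (hasDerivAt_snd_comp hc)).const_mul (1 / 2)))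
  have k := k₁.prodMk k₂
  simp only [zero_smul, add_zero, bodyVertical_dot_self_of_mem hp, neg_zero, zero_mul, one_mul,
    sub_self] at k
  refine HasDerivAt.congr_of_eventuallyEq k (Eventually.of_forall fun s => ?_)
  exact Prod.ext (moment_eq_momentExt _) (energy_eq_energyExt _)

/-- If `η × ω = 0`, the rate of the energy is `ω` times the rate of the moment, so the energy cannot
change while `j` is stationary. -/
theorem torque_ne_zero_of_isRegularPoint (hI : I.PosDef) (hρ : 0 < ρ) (hp : p ∈ phaseSpace)
    (h : IsRegularPoint I ρ p) : torque I ρ p ≠ 0 := by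
  intro ha
  obtain ⟨ν, δ, hνδ⟩ := h (0, 1)
  have hνδ' := (fderiv_integrals_apply hI hρ hp ν δ).symm.trans hνδ
  rw [Prod.mk.injEq, ha] at hνδ'
  rw [mulVec_injective_of_mem hp hνδ'.1] at hνδ'
  simp at hνδ'

/-- The equation reads `(I + ρ) δ = ρ ⟨u, δ⟩ u`, so `δ = ρ ⟨u, δ⟩ w`. The product with `u` gives
`⟨u, δ⟩ ρ X = 0`, and `X > 0`. It yields both the kernel of the derivative of the integrals and the
uniqueness of the velocity. -/
theorem eq_zero_of_momentRate_zero (hI : I.PosDef) (hρ : 0 < ρ) (hp : p ∈ phaseSpace) {δ : Vec}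
    (h : momentRate I ρ p 0 δ = 0) : δ = 0 := by
  have hX := (conf_pos_of_det hI hρ (det_pos_of_mem hp) : 0 < conf I ρ p)
  have hu := bodyVertical_dot_self_of_mem hp
  have h1 : inertia I ρ *ᵥ δ = (ρ * (bodyVertical p.1 ⬝ᵥ δ)) • bodyVertical p.1 := by
    rw [momentRate, hu] at h
    simpa [sub_eq_zero] using h
  have h2 : δ = (ρ * (bodyVertical p.1 ⬝ᵥ δ)) • invVertical I ρ p := by
    rw [invVertical, ← Matrix.mulVec_smul, ← h1, inv_mulVec_inertia hI hρ]
  have h3 := congrArg (bodyVertical p.1 ⬝ᵥ ·) h2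
  simp only [dotProduct_smul, smul_eq_mul] at h3
  have h4 : ρ * conf I ρ p = 1 - ρ * (bodyVertical p.1 ⬝ᵥ invVertical I ρ p) := by
    rw [conf, hu]
    field_simp
  have h5 : (bodyVertical p.1 ⬝ᵥ δ) * (ρ * conf I ρ p) = 0 := by
    rw [h4]
    linear_combination h3
  have h6 := (mul_eq_zero.1 h5).resolve_right (mul_pos hρ hX).ne'
  rw [h2, h6, mul_zero, zero_smul]

theorem hat_zero : hat 0 = 0 := by
  ext i j
  fin_cases i <;> fin_cases j <;> simp [hat]

/-- The angular velocities `ω` and `η` of the two fields are already independent, since `η × ω ≠ 0`.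
-/
theorem field_independent (hX : 0 < conf I ρ p) (hp : p ∈ phaseSpace) (ha : torque I ρ p ≠ 0)
    {v : Fin 2 → ℝ} (h : v 0 • field I ρ 0 p + v 1 • field I ρ 1 p = 0) : v = 0 := by
  have hs := (Real.sqrt_pos.2 hX).ne'
  rw [field_zero, field_one, smul_comm, smul_comm (v 1), ← smul_add, smul_eq_zero] at h
  have h1 := congrArg Prod.fst (h.resolve_left hs)
  have h2 : p.1 * hat (v 0 • p.2 + v 1 • eta I ρ p) = 0 := by
    rw [hat_add, hat_smul, hat_smul, mul_add, mul_smul_comm, mul_smul_comm]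
    exact h1
  have h3 : hat (v 0 • p.2 + v 1 • eta I ρ p) = hat 0 := by
    rw [← one_mul (hat (v 0 • p.2 + v 1 • eta I ρ p)), ← transpose_mul_self hp, mul_assoc, h2,
      mul_zero, hat_zero]
  have h4 := hat_injective h3
  have h5 := congrArg (fun x => x ⨯₃ p.2) h4
  have h6 := congrArg (fun x => eta I ρ p ⨯₃ x) h4
  simp only [map_add, LinearMap.add_apply, map_smul, LinearMap.smul_apply, cross_self, smul_zero,
    zero_add, add_zero, map_zero, LinearMap.zero_apply] at h5 h6
  ext i
  fin_cases i
  · exact (smul_eq_zero.1 h6).resolve_right ha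
  · exact (smul_eq_zero.1 h5).resolve_right ha

/-- Stationarity of `A Aᵀ` makes the vector tangent to the rotations, with some angular velocity
`ν`; stationarity of `j` and `T` makes `ν` orthogonal to `η × ω`, hence a combination of `ω` and
`η`. -/
theorem ker_fderiv_invariants_le (hI : I.PosDef) (hρ : 0 < ρ) (hp : p ∈ phaseSpace)
    (ha : torque I ρ p ≠ 0) {x : Phase} (hx : fderiv ℝ (invariants I ρ) p x = 0) :
    ∃ v : Fin 2 → ℝ, x = v 0 • field I ρ 0 p + v 1 • field I ρ 1 p := by
  have hX := (conf_pos_of_det hI hρ (det_pos_of_mem hp) : 0 < conf I ρ p)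
  have hs := (Real.sqrt_pos.2 hX).ne'
  obtain ⟨B, δ⟩ := x
  have h1 : HasDerivAt (fun s : ℝ => invariants I ρ (p + s • ((B, δ) : Phase))) 0 0 := by
    rw [← hx]
    exact analyticAt_invariants.differentiableAt.hasFDerivAt.hasLineDerivAt _
  have h2 : HasDerivAt (fun s : ℝ => (p + s • ((B, δ) : Phase)).1) B 0 := by
    exact hasDerivAt_line p.1 B 0
  have h3 := hasDerivAt_symEntries_mul_transpose h2
  have h4 : symEntries (B * p.1ᵀ + p.1 * Bᵀ) = symEntries 0 := by
    have h5 := h3.unique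
      ((ContinuousLinearMap.snd ℝ Param (Fin 6 → ℝ)).hasFDerivAt.comp_hasDerivAt 0 h1)
    simp at h5
    rw [h5]
    ext i
    fin_cases i <;> rfl
  have h5 : B * p.1ᵀ + p.1 * Bᵀ = 0 := eq_of_symEntries_eq
    (by simp [Matrix.transpose_add, Matrix.transpose_mul, add_comm]) Matrix.transpose_zero h4
  have h6 : p.1ᵀ * B + (p.1ᵀ * B)ᵀ = 0 := by
    have h7 := congrArg (fun M => p.1ᵀ * M * p.1) h5
    simp only [mul_add, add_mul, mul_zero, zero_mul] at h7
    rw [← h7, Matrix.transpose_mul, Matrix.transpose_transpose, mul_assoc, mul_assoc B,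
      transpose_mul_self hp, mul_one, ← mul_assoc p.1ᵀ p.1, transpose_mul_self hp, one_mul]
  obtain ⟨ν, hν⟩ := exists_eq_hat (S := p.1ᵀ * B) fun i j => congrFun (congrFun h6 i) j
  have hB : B = p.1 * hat ν := by
    rw [← hν, ← mul_assoc, (mem_phaseSpace_iff.1 hp).1, one_mul]
  subst hB
  have h8 := (fderiv_invariants_apply hI hρ ν δ).symm.trans hx
  rw [Prod.mk_eq_zero, Prod.mk_eq_zero] at h8
  obtain ⟨⟨h8, h9⟩, -⟩ := h8
  have h10 := mulVec_injective_of_mem hp h8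
  rw [h10, bodyVertical_dot_self_of_mem hp, one_mul, dotProduct_zero, zero_sub, neg_eq_zero] at h9
  obtain ⟨c₀, c₁, hc⟩ := exists_eq_smul_add_smul ha h9
  -- After subtraction of the two fields a kernel vector with angular velocity zero is left, and its
  -- `ω`-component must vanish.
  obtain ⟨d, hd⟩ : ∃ d, d = δ - c₀ • (field₁ I ρ p).2 - c₁ • (field₂ I ρ p).2 := ⟨_, rfl⟩
  have hsplit : ((p.1 * hat ν, δ) : Phase) =
      c₀ • field₁ I ρ p + c₁ • field₂ I ρ p + (p.1 * hat 0, d) := by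
    refine Prod.ext ?_ ?_
    · simp only [Prod.fst_add, Prod.smul_fst]
      rw [hc, hat_add, hat_smul, hat_smul, mul_add, mul_smul_comm, mul_smul_comm, hat_zero, mul_zero,
        add_zero]
      rfl
    · simp only [Prod.snd_add, Prod.smul_snd]
      rw [hd]
      abel
  have hd0 : d = 0 := by
    have h11 := hx
    rw [hsplit, map_add, map_add, map_smul, map_smul, fderiv_invariants_field₁ hI hρ hX.ne',
      fderiv_invariants_field₂ hI hρ hX.ne', smul_zero, smul_zero, zero_add, zero_add] at h11
    have h12 := (fderiv_invariants_apply hI hρ 0 d).symm.trans h11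
    rw [Prod.mk_eq_zero, Prod.mk_eq_zero] at h12
    exact eq_zero_of_momentRate_zero hI hρ hp (mulVec_injective_of_mem hp h12.1.1)
  refine ⟨![c₀ / √(conf I ρ p), c₁ / √(conf I ρ p)], ?_⟩
  have hz : ((p.1 * hat 0, d) : Phase) = 0 := by
    rw [hd0]
    refine Prod.ext ?_ rfl
    simp [hat_zero]
  rw [hsplit, hz, add_zero, field_zero, field_one, smul_smul, smul_smul]
  simp [hs]

-- Surjectivity is a dimension count: the kernel has dimension at most two, and `12 - 2 = 10` is the
-- dimension of the target.
open AnalyticFlow in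
theorem isRegularAt_invariants (hI : I.PosDef) (hρ : 0 < ρ) (hp : p ∈ phaseSpace)
    (ha : torque I ρ p ≠ 0) : IsRegularAt (invariants I ρ) (field I ρ) p where
  independent v hv := field_independent (conf_pos_of_det hI hρ (det_pos_of_mem hp)) hp ha hv
  ker_le x hx := ker_fderiv_invariants_le hI hρ hp ha hx
  surjective := by
    set L := (fderiv ℝ (invariants I ρ) p).toLinearMap with hL
    have h1 : LinearMap.ker L ≤ Submodule.span ℝ (Set.range fun i => field I ρ i p) := by
      intro x hx
      obtain ⟨v, rfl⟩ := ker_fderiv_invariants_le hI hρ hp ha hx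
      exact add_mem (Submodule.smul_mem _ _ (Submodule.subset_span ⟨0, rfl⟩))
        (Submodule.smul_mem _ _ (Submodule.subset_span ⟨1, rfl⟩))
    have h2 : Module.finrank ℝ (LinearMap.ker L) ≤ 2 :=
      (Submodule.finrank_mono h1).trans
        ((finrank_range_le_card fun i => field I ρ i p).trans_eq (Fintype.card_fin 2))
    have h3 := L.finrank_range_add_finrank_ker
    have h4 : Module.finrank ℝ Phase = 12 := by simp [Module.finrank_prod, Module.finrank_matrix]
    have h5 : Module.finrank ℝ (Param × (Fin 6 → ℝ)) = 10 := by simp [Module.finrank_prod]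
    have h6 : LinearMap.range L = ⊤ := by
      apply Submodule.eq_top_of_finrank_eq
      refine le_antisymm (Submodule.finrank_le _) ?_
      omega
    exact LinearMap.range_eq_top.1 h6

end Regular

end Chaplygin

end

/-! ### Compact level sets, and uniqueness of the velocity -/

section

open scoped Matrix Matrix.Norms.Elementwise Topology
open Set Filter Metric

namespace AnalyticFlow

variable {N : Type*} [NormedAddCommGroup N] [NormedSpace ℝ N]
  {Q : Type*} [NormedAddCommGroup Q] [NormedSpace ℝ Q] {U : Set N}

theorem eq_of_fderiv_apply_eq_zero {F : N → Q} {Y : N → N} {γ : ℝ → N} {s : Set ℝ}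
    (hF : ∀ q ∈ U, DifferentiableAt ℝ F q) (hFY : ∀ q ∈ U, fderiv ℝ F q (Y q) = 0)
    (hso : IsOpen s) (hs : IsPreconnected s)
    (hγ : ∀ t ∈ s, HasDerivAt γ (Y (γ t)) t ∧ γ t ∈ U) {a b : ℝ} (ha : a ∈ s) (hb : b ∈ s) :
    F (γ a) = F (γ b) := by
  have h : ∀ t ∈ s, HasDerivAt (fun t => F (γ t)) 0 t := fun t ht => by
    rw [← hFY _ (hγ t ht).2]
    exact (hF _ (hγ t ht).2).hasFDerivAt.comp_hasDerivAt t (hγ t ht).1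
  exact hso.is_const_of_deriv_eq_zero hs
    (fun t ht => (h t ht).differentiableAt.differentiableWithinAt) (fun t ht => (h t ht).deriv)
    ha hb

/-- The level sets of the first integral `F` are the traps. -/
theorem hasCompactTraps_of_isCompact {F : N → Q} {Y : N → N}
    (hF : ∀ q ∈ U, DifferentiableAt ℝ F q) (hFY : ∀ q ∈ U, fderiv ℝ F q (Y q) = 0)
    (hK : ∀ p ∈ U, IsCompact {q | q ∈ U ∧ F q = F p}) : HasCompactTraps Y U := by
  intro p hp
  refine ⟨{q | q ∈ U ∧ F q = F p}, fun q hq => hq.1, hK p hp, ⟨hp, rfl⟩, ?_⟩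
  intro γ δ hδ hγ h0 t ht
  refine ⟨(hγ t ht).2, ?_⟩
  rw [← h0.2]
  exact eq_of_fderiv_apply_eq_zero (s := Ioo (-δ) δ) hF hFY isOpen_Ioo isPreconnected_Ioo
    (fun t ht => hγ t (abs_lt.2 ht)) (abs_lt.1 ht) ⟨neg_lt_zero.2 hδ, hδ⟩

variable [CompleteSpace N] {G : (Fin 2 → ℝ) → N → N} {Y : Fin 2 → N → N}

theorem IsAction.hasDerivAt_smul (hG : IsAction G Y U) {q : N} (hq : q ∈ U) (v : Fin 2 → ℝ)
    (s : ℝ) : HasDerivAt (fun s : ℝ => G (s • v) q)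
      (v 0 • Y 0 (G (s • v) q) + v 1 • Y 1 (G (s • v) q)) s := by
  have hq' := hG.mem (s • v) q hq
  have han : AnalyticAt ℝ (fun t => G t (G (s • v) q)) 0 :=
    AnalyticAt.fun_comp (g := fun z : (Fin 2 → ℝ) × N => G z.1 z.2)
      (f := fun t => (t, G (s • v) q)) (hG.analytic 0 _ hq') (analyticAt_id.prod analyticAt_const)
  have h1 : HasDerivAt (fun r : ℝ => (r - s) • v) v s := by
    simpa using ((hasDerivAt_id s).sub_const s).smul_const v
  have h2 : HasFDerivAt (fun t => G t (G (s • v) q))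
      (fderiv ℝ (fun t => G t (G (s • v) q)) 0) ((s - s) • v) := by
    rw [sub_self, zero_smul]
    exact han.differentiableAt.hasFDerivAt
  have h3 := h2.comp_hasDerivAt s h1
  rw [hG.fderiv_apply hq'] at h3
  refine h3.congr_of_eventuallyEq (Eventually.of_forall fun r => ?_)
  change G (r • v) q = G ((r - s) • v) (G (s • v) q)
  rw [← hG.add _ _ q hq, ← add_smul, sub_add_cancel]

theorem IsAction.apply_eq_of_fderiv_eq_zero (hG : IsAction G Y U) {F : N → Q}
    (hF : ∀ q ∈ U, DifferentiableAt ℝ F q) (hFY : ∀ q ∈ U, ∀ i, fderiv ℝ F q (Y i q) = 0)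
    (t : Fin 2 → ℝ) {q : N} (hq : q ∈ U) : F (G t q) = F q := by
  have h := eq_of_fderiv_apply_eq_zero (Y := fun q => t 0 • Y 0 q + t 1 • Y 1 q)
    (γ := fun s : ℝ => G (s • t) q) (s := univ) hF
    (fun q hq => by rw [map_add, map_smul, map_smul, hFY q hq, hFY q hq]; simp)
    isOpen_univ isPreconnected_univ
    (fun s _ => ⟨hG.hasDerivAt_smul hq t s, hG.mem _ _ hq⟩) (mem_univ 1) (mem_univ 0)
  simpa [hG.zero q hq] using h

end AnalyticFlow

namespace Chaplygin

variable {I : Matrix (Fin 3) (Fin 3) ℝ} {ρ : ℝ} {p : Phase}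

section Compactness

theorem dot_self_nonneg (x : Vec) : 0 ≤ x ⬝ᵥ x := by
  rw [dot_eq]
  nlinarith [sq_nonneg (x 0), sq_nonneg (x 1), sq_nonneg (x 2)]

theorem dot_mul_dot_le (x y : Vec) : (x ⬝ᵥ y) * (x ⬝ᵥ y) ≤ (x ⬝ᵥ x) * (y ⬝ᵥ y) := by
  have h := dot_self_nonneg (x ⨯₃ y)
  have h' : (x ⨯₃ y) ⬝ᵥ (x ⨯₃ y) = (x ⬝ᵥ x) * (y ⬝ᵥ y) - (x ⬝ᵥ y) * (x ⬝ᵥ y) := by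
    simp only [dot_eq, cross_apply_zero, cross_apply_one, cross_apply_two]
    ring
  linarith

theorem exists_norm_sq_le_dot_mulVec (hI : I.PosDef) :
    ∃ l : ℝ, 0 < l ∧ ∀ x : Vec, l * ‖x‖ ^ 2 ≤ x ⬝ᵥ (I *ᵥ x) := by
  have hc : Continuous fun x : Vec => x ⬝ᵥ (I *ᵥ x) :=
    continuous_id.dotProduct (continuous_const.matrix_mulVec continuous_id)
  obtain ⟨x₀, hx₀, hmin⟩ := (isCompact_sphere (0 : Vec) 1).exists_isMinOn
    (NormedSpace.sphere_nonempty.2 zero_le_one) hc.continuousOn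
  have hx₀' : x₀ ≠ 0 := by
    rintro rfl
    simp at hx₀
  refine ⟨x₀ ⬝ᵥ (I *ᵥ x₀), dot_mulVec_pos hI hx₀', fun x => ?_⟩
  rcases eq_or_ne x 0 with rfl | hx
  · simp
  have hn : ‖x‖ ≠ 0 := norm_ne_zero_iff.2 hx
  have h := hmin (show ‖x‖⁻¹ • x ∈ sphere (0 : Vec) 1 by
    simp [norm_smul, hn])
  simp only [mem_ofPred_eq, Matrix.mulVec_smul, smul_dotProduct, dotProduct_smul, smul_eq_mul] at h
  calc x₀ ⬝ᵥ (I *ᵥ x₀) * ‖x‖ ^ 2 ≤ (‖x‖⁻¹ * (‖x‖⁻¹ * (x ⬝ᵥ (I *ᵥ x)))) * ‖x‖ ^ 2 := by gcongr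
    _ = x ⬝ᵥ (I *ᵥ x) := by field_simp

/-- The part of the energy with the factor `ρ` is nonnegative by Cauchy–Schwarz. -/
theorem le_energyExt (hρ : 0 < ρ) (p : Phase) :
    1 / 2 * ((bodyVertical p.1 ⬝ᵥ bodyVertical p.1) * (p.2 ⬝ᵥ (I *ᵥ p.2))) ≤ energyExt I ρ p := by
  have h := mul_le_mul_of_nonneg_left (dot_mul_dot_le (bodyVertical p.1) p.2) hρ.le
  rw [energyExt, eta, inertia_mulVec, add_dotProduct, smul_dotProduct, smul_eq_mul,
    dotProduct_comm p.2 (I *ᵥ p.2)]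
  linarith

theorem sq_entry_le (A : Matrix (Fin 3) (Fin 3) ℝ) (i j : Fin 3) :
    A i j ^ 2 ≤ (A * Aᵀ) i i := by
  simp only [Matrix.mul_apply, Matrix.transpose_apply, ← sq]
  exact Finset.single_le_sum (f := fun j => A i j ^ 2) (fun _ _ => sq_nonneg _) (Finset.mem_univ j)

theorem mul_transpose_eq_of_invariants {q : Phase} (h : invariants I ρ q = invariants I ρ p) :
    q.1 * q.1ᵀ = p.1 * p.1ᵀ :=
  eq_of_symEntries_eq (by rw [Matrix.transpose_mul, Matrix.transpose_transpose])
    (by rw [Matrix.transpose_mul, Matrix.transpose_transpose]) (congrArg Prod.snd h)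

/-- On a level set `A Aᵀ` is fixed, which bounds `A` and fixes `⟨u, u⟩`, one of its entries; then
the energy bounds `ω`. As the square of `det A` is fixed too, the open condition `det A > 0` becomes
the closed condition that `det A` has the value at `p`. -/
theorem isCompact_invariants_level (hI : I.PosDef) (hρ : 0 < ρ) (hp : 0 < p.1.det) :
    IsCompact {q : Phase | q ∈ {q : Phase | 0 < q.1.det} ∧ invariants I ρ q = invariants I ρ p} := by
  have hdet : Continuous fun q : Phase => q.1.det := continuous_fst.matrix_det
  have hinv : Continuous (invariants I ρ) :=
    continuous_iff_continuousAt.2 fun q => analyticAt_invariants.continuousAt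
  have heq : {q : Phase | q ∈ {q : Phase | 0 < q.1.det} ∧ invariants I ρ q = invariants I ρ p} =
      {q : Phase | q.1.det = p.1.det} ∩ {q | invariants I ρ q = invariants I ρ p} := by
    ext q
    refine ⟨fun ⟨h1, h2⟩ => ⟨?_, h2⟩, fun ⟨h1, h2⟩ => ⟨?_, h2⟩⟩
    · have h3 := congrArg Matrix.det (mul_transpose_eq_of_invariants h2)
      simp only [Matrix.det_mul, Matrix.det_transpose] at h3
      exact (mul_self_inj (le_of_lt h1) hp.le).1 h3
    · exact hp.trans_eq h1.symm
  rw [heq]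
  refine isCompact_of_isClosed_isBounded ((isClosed_eq hdet continuous_const).inter
    (isClosed_eq hinv continuous_const)) ?_
  obtain ⟨l, hl, hle⟩ := exists_norm_sq_le_dot_mulVec hI
  set d := bodyVertical p.1 ⬝ᵥ bodyVertical p.1 with hd
  have hd0 : 0 < d := lt_of_le_of_ne (dot_self_nonneg _) fun h =>
    bodyVertical_ne_zero hp (dotProduct_self_eq_zero.1 h.symm)
  -- Both radii have the form `1 + S`, because `x ^ 2 ≤ S` implies `|x| ≤ 1 + S` without square
  -- roots.
  obtain ⟨R₁, hR₁⟩ : ∃ R₁, R₁ = 1 + ∑ i, (p.1 * p.1ᵀ) i i := ⟨_, rfl⟩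
  obtain ⟨R₂, hR₂⟩ : ∃ R₂, R₂ = 1 + 2 * energyExt I ρ p / (d * l) := ⟨_, rfl⟩
  refine isBounded_iff_subset_closedBall (0 : Phase) |>.2 ⟨max R₁ R₂, fun q hq => ?_⟩
  obtain ⟨-, hq⟩ := hq
  have hq1 := mul_transpose_eq_of_invariants hq
  have hq2 : energyExt I ρ q = energyExt I ρ p := congrArg (fun z => z.1.2) hq
  have hnn : ∀ i, 0 ≤ (p.1 * p.1ᵀ) i i := fun i => (sq_nonneg _).trans (sq_entry_le p.1 i 0)
  have b1 : ‖q.1‖ ≤ R₁ := by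
    have hR : 0 ≤ R₁ := by
      rw [hR₁]
      exact add_nonneg zero_le_one (Finset.sum_nonneg fun i _ => hnn i)
    rw [Matrix.norm_le_iff hR]
    intro i j
    have h1 := sq_entry_le q.1 i j
    rw [hq1] at h1
    have h2 := Finset.single_le_sum (fun i _ => hnn i) (Finset.mem_univ i)
    rw [Real.norm_eq_abs, abs_le]
    constructor <;> nlinarith
  have b2 : ‖q.2‖ ≤ R₂ := by
    have h1 := le_energyExt (I := I) hρ q
    rw [bodyVertical_dot_self, hq1, ← bodyVertical_dot_self, hq2, ← hd] at h1
    have h2 := mul_le_mul_of_nonneg_left (hle q.2) hd0.le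
    have h3 : ‖q.2‖ ^ 2 ≤ 2 * energyExt I ρ p / (d * l) := by
      rw [le_div_iff₀ (by positivity)]
      linarith
    nlinarith [sq_nonneg (‖q.2‖ - 1)]
  rw [mem_closedBall_zero_iff, Prod.norm_def]
  exact max_le_max b1 b2

end Compactness

section Velocity

/-- The equation for `ω'` says exactly that `j` is conserved when `A` rotates with angular velocity
`ω`. -/
theorem momentRate_angularVelocity (hp : p ∈ phaseSpace) (δ : Vec) :
    momentRate I ρ p p.2 δ = I *ᵥ δ - (I *ᵥ p.2) ⨯₃ p.2 -
      ρ • ((bodyVertical p.1 ⬝ᵥ δ) • bodyVertical p.1 - δ) := by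
  rw [momentRate, bodyVertical_dot_self_of_mem hp, eta, inertia_mulVec, inertia_mulVec]
  generalize I *ᵥ p.2 = y
  generalize I *ᵥ δ = z
  apply vec_ext <;>
    simp only [dot_eq, cross_apply_zero, cross_apply_one, cross_apply_two,
      Pi.add_apply, Pi.sub_apply, Pi.smul_apply, smul_eq_mul] <;> ring

theorem isVelocity_iff (hp : p ∈ phaseSpace) {V : Phase} :
    IsVelocity I ρ p V ↔ V.1 = p.1 * hat p.2 ∧ momentRate I ρ p p.2 V.2 = 0 := by
  rw [IsVelocity, momentRate_angularVelocity hp, sub_eq_zero (b := ρ • _)]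

theorem isVelocity_field₁ (hI : I.PosDef) (hρ : 0 < ρ) (hp : p ∈ phaseSpace) :
    IsVelocity I ρ p (field₁ I ρ p) :=
  (isVelocity_iff hp).2 ⟨rfl, momentRate_field₁ hI hρ
    (conf_pos_of_det hI hρ (det_pos_of_mem hp)).ne'⟩

theorem momentRate_sub (ν δ δ' : Vec) :
    momentRate I ρ p 0 (δ - δ') = momentRate I ρ p ν δ - momentRate I ρ p ν δ' := by
  simp only [momentRate, Matrix.mulVec_sub]
  generalize inertia I ρ *ᵥ δ = y
  generalize inertia I ρ *ᵥ δ' = z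
  apply vec_ext <;>
    simp only [dot_eq, cross_apply_zero, cross_apply_one, cross_apply_two, Pi.zero_apply,
      Pi.add_apply, Pi.sub_apply, Pi.smul_apply, smul_eq_mul] <;> ring

theorem IsVelocity.eq_field₁ (hI : I.PosDef) (hρ : 0 < ρ) (hp : p ∈ phaseSpace) {V : Phase}
    (hV : IsVelocity I ρ p V) : V = field₁ I ρ p := by
  have h1 := (isVelocity_iff hp).1 hV
  have h2 := (isVelocity_iff hp).1 (isVelocity_field₁ hI hρ hp)
  refine Prod.ext (h1.1.trans h2.1.symm) (sub_eq_zero.1 ?_)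
  refine eq_zero_of_momentRate_zero hI hρ hp ?_
  rw [momentRate_sub p.2, h1.2, h2.2, sub_zero]

end Velocity

end Chaplygin

end

/-! ### Connected components, and motions as orbits in the rescaled time -/

section

open scoped Matrix Matrix.Norms.Elementwise Topology
open Set Filter AnalyticFlow

/-- The set `R` is connected, and open and closed relative to `L`. -/
theorem eq_connectedComponentIn_of_eventually {α : Type*} [TopologicalSpace α] {R L : Set α}
    (hR : IsPreconnected R) (hRc : IsClosed R) (hRL : R ⊆ L)
    (hloc : ∀ r ∈ R, ∀ᶠ q in 𝓝 r, q ∈ L → q ∈ R) {x : α} (hx : x ∈ R) :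
    R = connectedComponentIn L x := by
  refine Subset.antisymm (hR.subset_connectedComponentIn hx hRL) ?_
  have hCL := connectedComponentIn_subset L x
  have hcover : connectedComponentIn L x ⊆ interior {q | q ∈ L → q ∈ R} ∪ Rᶜ := fun q _ => by
    by_cases hqR : q ∈ R
    · exact Or.inl (mem_interior_iff_mem_nhds.2 (hloc q hqR))
    · exact Or.inr hqR
  have hdisj : connectedComponentIn L x ∩ (interior {q | q ∈ L → q ∈ R} ∩ Rᶜ) = ∅ :=
    eq_empty_of_forall_notMem fun q hq => hq.2.2 (interior_subset hq.2.1 (hCL hq.1))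
  rcases isPreconnected_iff_subset_of_disjoint.1 isPreconnected_connectedComponentIn _ _
    isOpen_interior hRc.isOpen_compl hcover hdisj with h | h
  · exact fun q hq => interior_subset (h hq) (hCL hq)
  · exact absurd hx (h (mem_connectedComponentIn (hRL hx)))

namespace Chaplygin

variable {I : Matrix (Fin 3) (Fin 3) ℝ} {ρ : ℝ}

theorem isOpenQuotientMap_toTorus : IsOpenQuotientMap toTorus :=
  IsOpenQuotientMap.piMap fun _ => QuotientAddGroup.isOpenQuotientMap_mk

theorem isOpen_det_pos : IsOpen {q : Phase | 0 < q.1.det} :=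
  isOpen_lt continuous_const continuous_fst.matrix_det

/-- The two commuting vector fields generate an analytic action of `ℝ²`. -/
theorem exists_isAction_field (hI : I.PosDef) (hρ : 0 < ρ) :
    ∃ G, IsAction G (field I ρ) {q : Phase | 0 < q.1.det} :=
  exists_isAction isOpen_det_pos
    (fun i _ hq => analyticAt_field (conf_pos_of_det hI hρ hq) i)
    (fun i => hasCompactTraps_of_isCompact (F := invariants I ρ)
      (fun _ _ => analyticAt_invariants.differentiableAt)
      (fun _ hq => fderiv_invariants_field hI hρ (conf_pos_of_det hI hρ hq).ne' i)
      (fun _ hp => isCompact_invariants_level hI hρ hp))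
    (fun _ hq => fderiv_field_comm hI hρ (conf_pos_of_det hI hρ hq))

theorem apply_single_hasDerivAt {G : (Fin 2 → ℝ) → Phase → Phase}
    (hG : IsAction G (field I ρ) {q : Phase | 0 < q.1.det}) {q : Phase} (hq : 0 < q.1.det)
    {f : ℝ → ℝ} {f' t : ℝ} (hf : HasDerivAt f f' t) :
    HasDerivAt (fun s => G (Pi.single 0 (f s)) q)
      (f' • field I ρ 0 (G (Pi.single 0 (f t)) q)) t := by
  have hs : ∀ s : ℝ, (s • Pi.single 0 1 : Fin 2 → ℝ) = Pi.single 0 s := fun s => by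
    rw [← Pi.single_smul, smul_eq_mul, mul_one]
  have h := hG.hasDerivAt_smul hq (Pi.single 0 1) (f t)
  have h0 : (Pi.single 0 1 : Fin 2 → ℝ) 1 = 0 := rfl
  simp only [hs, Pi.single_eq_same, one_smul, h0, zero_smul, add_zero] at h
  have h' := h.scomp t hf
  exact h'

/-- A rotational motion is an orbit of the action in the rescaled time. -/
theorem IsRotationalMotion.eq_apply {G : (Fin 2 → ℝ) → Phase → Phase} (hI : I.PosDef)
    (hρ : 0 < ρ) (hG : IsAction G (field I ρ) {q : Phase | 0 < q.1.det}) {γ : ℝ → Phase}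
    (hγ : IsRotationalMotion I ρ γ) {τ : ℝ → ℝ}
    (hτ : ∀ t, HasDerivAt τ (√(X I ρ (bodyVertical (γ t).1)))⁻¹ t) (t : ℝ) :
    γ t = G (Pi.single 0 (τ t - τ 0)) (γ 0) := by
  have hU : ∀ t, 0 < (γ t).1.det := fun t => det_pos_of_mem (hγ t).1
  have hX : ∀ t, 0 < conf I ρ (γ t) := fun t => conf_pos_of_det hI hρ (hU t)
  have hτ' : ∀ t, HasDerivAt τ (√(conf I ρ (γ t)))⁻¹ t := fun t => by
    rw [conf_eq_X (hγ t).1]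
    exact hτ t
  have hγc : Continuous γ := continuous_iff_continuousAt.2 fun t => by
    obtain ⟨V, -, hV⟩ := (hγ t).2
    exact hV.continuousAt
  have hc : Continuous (conf I ρ) :=
    continuous_iff_continuousAt.2 fun q => analyticAt_conf.continuousAt
  -- The factor `X^{-1/2}` is evaluated along `γ` for both curves. So it is a given function of
  -- time, and uniqueness holds for the field `field I ρ 0` multiplied by it.
  refine eqOn_of_hasDerivAt_smul (Y := field I ρ 0) (U := {q : Phase | 0 < q.1.det})
    (s := univ) (g := fun t => (√(conf I ρ (γ t)))⁻¹)
    (fun q hq => analyticAt_field (conf_pos_of_det hI hρ hq) 0) isOpen_univ isPreconnected_univ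
    ((hc.comp hγc).sqrt.inv₀ fun t => (Real.sqrt_pos.2 (hX t)).ne').continuousOn
    (fun t _ => ⟨?_, hU t⟩)
    (fun t _ => apply_single_hasDerivAt hG (hU 0) ((hτ' t).sub_const (τ 0))) (mem_univ 0) ?_
    (mem_univ t)
  · obtain ⟨V, hV, hV'⟩ := (hγ t).2
    rw [field_zero, smul_smul, inv_mul_cancel₀ (Real.sqrt_pos.2 (hX t)).ne', one_smul,
      ← hV.eq_field₁ hI hρ (hγ t).1]
    exact hV'
  · rw [sub_self, Pi.single_zero, hG.zero _ (hU 0)]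

end Chaplygin

end


/-! ### The invariant tori of Chaplygin's sphere -/

theorem mainTheorem2 (I : Matrix (Fin 3) (Fin 3) ℝ) (hI : I.PosDef) (m r : ℝ)
    (hm : 0 < m) (hr : 0 < r) (ε₀ : Chaplygin.Param)
    (hreg : Chaplygin.IsRegularValue I (m * r ^ 2) ε₀)
    (p₀ : Chaplygin.Phase) (hp₀ : p₀ ∈ Chaplygin.levelSet I (m * r ^ 2) ε₀) :
    ∃ (E : Set Chaplygin.Param) (M : Set Chaplygin.Phase)
      (Φ : UnitAddTorus (Fin 2) → Chaplygin.Param → Chaplygin.Phase)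
      (ν : Chaplygin.Param → Fin 2 → ℝ),
      -- `E` is an open neighborhood of the given regular value `(j, T)`
      IsOpen E ∧ ε₀ ∈ E ∧
      -- `M` is an open subset of `SO(3) × ℝ³` containing the given point
      (∃ U : Set Chaplygin.Phase, IsOpen U ∧ M = U ∩ Chaplygin.phaseSpace) ∧ p₀ ∈ M ∧
      -- analytic dependence of the frequencies and of the tori
      AnalyticOnNhd ℝ ν E ∧
      Chaplygin.IsAnalyticDiffeo Φ E M ∧
      -- the tori are connected components of the level sets of `(j, T)`
      (∀ x, ∀ ε ∈ E, Chaplygin.integrals I (m * r ^ 2) (Φ x ε) = ε) ∧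
      (∀ x, ∀ ε ∈ E, Set.range (fun y => Φ y ε) =
        connectedComponentIn (Chaplygin.levelSet I (m * r ^ 2) ε) (Φ x ε)) ∧
      -- the reparametrized motion is linear on the tori
      Chaplygin.LinearizesFlow I (m * r ^ 2) Φ E ν ∧
      (∀ γ : ℝ → Chaplygin.Phase, Chaplygin.IsRotationalMotion I (m * r ^ 2) γ → γ 0 ∈ M →
        ∀ τ : ℝ → ℝ,
          (∀ t, HasDerivAt τ
            (√(Chaplygin.X I (m * r ^ 2) (Chaplygin.bodyVertical (γ t).1)))⁻¹ t) →
          ∃ x : UnitAddTorus (Fin 2), ∃ ε ∈ E,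
            ∀ t, γ t = Φ (x + Chaplygin.toTorus (τ t • ν ε)) ε) := by
  have hρ : 0 < m * r ^ 2 := by positivity
  generalize m * r ^ 2 = ρ at *
  have hU : IsOpen {q : Chaplygin.Phase | 0 < q.1.det} := Chaplygin.isOpen_det_pos
  have hp₀U : p₀ ∈ {q : Chaplygin.Phase | 0 < q.1.det} := Chaplygin.det_pos_of_mem hp₀.1
  have hc : Chaplygin.invariants I ρ p₀ = (ε₀, Chaplygin.symEntries 1) := by
    rw [Chaplygin.invariants_eq hp₀.1, hp₀.2]
  have hphase : ∀ q ∈ {q : Chaplygin.Phase | 0 < q.1.det}, ∀ ε : Chaplygin.Param,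
      Chaplygin.invariants I ρ q = (ε, Chaplygin.symEntries 1) →
        q ∈ Chaplygin.phaseSpace ∧ Chaplygin.integrals I ρ q = ε := by
    intro q hq ε h
    have h1 := Chaplygin.mem_phaseSpace_of_symEntries hq (congrArg Prod.snd h)
    rw [Chaplygin.invariants_eq h1] at h
    exact ⟨h1, congrArg Prod.fst h⟩
  obtain ⟨G, hG⟩ := Chaplygin.exists_isAction_field hI hρ
  obtain ⟨E, Φ, ν, hE, hpE, hν, ⟨z₀, hz₀⟩, hΦU, hΦinj, hΦan, hg, hflow⟩ :=
    hG.exists_tori hU (F := Chaplygin.invariants I ρ)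
    (fun _ _ => Chaplygin.analyticAt_invariants)
    (fun t q hq => hG.apply_eq_of_fderiv_eq_zero
      (fun _ _ => Chaplygin.analyticAt_invariants.differentiableAt)
      (fun q hq i => Chaplygin.fderiv_invariants_field hI hρ
        (Chaplygin.conf_pos_of_det hI hρ hq).ne' i) t hq)
    hp₀U (Chaplygin.isCompact_invariants_level hI hρ hp₀U)
    -- The whole level set of the extended integrals through `p₀` lies in `SO(3) × ℝ³` over the
    -- value `ε₀`, so regularity of this value applies at each of its points.
    (fun q hq h => by
      obtain ⟨h1, h2⟩ := hphase q hq ε₀ (h.trans hc)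
      exact Chaplygin.isRegularAt_invariants hI hρ h1
        (Chaplygin.torque_ne_zero_of_isRegularPoint hI hρ h1 (hreg q ⟨h1, h2⟩)))
  rw [hc] at hpE hz₀
  -- The slice `A Aᵀ = 1` in the space of values. The family of tori over it is the part that
  -- consists of rotations.
  obtain ⟨ι, hι⟩ : ∃ ι : Chaplygin.Param → Chaplygin.Param × (Fin 6 → ℝ),
      ι = fun ε => (ε, Chaplygin.symEntries 1) := ⟨_, rfl⟩
  have hιa : ∀ ε, AnalyticAt ℝ ι ε := fun ε => by
    rw [hι]
    exact analyticAt_id.prod analyticAt_const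
  have hιc : Continuous ι := continuous_iff_continuousAt.2 fun ε => (hιa ε).continuousAt
  have hΦmem : ∀ z, ∀ ε ∈ ι ⁻¹' E, Φ z (ι ε) ∈ Chaplygin.levelSet I ρ ε := fun z ε hε =>
    hphase _ (hΦU z _ hε).1 ε (by rw [(hΦU z _ hε).2, hι])
  have hι_inv : ∀ q ∈ Chaplygin.phaseSpace,
      Chaplygin.invariants I ρ q = ι (Chaplygin.integrals I ρ q) := fun q hq => by
    rw [Chaplygin.invariants_eq hq, hι]
  have hcont : ∀ ε ∈ ι ⁻¹' E, Continuous fun z => Φ z (ι ε) := by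
    intro ε hε
    rw [Chaplygin.isOpenQuotientMap_toTorus.isQuotientMap.continuous_iff]
    refine continuous_iff_continuousAt.2 fun x => ?_
    exact ContinuousAt.comp (f := fun x : Fin 2 → ℝ => (x, ι ε))
      (g := fun z : (Fin 2 → ℝ) × _ => Φ (Chaplygin.toTorus z.1) z.2)
      (hΦan (x, ι ε) ⟨Set.mem_univ _, hε⟩).continuousAt
      (continuousAt_id.prodMk continuousAt_const)
  refine ⟨ι ⁻¹' E, (fun z : UnitAddTorus (Fin 2) × Chaplygin.Param => Φ z.1 (ι z.2)) ''
    (Set.univ ×ˢ (ι ⁻¹' E)), fun z ε => Φ z (ι ε), fun ε => ν (ι ε), hE.preimage hιc,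
    by rw [hι]; exact hpE, ?_, ⟨(z₀, ε₀), ⟨Set.mem_univ _, by rw [hι]; exact hpE⟩,
      by rw [hι]; exact hz₀⟩, fun ε hε => (hν _ hε).fun_comp (hιa ε), ⟨?_, ?_, ?_⟩,
    fun z ε hε => (hΦmem z ε hε).2, ?_, ?_, ?_⟩
  -- The union of all tori, also those of non-orthogonal `A`, is open in the ambient space by the
  -- local inverses; its intersection with the phase space is the union over the slice.
  · refine ⟨{q | ∃ z, ∃ ε ∈ E, Φ z ε = q}, ?_, ?_⟩
    · rw [isOpen_iff_mem_nhds]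
      rintro _ ⟨z, ε, hε, rfl⟩
      obtain ⟨g, -, hg'⟩ := hg z ε hε
      filter_upwards [hg'] with q hq
      exact ⟨_, _, hq.1, hq.2⟩
    · ext q
      constructor
      · rintro ⟨⟨z, ε⟩, ⟨-, hε⟩, rfl⟩
        exact ⟨⟨z, ι ε, hε, rfl⟩, (hΦmem z ε hε).1⟩
      · rintro ⟨⟨z, ε, hε, rfl⟩, hq⟩
        have h1 := hι_inv _ hq
        rw [(hΦU z ε hε).2] at h1
        refine ⟨(z, Chaplygin.integrals I ρ (Φ z ε)), ⟨Set.mem_univ _, ?_⟩, ?_⟩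
        · change ι _ ∈ E
          rw [← h1]
          exact hε
        · change Φ z (ι _) = _
          rw [← h1]
  · refine ⟨Set.mapsTo_image _ _, ?_, Set.surjOn_image _ _⟩
    rintro ⟨z, ε⟩ ⟨-, hε⟩ ⟨z', ε'⟩ ⟨-, hε'⟩ h
    change Φ z (ι ε) = Φ z' (ι ε') at h
    have h1 : ε = ε' := by
      rw [← (hΦmem z ε hε).2, ← (hΦmem z' ε' hε').2, h]
    subst h1
    rw [hΦinj _ hε h]
  · rintro ⟨x, ε⟩ ⟨-, hε⟩
    have h1 : AnalyticAt ℝ (fun z : (Fin 2 → ℝ) × Chaplygin.Param => ι z.2) (x, ε) :=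
      AnalyticAt.fun_comp (g := ι) (f := fun z : (Fin 2 → ℝ) × Chaplygin.Param => z.2)
        (x := (x, ε)) (hιa ε) analyticAt_snd
    exact AnalyticAt.fun_comp (f := fun z : (Fin 2 → ℝ) × Chaplygin.Param => (z.1, ι z.2))
      (hΦan (x, ι ε) ⟨Set.mem_univ _, hε⟩) (analyticAt_fst.prod h1)
  · rintro _ ⟨⟨z, ε⟩, ⟨-, hε⟩, rfl⟩
    obtain ⟨g, hga, hg'⟩ := hg z (ι ε) hε
    -- On `M` the value `(g q).2` lies on the slice automatically, so dropping its six matrix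
    -- entries loses nothing there.
    refine ⟨fun q => ((g q).1, (g q).2.1), (analyticAt_fst.fun_comp hga).prod
      (analyticAt_fst.fun_comp (analyticAt_snd.fun_comp hga)), ?_⟩
    filter_upwards [nhdsWithin_le_nhds hg', self_mem_nhdsWithin] with q hq hqM
    have h1 : q ∈ Chaplygin.phaseSpace := by
      obtain ⟨⟨z', ε'⟩, ⟨-, hε'⟩, rfl⟩ := hqM
      exact (hΦmem z' ε' hε').1
    have h2 := (hΦU (Chaplygin.toTorus (g q).1) _ hq.1).2
    rw [hq.2, hι_inv q h1] at h2
    have h3 : ι (g q).2.1 = (g q).2 := by rw [← h2, hι]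
    refine ⟨?_, ?_⟩
    · change ι _ ∈ E
      rw [h3]
      exact hq.1
    · rw [h3]
      exact hq.2
  · intro z ε hε
    -- The torus is connected and compact, and the local inverses show that it is open in the level
    -- set.
    refine eq_connectedComponentIn_of_eventually (isPreconnected_range (hcont ε hε))
      (isCompact_range (hcont ε hε)).isClosed ?_ ?_ (Set.mem_range_self z)
    · rintro _ ⟨y, rfl⟩
      exact hΦmem y ε hε
    · rintro _ ⟨y, rfl⟩
      obtain ⟨g, -, hg'⟩ := hg y (ι ε) hε
      filter_upwards [hg'] with q hq hqL
      have h2 := (hΦU (Chaplygin.toTorus (g q).1) _ hq.1).2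
      rw [hq.2, hι_inv q hqL.1, hqL.2] at h2
      exact ⟨Chaplygin.toTorus (g q).1, by rw [h2]; exact hq.2⟩
  · intro z ε hε
    have hq := (hΦmem z ε hε).1
    refine ⟨Chaplygin.field₁ I ρ (Φ z (ι ε)), Chaplygin.isVelocity_field₁ hI hρ hq, ?_⟩
    rw [← Chaplygin.conf_eq_X hq]
    simp only [hflow z (ι ε) hε]
    exact hG.hasDerivAt _ (hΦU z _ hε).1 0
  · rintro γ hγ ⟨⟨z, ε⟩, ⟨-, hε⟩, hz⟩ τ hτ
    -- The time variable need not vanish at `t = 0`; the shift by `-τ 0` compensates for this.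
    refine ⟨z + Chaplygin.toTorus (-τ 0 • ν (ι ε)), ε, hε, fun t => ?_⟩
    change Φ z (ι ε) = γ 0 at hz
    rw [hγ.eq_apply hI hρ hG hτ t, ← hz, ← hflow z (ι ε) hε, add_assoc, ← Chaplygin.toTorus_add,
      ← add_smul]
    congr 4
    ring
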